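/- Let $K$ be a field, let $Q$ be a finite quiver, and let $I$ be a two-sided ideal of the path algebra $KQ$ that is generated by a set of paths of length at least two, such that the monomial algebra $\Lambda=KQ/I$ is finite dimensional over $K$. Suppose that $\Lambda$ is indecomposable as an algebra, that is, $\Lambda\neq 0$ and the only central idempotents of $\Lambda$ are $0$ and $1$. Let $\mathfrak r$ be the Jacobson radical of $\Lambda$ and let $$E(\Lambda)=\bigoplus_{n\ge 0}\operatorname{Ext}^n_\Lambda(\Lambda/\mathfrak r,\Lambda/\mathfrak r)$$ be the Ext algebra of the right $\Lambda$-module $\Lambda/\mathfrak r$, with the Yoneda product. Let $Z_{\mathrm{gr}}(E(\Lambda))$ be the graded centre of $E(\Lambda)$, that is, the subring of $E(\Lambda)$ generated by all homogeneous elements $z$ such that $zg=(-1)^{|z||g|}gz$ for every homogeneous element $g$ of $E(\Lambda)$, where $|x|$ denotes the degree of $x$; it is a $K$-subalgebra of $E(\Lambda)$. Let $\mathcal N_Z$ be the ideal of $Z_{\mathrm{gr}}(E(\Lambda))$ generated by the homogeneous nilpotent elements of $Z_{\mathrm{gr}}(E(\Lambda))$. Then $Z_{\mathrm{gr}}(E(\Lambda))/\mathcal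 N_Z$ is a commutative, finitely generated $K$-algebra of Krull dimension at most one. -/

import Mathlib

open CategoryTheory CategoryTheory.Abelian
open scoped DirectSum

universe u v w

noncomputable section

/-! ## Path algebras and monomial algebras -/

/-- A path of a quiver, together with its source and its target. -/
structure QuiverPath (V : Type u) [Quiver.{v} V] where
  source : V
  target : V
  path : Quiver.Path source target

namespace QuiverPath

variable {V : Type u} [Quiver.{v} V]

/-- The length of a path: its number of arrows. -/
def length (p : QuiverPath V) : ℕ := p.path.length

/-- The trivial path at a vertex. -/
def nil (x : V) : QuiverPath V := ⟨x, x, Quiver.Path.nil⟩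

/-- The concatenation `pq` (first `p`, then `q`) of two paths such that `p` ends where `q`
starts. -/
def concat (p q : QuiverPath V) (h : p.target = q.source) : QuiverPath V :=
  ⟨p.source, q.target, p.path.comp (q.path.cast h.symm rfl)⟩

theorem nil_concat (x : V) (p : QuiverPath V) (h : x = p.source) :
    (nil x).concat p h = p := by
  subst h
  simp [concat, nil]

theorem concat_nil (p : QuiverPath V) (x : V) (h : p.target = x) :
    p.concat (nil x) h = p := by
  subst h
  simp [concat, nil]

theorem concat_assoc (p q r : QuiverPath V) (h : p.target = q.source)
    (h' : q.target = r.source) :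
    (p.concat q h).concat r h' = p.concat (q.concat r h') h := by
  obtain ⟨a, b, p⟩ := p
  obtain ⟨c, d, q⟩ := q
  obtain ⟨e, f, r⟩ := r
  dsimp at h h'
  subst h h'
  simp [concat]

end QuiverPath

/-- The path algebra `KQ` of a quiver `Q`, here with set of vertices `V`: the `K`-vector space
whose basis is the set of all paths of `Q`, the trivial ones included. -/
def PathAlgebra (K : Type w) [Field K] (V : Type u) [Quiver.{v} V] : Type (max u v w) :=
  QuiverPath V →₀ K

namespace PathAlgebra

variable (K : Type w) [Field K] {V : Type u} [Quiver.{v} V]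

instance : AddCommGroup (PathAlgebra K V) := inferInstanceAs (AddCommGroup (QuiverPath V →₀ K))

instance : Module K (PathAlgebra K V) := inferInstanceAs (Module K (QuiverPath V →₀ K))

/-- The basis element of the path algebra that is given by a path. -/
def ofPath (p : QuiverPath V) : PathAlgebra K V := Finsupp.single p (1 : K)

open Classical in
/-- The product of two paths: their concatenation if the first ends where the second starts,
and `0` otherwise. -/
def pathMul (p q : QuiverPath V) : PathAlgebra K V :=
  if h : p.target = q.source then ofPath K (p.concat q h) else 0

/-- The bilinear extension of the product of paths. -/
def mulLin : PathAlgebra K V →ₗ[K] PathAlgebra K V →ₗ[K] PathAlgebra K V :=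
  Finsupp.lift (PathAlgebra K V →ₗ[K] PathAlgebra K V) K (QuiverPath V)
    fun p => Finsupp.lift (PathAlgebra K V) K (QuiverPath V) fun q => pathMul K p q

instance : Mul (PathAlgebra K V) := ⟨fun f g => mulLin K f g⟩

/-- The identity: the sum of the trivial paths. -/
instance [Fintype V] : One (PathAlgebra K V) := ⟨∑ x : V, ofPath K (QuiverPath.nil x)⟩

variable {K}

theorem mul_def (f g : PathAlgebra K V) : f * g = mulLin K f g := rfl

theorem one_def [Fintype V] : (1 : PathAlgebra K V) = ∑ x : V, ofPath K (QuiverPath.nil x) := rfl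

theorem ofPath_mul_ofPath (p q : QuiverPath V) : ofPath K p * ofPath K q = pathMul K p q := by
  have h1 : mulLin K (ofPath K p) =
      Finsupp.lift (PathAlgebra K V) K (QuiverPath V) fun q => pathMul K p q := by
    refine (Finsupp.lift_apply _ _ _ _ _).trans ((Finsupp.sum_single_index ?_).trans (one_smul K _))
    exact zero_smul K _
  rw [mul_def, h1]
  refine (Finsupp.lift_apply _ _ _ _ _).trans ((Finsupp.sum_single_index ?_).trans (one_smul K _))
  exact zero_smul K _

theorem hom_ext {M : Type*} [AddCommMonoid M] [Module K M] {f g : PathAlgebra K V →ₗ[K] M}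
    (h : ∀ p, f (ofPath K p) = g (ofPath K p)) : f = g :=
  Finsupp.lhom_ext' fun p => LinearMap.ext_ring (h p)

theorem mul_assoc_aux (f g k : PathAlgebra K V) : f * g * k = f * (g * k) := by
  have h1 : ∀ p q r : QuiverPath V,
      ofPath K p * ofPath K q * ofPath K r = ofPath K p * (ofPath K q * ofPath K r) := by
    intro p q r
    simp only [ofPath_mul_ofPath, pathMul]
    by_cases h : p.target = q.source <;> by_cases h' : q.target = r.source
    · rw [dif_pos h, dif_pos h', ofPath_mul_ofPath, ofPath_mul_ofPath, pathMul, pathMul,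
        dif_pos (show (p.concat q h).target = r.source from h'),
        dif_pos (show p.target = (q.concat r h').source from h), QuiverPath.concat_assoc]
    · rw [dif_pos h, dif_neg h', ofPath_mul_ofPath, pathMul,
        dif_neg (show ¬ (p.concat q h).target = r.source from h')]
      simp [mul_def]
    · rw [dif_neg h, dif_pos h', ofPath_mul_ofPath, pathMul,
        dif_neg (show ¬ p.target = (q.concat r h').source from h)]
      simp [mul_def]
    · rw [dif_neg h, dif_neg h']
      simp [mul_def]
  have h2 : ∀ (p q : QuiverPath V) (k : PathAlgebra K V),
      ofPath K p * ofPath K q * k = ofPath K p * (ofPath K q * k) := fun p q =>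
    LinearMap.congr_fun (f := mulLin K (ofPath K p * ofPath K q))
      (g := (mulLin K (ofPath K p)).comp (mulLin K (ofPath K q))) (hom_ext fun r => h1 p q r)
  have h3 : ∀ (p : QuiverPath V) (g k : PathAlgebra K V),
      ofPath K p * g * k = ofPath K p * (g * k) := fun p g k =>
    LinearMap.congr_fun (f := ((mulLin K).flip k).comp (mulLin K (ofPath K p)))
      (g := (mulLin K (ofPath K p)).comp ((mulLin K).flip k)) (hom_ext fun q => h2 p q k) g
  exact LinearMap.congr_fun (f := ((mulLin K).flip k).comp ((mulLin K).flip g))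
    (g := (mulLin K).flip (g * k)) (hom_ext fun p => h3 p g k) f

theorem one_mul_aux [Fintype V] (f : PathAlgebra K V) : 1 * f = f := by
  classical
  have key : mulLin K (1 : PathAlgebra K V) = LinearMap.id := by
    refine hom_ext fun p => ?_
    change 1 * ofPath K p = ofPath K p
    have h : ∀ x : V, ofPath K (QuiverPath.nil x) * ofPath K p =
        if x = p.source then ofPath K p else 0 := by
      intro x
      rw [ofPath_mul_ofPath, pathMul]
      by_cases hx : x = p.source
      · rw [dif_pos (show (QuiverPath.nil x).target = p.source from hx), if_pos hx,
          QuiverPath.nil_concat]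
      · rw [dif_neg (show ¬ (QuiverPath.nil x).target = p.source from hx), if_neg hx]
    simp only [mul_def] at h
    rw [one_def, mul_def, map_sum, LinearMap.sum_apply]
    simp [h]
  exact congrArg (fun F => F f) key

theorem mul_one_aux [Fintype V] (f : PathAlgebra K V) : f * 1 = f := by
  classical
  have key : (mulLin K).flip (1 : PathAlgebra K V) = LinearMap.id := by
    refine hom_ext fun p => ?_
    change ofPath K p * 1 = ofPath K p
    have h : ∀ x : V, ofPath K p * ofPath K (QuiverPath.nil x) =
        if p.target = x then ofPath K p else 0 := by
      intro x
      rw [ofPath_mul_ofPath, pathMul]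
      by_cases hx : p.target = x
      · rw [dif_pos (show p.target = (QuiverPath.nil x).source from hx), if_pos hx,
          QuiverPath.concat_nil]
      · rw [dif_neg (show ¬ p.target = (QuiverPath.nil x).source from hx), if_neg hx]
    simp only [mul_def] at h
    rw [one_def, mul_def, map_sum]
    simp [h]
  exact congrArg (fun F => F f) key

instance [Fintype V] : Ring (PathAlgebra K V) :=
  { (inferInstance : AddCommGroup (PathAlgebra K V)),
    (inferInstance : Mul (PathAlgebra K V)),
    (inferInstance : One (PathAlgebra K V)) with
    left_distrib := fun f g k => by simp [mul_def]
    right_distrib := fun f g k => by simp [mul_def]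
    zero_mul := fun f => by simp [mul_def]
    mul_zero := fun f => by simp [mul_def]
    mul_assoc := mul_assoc_aux
    one_mul := one_mul_aux
    mul_one := mul_one_aux }

instance [Fintype V] : Algebra K (PathAlgebra K V) :=
  Algebra.ofModule (fun r f g => by simp [mul_def]) (fun r f g => by simp [mul_def])

end PathAlgebra

/-- A two-sided ideal of a path algebra that can be generated by a set of monomials, that is,
of paths, of length at least two. -/
def IsMonomialIdeal {K : Type w} [Field K] {V : Type u} [Fintype V] [Quiver.{v} V]
    (I : TwoSidedIdeal (PathAlgebra K V)) : Prop :=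
  ∃ S : Set (QuiverPath V), (∀ p ∈ S, 2 ≤ p.length) ∧
    I = TwoSidedIdeal.span (PathAlgebra.ofPath K '' S)

/-- A ring (equivalently, an algebra over a field) is indecomposable if it is nonzero and is not
the product of two nonzero rings, that is, its only central idempotents are `0` and `1`. -/
def IsIndecomposableRing (A : Type u) [Ring A] : Prop :=
  Nontrivial A ∧ ∀ e : A, e * e = e → (∀ x : A, e * x = x * e) → e = 0 ∨ e = 1

/-! ## The Ext algebra -/

section SelfExt

variable {C : Type u} [Category.{v} C] [Abelian C] [HasExt.{w} C]

/-- `Ext^n(X, X)`. -/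
abbrev SelfExt (X : C) (n : ℕ) : Type w := Ext X X n

variable (X : C)

theorem SelfExt.comp_eq_cast {m n p q : ℕ} (a : SelfExt X m) (b : SelfExt X n)
    (h : m + n = p) (h' : m + n = q) :
    GradedMonoid.mk (A := SelfExt X) p (a.comp b h) = GradedMonoid.mk q (a.comp b h') := by
  subst h h'
  rfl

/-- The identity of `X` as an element of `Ext^0(X, X)`. -/
instance SelfExt.gone : GradedMonoid.GOne (SelfExt X) where
  one := Ext.mk₀ (𝟙 X)

/-- The Yoneda product on the groups `Ext^n(X, X)`: the product of `a` and `b` is the composite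
"first `a`, then `b`". -/
instance SelfExt.gmul : GradedMonoid.GMul (SelfExt X) where
  mul a b := a.comp b rfl

instance SelfExt.gmonoid : GradedMonoid.GMonoid (SelfExt X) where
  one_mul := fun ⟨n, a⟩ => by
    refine Eq.trans (SelfExt.comp_eq_cast X (Ext.mk₀ (𝟙 X)) a rfl (zero_add n)) ?_
    rw [Ext.mk₀_id_comp]
    rfl
  mul_one := fun ⟨n, a⟩ => by
    refine Eq.trans (SelfExt.comp_eq_cast X a (Ext.mk₀ (𝟙 X)) rfl (add_zero n)) ?_
    rw [Ext.comp_mk₀_id]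
    rfl
  mul_assoc := fun ⟨l, a⟩ ⟨m, b⟩ ⟨n, c⟩ => by
    refine Eq.trans (SelfExt.comp_eq_cast X (a.comp b rfl) c rfl (add_assoc l m n)) ?_
    exact congrArg (GradedMonoid.mk (A := SelfExt X) _)
      (Ext.comp_assoc a b c rfl rfl (add_assoc l m n))

instance SelfExt.gring : DirectSum.GRing (SelfExt X) where
  __ := SelfExt.gmonoid X
  mul_zero a := Ext.comp_zero a X _ _ rfl
  zero_mul b := Ext.zero_comp X _ b _ rfl
  mul_add a b c := Ext.comp_add a b c rfl
  add_mul a b c := Ext.add_comp a b c rfl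
  natCast n := n • Ext.mk₀ (𝟙 X)
  natCast_zero := zero_smul ℕ _
  natCast_succ n := succ_nsmul _ n
  intCast n := n • Ext.mk₀ (𝟙 X)
  intCast_ofNat n := natCast_zsmul _ n
  intCast_negSucc_ofNat n := negSucc_zsmul _ n

/-- The `K`-linear structure of `⨁ Ext^n(X, X)`, for an object `X` of a `K`-linear category. -/
instance SelfExt.galgebra (K : Type*) [Field K] [Linear K C] :
    DirectSum.GAlgebra K (SelfExt X) where
  toFun := (smulAddHom K (SelfExt X 0)).flip (Ext.mk₀ (𝟙 X))
  map_one := one_smul K _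
  map_mul r s := by
    refine congrArg (GradedMonoid.mk (A := SelfExt X) 0) ?_
    change (r * s) • Ext.mk₀ (𝟙 X) =
      Ext.comp (r • Ext.mk₀ (𝟙 X)) (s • Ext.mk₀ (𝟙 X)) (add_zero 0)
    rw [Ext.smul_comp, Ext.comp_smul, Ext.comp_mk₀_id, mul_smul]
  commutes := fun r ⟨n, a⟩ => by
    refine Eq.trans (SelfExt.comp_eq_cast X (r • Ext.mk₀ (𝟙 X)) a rfl (zero_add n)) ?_
    refine Eq.trans ?_ (SelfExt.comp_eq_cast X a (r • Ext.mk₀ (𝟙 X)) (add_zero n) rfl)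
    rw [Ext.smul_comp, Ext.comp_smul, Ext.mk₀_id_comp, Ext.comp_mk₀_id]
  smul_def := fun r ⟨n, a⟩ => by
    refine Eq.trans ?_
      (SelfExt.comp_eq_cast X (r • Ext.mk₀ (𝟙 X)) a (zero_add n) rfl)
    rw [Ext.smul_comp, Ext.mk₀_id_comp]
    rfl

end SelfExt

/-- The Jacobson radical `r` of `A` as a submodule of the right `A`-module `A`. -/
def rightRadical (A : Type u) [Ring A] : Submodule Aᵐᵒᵖ A where
  carrier := {x | x ∈ Ring.jacobson A}
  add_mem' := fun ha hb => (Ring.jacobson A).add_mem ha hb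
  zero_mem' := (Ring.jacobson A).zero_mem
  smul_mem' := fun c _ hx => 
    (Ring.jacobson A).mul_mem_right c.unop hx

/-- The right `A`-module `A / r`, where `r` is the Jacobson radical of `A`. -/
abbrev topModule (A : Type u) [Ring A] : ModuleCat.{u} Aᵐᵒᵖ :=
  ModuleCat.of Aᵐᵒᵖ (A ⧸ rightRadical A)

/-- The Ext algebra `E(A) = ⨁ Ext^n_A(A / r, A / r)` with the Yoneda product. -/
abbrev ExtAlgebra (A : Type u) [Ring A] : Type u :=
  ⨁ n : ℕ, SelfExt (topModule A) n

/-! ## The graded centre modulo nilpotents -/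

section GradedCentre

variable (K : Type w) [Field K] (A : Type u) [Ring A] [Algebra K A]

/-- The inclusion `Ext^n_A(A / r, A / r) → E(A)` of the elements of degree `n`. -/
abbrev ExtAlgebra.of (n : ℕ) (x : SelfExt (topModule A) n) : ExtAlgebra A :=
  DirectSum.of (SelfExt (topModule A)) n x

/-- The homogeneous elements `z` of `E(A)` such that `z g = (-1)^(|z||g|) g z` for all
homogeneous `g`. -/
def gradedCentral : Set (ExtAlgebra A) :=
  {z | ∃ (m : ℕ) (x : SelfExt (topModule A) m), z = ExtAlgebra.of A m x ∧
    ∀ (n : ℕ) (y : SelfExt (topModule A) n),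
      z * ExtAlgebra.of A n y = (-1) ^ (m * n) * (ExtAlgebra.of A n y * z)}

theorem algebraMap_mem_gradedCentral (r : K) :
    algebraMap K (ExtAlgebra A) r ∈ gradedCentral A := by
  refine ⟨0, DirectSum.GAlgebra.toFun r, rfl, fun n y => ?_⟩
  rw [zero_mul, pow_zero, one_mul]
  exact Algebra.commutes r _

/-- The graded centre of `E(A)`: the subring that is generated by the homogeneous elements `z`
such that `z g = (-1)^(|z||g|) g z` for all homogeneous `g`. It contains `K`, and is regarded as
a `K`-subalgebra. -/
def gradedCentre : Subalgebra K (ExtAlgebra A) :=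
  { (Subring.closure (gradedCentral A)).toSubsemiring with
    algebraMap_mem' := fun r =>
      Subring.subset_closure (algebraMap_mem_gradedCentral K A r) }

/-- The two-sided ideal of the graded centre that is generated by its homogeneous nilpotent
elements. -/
def nilpotentIdeal : TwoSidedIdeal (gradedCentre K A) :=
  TwoSidedIdeal.span {z | IsNilpotent z ∧
    ∃ (m : ℕ) (x : SelfExt (topModule A) m), (z : ExtAlgebra A) = ExtAlgebra.of A m x}

/-- The graded centre of `E(A)` modulo the ideal generated by the homogeneous nilpotents. -/
abbrev GradedCentreModNil : Type u := (nilpotentIdeal K A).ringCon.Quotient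

end GradedCentre

end

/-! The minimal projective resolution of the top is indexed by chains: words s₁s₂…sₙ in which s₁ is
an arrow and every further sᵢ is a nonzero path, minimal with the property that sᵢ₋₁sᵢ = 0. The
kernel of left multiplication by a path is spanned by the paths it kills, so exactness is
combinatorial; minimality makes the chains of degree n a basis of Extⁿ (`toExt_bijective`). An
explicit comparison of resolutions shows that the Yoneda product of two chains is their
concatenation if this is a chain of the right degree, and 0 otherwise (`toExt_comp_toExt`).

Two properties of words carry the rest: the chains of a fixed degree form a prefix code
(`Chain.eq_of_prefix`), and whether a chain can be continued by a chain of degree two depends only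
on its last piece (`Chain.exists_concat_two`, `Chain.path_eq_zero_of_concat`). `WordGrading`
axiomatizes what is needed.

Let z be homogeneous and central of positive degree. By the prefix property, powers of z have no
cross terms, so z is nilpotent as soon as all its words are (`Central.isNilpotent`). Call a
non-nilpotent word of z essential. Rotating essential words by their beginnings of degree two shows
that two of them with the same beginning have a common power (`Essential.rep_eq`). So for every word
d of degree two there is at most one essential word in each degree whose square begins with d, and
taking its coefficient is multiplicative (`leadCoeff_mul`). These functionals, with the coordinates
at the vertices in degree zero, map the graded centre to a finite product of polynomial rings K[X],
with the ideal of homogeneous nilpotents as kernel (`exists_algHom`).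

The quotient is thus a graded subalgebra of a finite product of copies of K[X]. Such an algebra is
commutative, finitely generated (`finiteType_of_graded`) and of Krull dimension at most one
(`ringKrullDim_subalgebra_le_one`), because K[X] is integral over K[q] for every nonconstant q. -/

noncomputable section

/-! ## Algebras with a basis of words -/

/-- A presentation of an algebra by vertices and arrows such that the nonzero paths form a
basis. -/
structure MonomialPresentation (K : Type*) [Field K] (A : Type*) [Ring A] [Algebra K A]
    (V : Type u) [Fintype V] (α : Type v) where
  src : α → V
  tgt : α → V
  vert : V → A
  arrow : α → A
  vert_mul_self : ∀ x, vert x * vert x = vert x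
  vert_mul_of_ne : ∀ {x y}, x ≠ y → vert x * vert y = 0
  sum_vert : ∑ x, vert x = 1
  vert_mul_arrow : ∀ a, vert (src a) * arrow a = arrow a
  arrow_mul_vert : ∀ a, arrow a * vert (tgt a) = arrow a
  vert_ne_zero : ∀ x, vert x ≠ 0
  coeff : V → List α → A →ₗ[K] K
  coeff_self : ∀ x l, vert x * (l.map arrow).prod ≠ 0 →
    coeff x l (vert x * (l.map arrow).prod) = 1
  coeff_of_ne : ∀ {x y l m}, (x, l) ≠ (y, m) → coeff x l (vert y * (m.map arrow).prod) = 0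
  span_eq_top : Submodule.span K
    (Set.range fun p : V × List α => vert p.1 * (p.2.map arrow).prod) = ⊤
  finite_paths : {p : V × List α | vert p.1 * (p.2.map arrow).prod ≠ 0}.Finite

namespace MonomialPresentation

variable {K : Type*} [Field K] {A : Type*} [Ring A] [Algebra K A]
  {V : Type u} [Fintype V] {α : Type v} (M : MonomialPresentation K A V α)

/-- The element of the algebra given by a word, read from the vertex `x`. -/
def path (x : V) (l : List α) : A := M.vert x * (l.map M.arrow).prod

/-- The vertex that is reached from `x` along a word. -/
def endpoint (x : V) (l : List α) : V := l.foldl (fun _ a => M.tgt a) x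

@[simp] theorem endpoint_nil (x : V) : M.endpoint x [] = x := rfl

@[simp] theorem endpoint_cons (x : V) (a : α) (l : List α) :
    M.endpoint x (a :: l) = M.endpoint (M.tgt a) l := rfl

theorem endpoint_append (x : V) (l m : List α) :
    M.endpoint x (l ++ m) = M.endpoint (M.endpoint x l) m := by
  simp [endpoint, List.foldl_append]

@[simp] theorem path_nil (x : V) : M.path x [] = M.vert x := by simp [path]

theorem span_path : Submodule.span K (Set.range fun p : V × List α => M.path p.1 p.2) = ⊤ :=
  M.span_eq_top

theorem coeff_path_self {x : V} {l : List α} (h : M.path x l ≠ 0) :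
    M.coeff x l (M.path x l) = 1 := M.coeff_self x l h

theorem coeff_path_of_ne {x y : V} {l m : List α} (h : (x, l) ≠ (y, m)) :
    M.coeff x l (M.path y m) = 0 := M.coeff_of_ne h

/-- To prove an identity between linear maps, it is enough to check it on paths. -/
theorem linear_ext {W : Type*} [AddCommGroup W] [Module K W] {f g : A →ₗ[K] W}
    (h : ∀ x l, f (M.path x l) = g (M.path x l)) : f = g :=
  LinearMap.ext_on_range M.span_path fun p => h p.1 p.2

/-- The functional vanishes on every path: on the others by `coeff_path_of_ne`, on its own because
that path is zero. -/
theorem coeff_eq_zero {x : V} {l : List α} (h : M.path x l = 0) : M.coeff x l = 0 := by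
  refine M.linear_ext fun y m => ?_
  by_cases e : (x, l) = (y, m)
  · cases e; simp [h]
  · simpa using M.coeff_path_of_ne e

theorem vert_mul_path_self (x : V) (l : List α) : M.vert x * M.path x l = M.path x l := by
  rw [path, ← mul_assoc, M.vert_mul_self]

theorem vert_mul_path_of_ne {x y : V} (h : x ≠ y) (l : List α) : M.vert x * M.path y l = 0 := by
  rw [path, ← mul_assoc, M.vert_mul_of_ne h, zero_mul]

theorem path_append (x : V) (l m : List α) :
    M.path x (l ++ m) = M.path x l * M.path (M.endpoint x l) m := by
  have key : ∀ (l : List α) (x : V), M.path x l * M.vert (M.endpoint x l) = M.path x l := by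
    intro l
    induction l using List.reverseRecOn with
    | nil => intro x; simp [M.vert_mul_self]
    | append_singleton l a _ =>
      intro x
      simp [path, endpoint_append, mul_assoc, M.arrow_mul_vert]
  have : M.path x (l ++ m) = M.path x l * (m.map M.arrow).prod := by
    simp [path, mul_assoc]
  rw [this, path.eq_def M (M.endpoint x l) m, ← mul_assoc, key]

theorem path_mul_vert (x : V) (l : List α) :
    M.path x l * M.vert (M.endpoint x l) = M.path x l := by
  have := M.path_append x l []
  simpa using this.symm

theorem path_mul_path_of_ne {x y : V} {l : List α} (h : M.endpoint x l ≠ y) (m : List α) :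
    M.path x l * M.path y m = 0 := by
  rw [← M.path_mul_vert x l, mul_assoc, M.vert_mul_path_of_ne h, mul_zero]

theorem path_cons_of_ne {x : V} {a : α} (h : x ≠ M.src a) (l : List α) :
    M.path x (a :: l) = 0 := by
  rw [path, List.map_cons, List.prod_cons, ← M.vert_mul_arrow a, mul_assoc, ← mul_assoc,
    M.vert_mul_of_ne h, zero_mul]

theorem path_eq_zero_of_prefix {x : V} {l m : List α} (h : l <+: m) (hl : M.path x l = 0) :
    M.path x m = 0 := by
  obtain ⟨r, rfl⟩ := h
  rw [path_append, hl, zero_mul]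

theorem path_eq_zero_of_right {x : V} {l m : List α} (h : M.path (M.endpoint x l) m = 0) :
    M.path x (l ++ m) = 0 := by
  rw [path_append, h, mul_zero]

theorem path_ne_zero_of_prefix {x : V} {l m : List α} (h : l <+: m) (hm : M.path x m ≠ 0) :
    M.path x l ≠ 0 := fun h0 => hm (M.path_eq_zero_of_prefix h h0)

/-- The left factor of a product of paths can be stripped off a coefficient. -/
theorem coeff_path_mul {x : V} {t l : List α} (h : M.path x (t ++ l) ≠ 0) (a : A) :
    M.coeff x (t ++ l) (M.path x t * a) = M.coeff (M.endpoint x t) l a := by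
  suffices (M.coeff x (t ++ l)).comp (LinearMap.mulLeft K (M.path x t)) =
      M.coeff (M.endpoint x t) l from LinearMap.congr_fun this a
  refine M.linear_ext fun y m => ?_
  simp only [LinearMap.comp_apply, LinearMap.mulLeft_apply]
  by_cases hy : M.endpoint x t = y
  · subst hy
    rw [← path_append]
    by_cases hm : l = m
    · subst hm
      rw [M.coeff_path_self h, M.coeff_path_self]
      exact fun h0 => h (M.path_eq_zero_of_right h0)
    · rw [M.coeff_path_of_ne (by simpa using hm), M.coeff_path_of_ne (by simpa using hm)]
  · rw [M.path_mul_path_of_ne hy, map_zero, M.coeff_path_of_ne (by simp [hy])]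

/-- Left multiplication by `M.path x t` sends a path to zero or to a path from `x` whose word begins
with `t`. -/
theorem coeff_path_mul_of_not_prefix {x y : V} {t q : List α} (h : ¬(x = y ∧ t <+: q)) (a : A) :
    M.coeff y q (M.path x t * a) = 0 := by
  suffices (M.coeff y q).comp (LinearMap.mulLeft K (M.path x t)) = 0 from
    LinearMap.congr_fun this a
  refine M.linear_ext fun z m => ?_
  simp only [LinearMap.comp_apply, LinearMap.mulLeft_apply, LinearMap.zero_apply]
  by_cases hy : M.endpoint x t = z
  · subst hy
    rw [← path_append]
    refine M.coeff_path_of_ne fun e => h ?_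
    simp only [Prod.mk.injEq] at e
    exact ⟨e.1.symm, e.2 ▸ List.prefix_append _ _⟩
  · rw [M.path_mul_path_of_ne hy, map_zero]

/-- The set of nonzero paths, as a finite set. -/
def support : Finset (V × List α) := M.finite_paths.toFinset

theorem mem_support {p : V × List α} : p ∈ M.support ↔ M.path p.1 p.2 ≠ 0 := by
  simp [support, path]

theorem sum_coeff_smul_path (a : A) :
    ∑ p ∈ M.support, M.coeff p.1 p.2 a • M.path p.1 p.2 = a := by
  suffices ∑ p ∈ M.support, (M.coeff p.1 p.2).smulRight (M.path p.1 p.2) = LinearMap.id by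
    simpa using LinearMap.congr_fun this a
  refine M.linear_ext fun x l => ?_
  simp only [LinearMap.sum_apply, LinearMap.smulRight_apply, LinearMap.id_apply]
  by_cases h : M.path x l = 0
  · simp [h]
  rw [Finset.sum_eq_single (x, l)]
  · simp [M.coeff_path_self h]
  · rintro ⟨y, m⟩ _ hne
    rw [M.coeff_path_of_ne hne, zero_smul]
  · intro h0
    exact absurd (M.mem_support.2 h) h0

theorem ext_coeff {a b : A} (h : ∀ x l, M.coeff x l a = M.coeff x l b) : a = b := by
  rw [← M.sum_coeff_smul_path a, ← M.sum_coeff_smul_path b]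
  simp [h]

theorem coeff_vert_mul_self (x : V) (l : List α) (a : A) :
    M.coeff x l (M.vert x * a) = M.coeff x l a := by
  by_cases h : M.path x l = 0
  · simp [M.coeff_eq_zero h]
  · simpa using M.coeff_path_mul (t := []) (l := l) (x := x) (by simpa using h) a

theorem coeff_vert_mul_of_ne {x y : V} (h : x ≠ y) (l : List α) (a : A) :
    M.coeff y l (M.vert x * a) = 0 := by
  simpa using M.coeff_path_mul_of_not_prefix (t := []) (q := l) (x := x) (y := y)
    (by simp [h]) a

theorem coeff_of_vert_mul_eq {x y : V} (h : x ≠ y) {a : A} (ha : M.vert x * a = a)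
    (l : List α) : M.coeff y l a = 0 := by
  rw [← ha, M.coeff_vert_mul_of_ne h]

/-- The coefficient at a trivial path is multiplicative. -/
theorem coeff_nil_mul (x : V) (a b : A) :
    M.coeff x [] (a * b) = M.coeff x [] a * M.coeff x [] b := by
  suffices (M.coeff x []).comp (LinearMap.mulRight K b) =
      (M.coeff x []).smulRight (M.coeff x [] b) from LinearMap.congr_fun this a
  refine M.linear_ext fun y m => ?_
  simp only [LinearMap.comp_apply, LinearMap.mulRight_apply, LinearMap.smulRight_apply,
    smul_eq_mul]
  by_cases h : (x, ([] : List α)) = (y, m)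
  · cases h
    rw [M.coeff_path_self (by simpa using M.vert_ne_zero x), one_mul, path_nil,
      M.coeff_vert_mul_self]
  · rw [M.coeff_path_of_ne h, zero_mul, M.coeff_path_mul_of_not_prefix]
    simp only [List.prefix_nil]
    rintro ⟨rfl, rfl⟩
    exact h rfl

theorem coeff_nil_vert [DecidableEq V] (x y : V) :
    M.coeff x [] (M.vert y) = if x = y then 1 else 0 := by
  split_ifs with h
  · subst h
    simpa using M.coeff_path_self (x := x) (l := []) (by simpa using M.vert_ne_zero x)
  · simpa using M.coeff_path_of_ne (x := x) (y := y) (l := []) (m := []) (by simpa using h)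

theorem coeff_nil_one (x : V) : M.coeff x [] (1 : A) = 1 := by
  classical
  rw [← M.sum_vert, map_sum]
  simp [M.coeff_nil_vert]

/-! ### The Jacobson radical. -/

/-- The coefficient at the trivial path at a vertex, as a ring homomorphism. -/
def character (x : V) : A →+* K where
  toFun := M.coeff x []
  map_one' := M.coeff_nil_one x
  map_mul' := M.coeff_nil_mul x
  map_zero' := map_zero _
  map_add' := map_add _

/-- Each term of `a` strips a nonempty prefix off the word, and what remains is too short for `b`.
-/
theorem coeff_mul_eq_zero_of_length {n : ℕ} {a b : A}
    (ha : ∀ x l, l.length < 1 → M.coeff x l a = 0) (hb : ∀ x l, l.length < n → M.coeff x l b = 0)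
    (x : V) (l : List α) (hl : l.length < n + 1) : M.coeff x l (a * b) = 0 := by
  rw [← M.sum_coeff_smul_path a, Finset.sum_mul, map_sum]
  refine Finset.sum_eq_zero fun p _ => ?_
  obtain ⟨y, m⟩ := p
  rw [smul_mul_assoc, map_smul]
  by_cases hm : m.length < 1
  · rw [ha y m hm, zero_smul]
  by_cases hp : y = x ∧ m <+: l
  · obtain ⟨rfl, r, rfl⟩ := hp
    by_cases h0 : M.path y (m ++ r) = 0
    · simp [M.coeff_eq_zero h0]
    · rw [M.coeff_path_mul h0, hb, smul_zero]
      simp only [List.length_append] at hl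
      omega
  · rw [M.coeff_path_mul_of_not_prefix hp, smul_zero]

/-- The `n`-th power only involves words of length at least `n`, and the lengths of the finitely
many nonzero paths are bounded. -/
theorem isNilpotent_of_coeff_nil {a : A} (ha : ∀ x, M.coeff x [] a = 0) : IsNilpotent a := by
  have h1 : ∀ x l, l.length < 1 → M.coeff x l a = 0 := fun x l hl => by
    rw [Nat.lt_one_iff, List.length_eq_zero_iff] at hl
    rw [hl, ha]
  have h2 : ∀ n x l, l.length < n → M.coeff x l (a ^ n) = 0 := by
    intro n
    induction n with
    | zero => intro x l hl; omega
    | succ n ih =>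
      rw [pow_succ']
      exact M.coeff_mul_eq_zero_of_length h1 ih
  obtain ⟨N, hN⟩ := (M.support.image fun p => p.2.length).bddAbove
  refine ⟨N + 1, M.ext_coeff fun x l => ?_⟩
  rw [map_zero]
  by_cases h0 : M.path x l = 0
  · simp [M.coeff_eq_zero h0]
  · exact h2 _ _ _ (Nat.lt_succ_of_le (hN (Finset.mem_coe.2
      (Finset.mem_image_of_mem (fun p : V × List α => p.2.length)
        ((M.mem_support (p := (x, l))).2 h0)))))

/-- The kernels of the characters are maximal left ideals. Conversely, if all characters vanish on
`a`, they vanish on each `b * a`, which is then nilpotent; so `1 - b * a` is a unit and no maximal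
left ideal can omit `a`. -/
theorem mem_jacobson_iff {a : A} : a ∈ Ring.jacobson A ↔ ∀ x, M.coeff x [] a = 0 := by
  rw [Ring.jacobson_eq_sInf_isMaximal, Submodule.mem_sInf]
  constructor
  · intro h x
    refine h (RingHom.ker (M.character x)) (RingHom.ker_isMaximal_of_surjective _ fun c => ?_)
    refine ⟨algebraMap K A c, ?_⟩
    change M.coeff x [] (algebraMap K A c) = c
    rw [Algebra.algebraMap_eq_smul_one, map_smul, M.coeff_nil_one, smul_eq_mul, mul_one]
  · intro h I hI
    by_contra ha
    obtain ⟨b, hb⟩ := hI.exists_inv ha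
    obtain ⟨i, hi, hbi⟩ := hb
    have hn : IsNilpotent (b * a) := M.isNilpotent_of_coeff_nil fun x => by
      rw [M.coeff_nil_mul, h x, mul_zero]
    have hu : IsUnit i := by
      have := hn.isUnit_one_sub
      rwa [show 1 - b * a = i by rw [← hbi]; abel] at this
    exact hI.ne_top (Ideal.eq_top_of_isUnit_mem _ hi hu)

end MonomialPresentation

/-! ## Chains -/

namespace MonomialPresentation

section Chains

variable {K : Type*} [Field K] {A : Type*} [Ring A] [Algebra K A]
  {V : Type u} [Fintype V] {α : Type v} (M : MonomialPresentation K A V α)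

/-- A state `σ = (x, t)` kills a word `l` if the path `t l` from `x` is zero; a state with trivial
`t` kills the words of positive length. -/
def Kills (σ : V × List α) (l : List α) : Prop :=
  if σ.2 = [] then l ≠ [] else M.path σ.1 (σ.2 ++ l) = 0

/-- The minimal words that are killed by a state. -/
def Next (σ : V × List α) (s : List α) : Prop :=
  M.path (M.endpoint σ.1 σ.2) s ≠ 0 ∧ s ≠ [] ∧ M.Kills σ s ∧
    ∀ r, r <+: s → r ≠ s → ¬M.Kills σ r

variable {M}

theorem Kills.of_prefix {σ : V × List α} {l m : List α} (h : M.Kills σ l) (hl : l <+: m) :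
    M.Kills σ m := by
  unfold Kills at *
  split_ifs at h ⊢
  · rintro rfl
    exact h (List.prefix_nil.1 hl)
  · exact M.path_eq_zero_of_prefix (List.prefix_append_right_inj _ |>.2 hl) h

/-- Two prefixes of one word are comparable, and minimality excludes a proper inclusion. All
uniqueness statements on chains rest on this prefix property. -/
theorem Next.eq_of_prefix {σ : V × List α} {s t l : List α} (hs : M.Next σ s) (ht : M.Next σ t)
    (hsl : s <+: l) (htl : t <+: l) : s = t := by
  rcases List.prefix_or_prefix_of_prefix hsl htl with h | h
  · by_contra hne
    exact ht.2.2.2 s h hne hs.2.2.1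
  · by_contra hne
    exact hs.2.2.2 t h (Ne.symm hne) ht.2.2.1

theorem not_kills_nil {σ : V × List α} (h : M.path σ.1 σ.2 ≠ 0) : ¬M.Kills σ [] := by
  unfold Kills
  split_ifs <;> simp [h]

/-- A killed nonzero word has a minimal killed prefix. -/
theorem Kills.exists_next {σ : V × List α} (hσ : M.path σ.1 σ.2 ≠ 0) {l : List α}
    (hl : M.Kills σ l) (h0 : M.path (M.endpoint σ.1 σ.2) l ≠ 0) :
    ∃ s, M.Next σ s ∧ s <+: l := by
  classical
  have hex : ∃ n, M.Kills σ (l.take n) := ⟨l.length, by rwa [List.take_length]⟩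
  have hpre : l.take (Nat.find hex) <+: l := List.take_prefix _ _
  refine ⟨l.take (Nat.find hex), ⟨M.path_ne_zero_of_prefix hpre h0, ?_, Nat.find_spec hex, ?_⟩,
    hpre⟩
  · intro h
    exact not_kills_nil hσ (h ▸ Nat.find_spec hex)
  · intro r hr hne hk
    have hrl : r = l.take r.length := List.prefix_iff_eq_take.1 (hr.trans hpre)
    have hlt : r.length < Nat.find hex := by
      by_contra hge
      refine hne (hr.eq_of_length_le ?_)
      rw [List.length_take]
      omega
    exact Nat.find_min hex hlt (hrl ▸ hk)

variable (M)

/-- The chains of degree `n`, together with their states. -/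
def chainAux : ℕ → Σ T : Type (max u v), T → V × List α
  | 0 => ⟨ULift V, fun x => (x.down, [])⟩
  | n + 1 => ⟨Σ γ : (chainAux n).1, {s : List α // M.Next ((chainAux n).2 γ) s},
      fun δ => (M.endpoint ((chainAux n).2 δ.1).1 ((chainAux n).2 δ.1).2, δ.2.1)⟩

/-- The chains of degree `n`: vertices for `n = 0`, and sequences of minimal killed words in
general. -/
def Chain (n : ℕ) : Type (max u v) := (M.chainAux n).1

variable {M}

/-- The state of a chain: its last word, and the vertex where that word starts. -/
def Chain.state {n : ℕ} (γ : M.Chain n) : V × List α := (M.chainAux n).2 γ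

/-- The vertex where a chain ends. -/
def Chain.target {n : ℕ} (γ : M.Chain n) : V := M.endpoint γ.state.1 γ.state.2

variable (M) in
/-- The trivial chain at a vertex. -/
def Chain.nil (x : V) : M.Chain 0 := ULift.up x

/-- The extension of a chain by a minimal killed word. -/
def Chain.cons {n : ℕ} (γ : M.Chain n) (s : {s : List α // M.Next γ.state s}) :
    M.Chain (n + 1) := ⟨γ, s⟩

/-- The chain without its last word. -/
def Chain.init {n : ℕ} (γ : M.Chain (n + 1)) : M.Chain n := Sigma.fst γ

/-- The last word of a chain. -/
def Chain.last {n : ℕ} (γ : M.Chain (n + 1)) : {s : List α // M.Next γ.init.state s} :=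
  Sigma.snd γ

@[simp] theorem Chain.init_cons {n : ℕ} (γ : M.Chain n) (s) : (γ.cons s).init = γ := rfl

@[simp] theorem Chain.last_cons {n : ℕ} (γ : M.Chain n) (s) : (γ.cons s).last = s := rfl

@[simp] theorem Chain.state_cons {n : ℕ} (γ : M.Chain n) (s) :
    (γ.cons s).state = (γ.target, s.1) := rfl

@[simp] theorem Chain.target_cons {n : ℕ} (γ : M.Chain n) (s) :
    (γ.cons s).target = M.endpoint γ.target s.1 := rfl

@[simp] theorem Chain.state_nil (x : V) : (Chain.nil M x).state = (x, []) := rfl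

@[simp] theorem Chain.target_nil (x : V) : (Chain.nil M x).target = x := rfl

theorem Chain.cases_zero (γ : M.Chain 0) : ∃ x, γ = Chain.nil M x := ⟨γ.down, rfl⟩

theorem Chain.cases_succ {n : ℕ} (γ : M.Chain (n + 1)) : ∃ δ s, γ = Chain.cons (n := n) δ s :=
  ⟨γ.init, γ.last, rfl⟩

theorem Chain.path_state_ne_zero : ∀ {n : ℕ} (γ : M.Chain n), M.path γ.state.1 γ.state.2 ≠ 0
  | 0, γ => by
    obtain ⟨x, rfl⟩ := γ.cases_zero
    simpa using M.vert_ne_zero x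
  | n + 1, γ => γ.last.2.1

/-- The vertex where a chain starts. -/
def Chain.source : ∀ {n : ℕ}, M.Chain n → V
  | 0, γ => γ.state.1
  | _ + 1, γ => Chain.source γ.init

/-- The word of a chain: the concatenation of its pieces. -/
def Chain.word : ∀ {n : ℕ}, M.Chain n → List α
  | 0, _ => []
  | _ + 1, γ => Chain.word γ.init ++ γ.last.1

@[simp] theorem Chain.source_nil (x : V) : (Chain.nil M x).source = x := rfl

@[simp] theorem Chain.word_nil (x : V) : (Chain.nil M x).word = [] := rfl

@[simp] theorem Chain.source_cons {n : ℕ} (γ : M.Chain n) (s) : (γ.cons s).source = γ.source := rfl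

@[simp] theorem Chain.word_cons {n : ℕ} (γ : M.Chain n) (s) : (γ.cons s).word = γ.word ++ s.1 := rfl

theorem Chain.target_eq {n : ℕ} (γ : M.Chain n) : γ.target = M.endpoint γ.source γ.word := by
  induction n with
  | zero => obtain ⟨x, rfl⟩ := γ.cases_zero; rfl
  | succ n ih =>
    obtain ⟨δ, s, rfl⟩ := γ.cases_succ
    simp [endpoint_append, ih δ]

theorem Chain.length_word_ge {n : ℕ} (γ : M.Chain n) : n ≤ γ.word.length := by
  induction n with
  | zero => simp
  | succ n ih =>
    obtain ⟨δ, s, rfl⟩ := γ.cases_succ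
    have := ih δ
    have hs := List.length_pos_iff.2 s.2.2.1
    simp
    omega

/-- A chain is determined by its degree and its word. -/
theorem Chain.eq_of_prefix {n : ℕ} {γ δ : M.Chain n} (h : γ.source = δ.source) {l : List α}
    (hγ : γ.word <+: l) (hδ : δ.word <+: l) : γ = δ := by
  induction n generalizing l with
  | zero =>
    obtain ⟨x, rfl⟩ := γ.cases_zero
    obtain ⟨y, rfl⟩ := δ.cases_zero
    simp at h
    rw [h]
  | succ n ih =>
    obtain ⟨γ, s, rfl⟩ := γ.cases_succ
    obtain ⟨δ, t, rfl⟩ := δ.cases_succ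
    obtain rfl : γ = δ := ih h ((List.prefix_append _ _).trans hγ)
      ((List.prefix_append _ _).trans hδ)
    obtain ⟨r, rfl⟩ : γ.word <+: l := (List.prefix_append _ _).trans hγ
    have hst : s = t := by
      apply Subtype.ext
      simp only [Chain.word_cons, List.prefix_append_right_inj] at hγ hδ
      exact s.2.eq_of_prefix t.2 hγ hδ
    rw [hst]

theorem Chain.ext {n : ℕ} {γ δ : M.Chain n} (h : γ.source = δ.source) (hw : γ.word = δ.word) :
    γ = δ := Chain.eq_of_prefix h (List.prefix_refl _) (hw ▸ List.prefix_refl _)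

/-- The truncation of a chain. -/
theorem Chain.exists_truncation {n m : ℕ} (h : m ≤ n) (γ : M.Chain n) :
    ∃ δ : M.Chain m, δ.source = γ.source ∧ δ.word <+: γ.word := by
  induction h with
  | refl => exact ⟨γ, rfl, List.prefix_refl _⟩
  | step h ih =>
    obtain ⟨δ, h1, h2⟩ := ih γ.init
    exact ⟨δ, h1, h2.trans (List.prefix_append _ _)⟩

theorem Chain.kills_of_pos {n : ℕ} (γ : M.Chain (n + 1)) (l : List α) :
    M.Kills γ.state l ↔ M.path γ.init.target (γ.last.1 ++ l) = 0 := by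
  rw [Kills, if_neg (by exact γ.last.2.2.1)]
  rfl

theorem Chain.kills_zero (x : V) (l : List α) : M.Kills (Chain.nil M x).state l ↔ l ≠ [] := by
  simp [Kills]

/-- If the word of a chain of degree `m + j` and the concatenation of a chain of degree `m` with a
chain of degree `j` are prefixes of the same word, then the latter is the shorter one. -/
theorem Chain.concat_prefix {m : ℕ} (γ : M.Chain m) : ∀ (j : ℕ) (δ : M.Chain (m + j))
    (η : M.Chain j) (l : List α), δ.source = γ.source → γ.target = η.source → δ.word <+: l →
    γ.word ++ η.word <+: l → γ.word ++ η.word <+: δ.word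
  | 0, δ, η, l, hs, _, hδ, hη => by
    have hη0 : η.word = [] := rfl
    rw [hη0, List.append_nil] at hη ⊢
    rw [Chain.eq_of_prefix (γ := δ) (δ := γ) hs hδ hη]
  | 1, δ, η, l, hs, _, hδ, hη => by
    obtain ⟨δ, t, rfl⟩ := Chain.cases_succ (n := m) δ
    obtain ⟨η, s, rfl⟩ := Chain.cases_succ (n := 0) η
    obtain ⟨x, rfl⟩ := η.cases_zero
    obtain rfl : δ = γ := Chain.eq_of_prefix hs ((List.prefix_append _ _).trans hδ)
      ((List.prefix_append _ _).trans hη)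
    refine List.prefix_of_prefix_length_le hη hδ ?_
    have ht := List.length_pos_iff.2 t.2.2.1
    -- The first word of a chain is a single letter: a trivial state already kills every nonempty
    -- prefix.
    have hs1 : s.1.length ≤ 1 := by
      by_contra hlt
      refine s.2.2.2.2 (s.1.take 1) (List.take_prefix _ _) (fun h => ?_) ?_
      · have := congrArg List.length h
        rw [List.length_take] at this
        omega
      · rw [Chain.kills_zero]
        intro h
        have := congrArg List.length h
        rw [List.length_take, List.length_nil] at this
        omega
    change (δ.word ++ ([] ++ s.1)).length ≤ (δ.word ++ t.1).length
    simp only [List.length_append, List.length_nil]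
    omega
  | j + 2, δ, η, l, hs, hη', hδ, hη => by
    -- The induction descends by two degrees because it compares the zero path `t' t` at the end of
    -- `δ` with the zero path `s' s` at the end of `η`.
    obtain ⟨δ, t, rfl⟩ := Chain.cases_succ (n := m + j + 1) δ
    obtain ⟨δ, t', rfl⟩ := Chain.cases_succ (n := m + j) δ
    obtain ⟨η, s, rfl⟩ := Chain.cases_succ (n := j + 1) η
    obtain ⟨η, s', rfl⟩ := Chain.cases_succ (n := j) η
    obtain ⟨r, hr⟩ := Chain.concat_prefix γ j δ η l hs hη'
      (by simp only [Chain.word_cons, List.append_assoc] at hδ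
          exact (List.prefix_append _ _).trans hδ)
      (by simp only [Chain.word_cons, ← List.append_assoc] at hη
          exact ((List.prefix_append _ _).trans (List.prefix_append _ _)).trans hη)
    -- If `δ` ended first, the zero path `t' t` would lie in a proper prefix of `s' s`. This is
    -- impossible: prefixes of `s'` are nonzero, and so are the longer proper prefixes, by the
    -- minimality of `s`.
    by_contra hcon
    have hpre := (List.prefix_or_prefix_of_prefix hη hδ).resolve_left hcon
    have hne : r ++ t'.1 ++ t.1 ≠ s'.1 ++ s.1 := by
      intro h
      apply hcon
      simp only [Chain.word_cons, ← hr, List.append_assoc] at h ⊢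
      rw [h]
    have hpre' : r ++ t'.1 ++ t.1 <+: s'.1 ++ s.1 := by
      simpa only [Chain.word_cons, ← hr, List.append_assoc, List.prefix_append_right_inj] using hpre
    have hzero : M.path η.target (r ++ (t'.1 ++ t.1)) = 0 := by
      refine M.path_eq_zero_of_right ?_
      have : M.endpoint η.target r = δ.target := by
        have hs' : δ.source = γ.source := hs
        have hη'' : γ.target = η.source := hη'
        rw [δ.target_eq, ← hr, endpoint_append, endpoint_append, hs', ← γ.target_eq, hη'',
          ← η.target_eq]
      rw [this]
      exact (Chain.kills_of_pos (δ.cons t') t.1).1 t.2.2.2.1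
    rw [← List.append_assoc] at hzero
    rcases List.prefix_or_prefix_of_prefix hpre' (List.prefix_append s'.1 s.1) with h | h
    · exact s'.2.1 (M.path_eq_zero_of_prefix h hzero)
    · obtain ⟨q, hq⟩ := h
      rw [← hq] at hpre' hne hzero
      refine s.2.2.2.2 q ((List.prefix_append_right_inj _).1 hpre') (fun h => hne (by rw [h])) ?_
      exact (Chain.kills_of_pos (η.cons s') q).2 hzero

end Chains

end MonomialPresentation

/-! ### Concatenation of chains and the coefficients of the comparison. -/

namespace MonomialPresentation

section Chains

variable {K : Type*} [Field K] {A : Type*} [Ring A] [Algebra K A]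
  {V : Type u} [Fintype V] {α : Type v} {M : MonomialPresentation K A V α}

/-- This lets the comparison of resolutions pass to the next degree. By `Chain.concat_prefix` one
degree lower, the last word `t'` of `δ` starts no earlier than the last word `s'` of `η`, so the
path `s' u t` ends in the zero path `t' t`. -/
theorem Chain.kills_of_concat {m : ℕ} {γ : M.Chain m} : ∀ {j : ℕ} {δ : M.Chain (m + j)}
    {η : M.Chain j} {u t : List α}, δ.source = γ.source → γ.target = η.source →
    δ.word = γ.word ++ η.word ++ u → M.Next δ.state t → M.Kills η.state (u ++ t)
  | 0, δ, η, u, t, _, _, _, ht => by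
    obtain ⟨x, rfl⟩ := η.cases_zero
    rw [Chain.kills_zero]
    simp [ht.2.1]
  | j + 1, δ, η, u, t, hs, hη, hw, ht => by
    obtain ⟨δ, t', rfl⟩ := Chain.cases_succ (n := m + j) δ
    obtain ⟨η, s', rfl⟩ := Chain.cases_succ (n := j) η
    have hs' : δ.source = γ.source := hs
    have hη' : γ.target = η.source := hη
    have hw' : δ.word ++ t'.1 = γ.word ++ (η.word ++ s'.1) ++ u := hw
    obtain ⟨r, hr⟩ := Chain.concat_prefix γ j δ η (δ.word ++ t'.1) hs hη'
      (List.prefix_append _ _) ⟨s'.1 ++ u, by rw [hw']; simp⟩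
    have hrt : r ++ t'.1 = s'.1 ++ u := by
      rw [← hr] at hw'
      simpa only [List.append_assoc, List.append_cancel_left_eq] using hw'
    have hend : M.endpoint η.target r = δ.target := by
      rw [δ.target_eq, ← hr, endpoint_append, endpoint_append, hs', ← γ.target_eq, hη',
        ← η.target_eq]
    rw [Chain.kills_of_pos]
    change M.path η.target (s'.1 ++ (u ++ t)) = 0
    rw [← List.append_assoc, ← hrt, List.append_assoc]
    refine M.path_eq_zero_of_right ?_
    rw [hend]
    exact (Chain.kills_of_pos (δ.cons t') t).1 ht.2.2.1

/-- The last word of a chain of positive degree is a suffix of its word. -/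
theorem Chain.state_suffix {n : ℕ} (γ : M.Chain (n + 1)) : γ.state.2 <:+ γ.word :=
  List.suffix_append _ _

theorem Chain.state_ne_nil {n : ℕ} (γ : M.Chain (n + 1)) : γ.state.2 ≠ [] := γ.last.2.2.1

theorem Chain.target_eq_state {n : ℕ} (γ : M.Chain n) :
    γ.target = M.endpoint γ.state.1 γ.state.2 := rfl

/-- The word of a chain of degree two is a minimal zero path. -/
theorem Chain.two_word (d : M.Chain 2) : ∃ a s, d.word = a :: s ∧ s ≠ [] ∧ M.src a = d.source ∧
    M.path (M.tgt a) s ≠ 0 ∧ M.path d.source (a :: s) = 0 ∧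
    ∀ r, r <+: s → r ≠ s → M.path d.source (a :: r) ≠ 0 := by
  obtain ⟨d, s, rfl⟩ := Chain.cases_succ (n := 1) d
  obtain ⟨d, t, rfl⟩ := Chain.cases_succ (n := 0) d
  obtain ⟨x, rfl⟩ := d.cases_zero
  obtain ⟨t, ht⟩ := t
  obtain ⟨s, hs⟩ := s
  obtain ⟨a, t', rfl⟩ := List.exists_cons_of_ne_nil ht.2.1
  obtain rfl : t' = [] := by
    by_contra h
    refine ht.2.2.2 [a] (by simp) (by simpa using Ne.symm h) ?_
    rw [Chain.kills_zero]
    simp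
  have hk : ∀ l, M.Kills ((Chain.nil M x).cons ⟨[a], ht⟩).state l ↔ M.path x (a :: l) = 0 :=
    fun l => Chain.kills_of_pos ((Chain.nil M x).cons ⟨[a], ht⟩) l
  refine ⟨a, s, rfl, hs.2.1, ?_, hs.1, (hk s).1 hs.2.2.1, fun r hr hne h => ?_⟩
  · by_contra h
    refine ht.1 (M.path_cons_of_ne (Ne.symm h) _)
  · exact hs.2.2.2 r hr hne ((hk r).2 h)

theorem path_append_ne_zero_right {x : V} {l m : List α} (h : M.path x (l ++ m) ≠ 0) :
    M.path (M.endpoint x l) m ≠ 0 := fun h0 => h (M.path_eq_zero_of_right h0)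

/-- A chain whose last word kills the word of a chain of degree two without its last letter can
be continued by the latter. -/
theorem Chain.exists_concat_two {n : ℕ} (γ : M.Chain (n + 1)) (d : M.Chain 2)
    (h : γ.target = d.source) (hk : M.path γ.state.1 (γ.state.2 ++ d.word.dropLast) = 0) :
    ∃ δ : M.Chain (n + 1 + 2), δ.source = γ.source ∧ δ.word = γ.word ++ d.word := by
  obtain ⟨a, s, hd, hs, ha, hs0, hz, hmin⟩ := d.two_word
  have hdrop : d.word.dropLast = a :: s.dropLast := by
    rw [hd, List.dropLast_cons_of_ne_nil hs]
  have hnz : M.path d.source d.word.dropLast ≠ 0 := by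
    rw [hdrop]
    refine hmin _ (List.dropLast_prefix s) fun e => ?_
    have := congrArg List.length e
    have := List.length_pos_iff.2 hs
    rw [List.length_dropLast] at *
    omega
  -- The word of `d` splits as `t` followed by `r z`: `t` is the minimal killed prefix of `d`
  -- without its last letter, and `r z` is minimal among the words killed by `t` because `d` is a
  -- minimal zero path.
  obtain ⟨t, ht, r, hr⟩ := Kills.exists_next γ.path_state_ne_zero (l := d.word.dropLast)
    (by rwa [Kills, if_neg γ.state_ne_nil]) (by rw [← γ.target_eq_state, h]; exact hnz)
  obtain ⟨z, hz'⟩ : ∃ z, d.word = d.word.dropLast ++ [z] :=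
    ⟨d.word.getLast (by simp [hd]), (List.dropLast_append_getLast _).symm⟩
  have hw : d.word = t ++ (r ++ [z]) := by rw [hz', ← hr, List.append_assoc]
  have hw0 : M.path d.source (t ++ (r ++ [z])) = 0 := by rw [← hw, hd]; exact hz
  obtain ⟨b, t', rfl⟩ := List.exists_cons_of_ne_nil ht.2.1
  have hb : a = b ∧ s = t' ++ (r ++ [z]) := by
    rw [hd, List.cons_append] at hw
    exact List.cons.inj hw
  obtain ⟨rfl, hs'⟩ := hb
  let γ' : M.Chain (n + 2) := γ.cons ⟨a :: t', ht⟩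
  have hk' : ∀ l, M.Kills γ'.state l ↔ M.path d.source (a :: t' ++ l) = 0 := fun l => by
    rw [← h]
    exact Chain.kills_of_pos γ' l
  have hnext : M.Next γ'.state (r ++ [z]) := by
    refine ⟨?_, by simp, (hk' _).2 hw0, fun q hq hne hkq => ?_⟩
    · rw [← Chain.target_eq_state, show γ'.target = M.endpoint (M.tgt a) t' from rfl]
      rw [hs'] at hs0
      exact path_append_ne_zero_right hs0
    · have hqr : q <+: r := by
        rcases List.prefix_concat_iff.1 hq with h | h
        · exact absurd h hne
        · exact h
      refine hnz (M.path_eq_zero_of_prefix ?_ ((hk' q).1 hkq))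
      rw [← hr]
      exact (List.prefix_append_right_inj _).2 hqr
  refine ⟨γ'.cons ⟨_, hnext⟩, rfl, ?_⟩
  rw [hw]
  change γ.word ++ (a :: t') ++ (r ++ [z]) = _
  rw [List.append_assoc]

/-- If a chain is continued by a word that starts with the word of a chain of degree two, then
its last word kills the latter without its last letter. -/
theorem Chain.path_eq_zero_of_concat {n k : ℕ} (γ : M.Chain (n + 1)) {l : List α}
    (δ : M.Chain k) (hk : n + 2 ≤ k) (hs : δ.source = γ.source) (hδ : δ.word = γ.word ++ l)
    (d : M.Chain 2) (hd : γ.target = d.source) (hdl : d.word <+: l) :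
    M.path γ.state.1 (γ.state.2 ++ d.word.dropLast) = 0 := by
  -- In degree `n + 2` the chain `δ` is `γ` followed by one word `t`. Being nonzero, `t` cannot
  -- contain the zero path `d`, so it is a prefix of `d` without its last letter.
  obtain ⟨τ, h1, h2⟩ := Chain.exists_truncation hk δ
  obtain ⟨τ, t, rfl⟩ := Chain.cases_succ (n := n + 1) τ
  rw [hδ] at h2
  obtain rfl : τ = γ := Chain.eq_of_prefix (h1.trans hs) ((List.prefix_append _ _).trans h2)
    (List.prefix_append _ _)
  have htl : t.1 <+: l := (List.prefix_append_right_inj _).1 h2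
  obtain ⟨a, s, hds, hs0, -, -, hz, -⟩ := d.two_word
  have hdne : d.word ≠ [] := by simp [hds]
  have ht0 : M.path d.source t.1 ≠ 0 := hd ▸ t.2.1
  have htd : t.1 <+: d.word.dropLast := by
    rcases List.prefix_or_prefix_of_prefix htl hdl with h | h
    · rw [← List.dropLast_append_getLast hdne] at h
      rcases List.prefix_concat_iff.1 h with h' | h'
      · rw [List.dropLast_append_getLast] at h'
        rw [h', hds] at ht0
        exact absurd hz ht0
      · exact h'
    · exact absurd (M.path_eq_zero_of_prefix h (hds ▸ hz)) ht0
  have := t.2.2.2.1.of_prefix htd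
  rwa [Kills, if_neg τ.state_ne_nil] at this

/-- The coefficient of the comparison of resolutions that is given by a chain `γ`: the path that
remains of `δ` after `γ` and `η`. -/
def remainder {m j k : ℕ} (γ : M.Chain m) (η : M.Chain j) (δ : M.Chain k) : A := by
  classical
  exact if δ.source = γ.source ∧ γ.target = η.source ∧ γ.word ++ η.word <+: δ.word then
    M.path η.target (δ.word.drop (γ.word ++ η.word).length) else 0

theorem remainder_eq {m j k : ℕ} {γ : M.Chain m} {η : M.Chain j} {δ : M.Chain k}
    (hs : δ.source = γ.source) (hη : γ.target = η.source) {u : List α}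
    (hw : δ.word = γ.word ++ η.word ++ u) : remainder γ η δ = M.path η.target u := by
  rw [remainder, if_pos ⟨hs, hη, by rw [hw]; exact List.prefix_append _ _⟩, hw, List.drop_left]

theorem remainder_eq_zero {m j k : ℕ} {γ : M.Chain m} {η : M.Chain j} {δ : M.Chain k}
    (h : ¬(δ.source = γ.source ∧ γ.target = η.source ∧ γ.word ++ η.word <+: δ.word)) :
    remainder γ η δ = 0 := by
  rw [remainder, if_neg h]

theorem vert_mul_remainder {m j k : ℕ} (γ : M.Chain m) (η : M.Chain j) (δ : M.Chain k) :
    M.vert η.target * remainder γ η δ = remainder γ η δ := by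
  rw [remainder]
  split_ifs
  · rw [M.vert_mul_path_self]
  · rw [mul_zero]

theorem Chain.target_of_word {m j k : ℕ} {γ : M.Chain m} {η : M.Chain j} {δ : M.Chain k}
    (hs : δ.source = γ.source) (hη : γ.target = η.source) {u : List α}
    (hw : δ.word = γ.word ++ η.word ++ u) : M.endpoint η.target u = δ.target := by
  rw [δ.target_eq, hw, endpoint_append, endpoint_append, hs, ← γ.target_eq, hη, ← η.target_eq]

theorem finite_next (σ : V × List α) : Finite {s : List α // M.Next σ s} := by
  have : ({s : List α | M.Next σ s}).Finite := by
    refine Set.Finite.subset (M.finite_paths.image Prod.snd) fun s hs => ?_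
    exact ⟨(_, s), hs.1, rfl⟩
  exact this

instance (σ : V × List α) : Fintype {s : List α // M.Next σ s} :=
  @Fintype.ofFinite _ (finite_next σ)

instance instFintypeChain : ∀ n, Fintype (M.Chain n)
  | 0 => inferInstanceAs (Fintype (ULift V))
  | n + 1 =>
    letI := instFintypeChain n
    inferInstanceAs (Fintype (Σ γ : M.Chain n, {s : List α // M.Next γ.state s}))

theorem Chain.sum_succ {n : ℕ} {W : Type*} [AddCommMonoid W] (f : M.Chain (n + 1) → W) :
    ∑ δ, f δ = ∑ γ : M.Chain n, ∑ s : {s : List α // M.Next γ.state s}, f (γ.cons s) :=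
  Fintype.sum_sigma (fun δ : (Σ γ : M.Chain n, {s : List α // M.Next γ.state s}) => f δ)

/-- The comparison given by a chain commutes with the differentials. -/
theorem sum_path_mul_remainder {m j : ℕ} (γ : M.Chain m) (η : M.Chain j) (δ : M.Chain (m + j))
    (t : {t : List α // M.Next δ.state t}) :
    ∑ s : {s : List α // M.Next η.state s},
      M.path η.target s.1 * remainder γ (η.cons s) (δ.cons t) =
    remainder γ η δ * M.path δ.target t.1 := by
  by_cases h : δ.source = γ.source ∧ γ.target = η.source ∧ γ.word ++ η.word <+: δ.word
  · obtain ⟨hs, hη, u, hu⟩ := h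
    have key : ∀ s : {s : List α // M.Next η.state s}, s.1 <+: u ++ t.1 →
        M.path η.target s.1 * remainder γ (η.cons s) (δ.cons t) = M.path η.target (u ++ t.1) := by
      rintro s ⟨r, hr⟩
      rw [remainder_eq (γ := γ) (η := η.cons s) (δ := δ.cons t) hs hη (u := r) (by
        simp only [Chain.word_cons]
        rw [← hu, List.append_assoc, ← hr]
        simp), ← hr, path_append]
      rfl
    have key' : ∀ s : {s : List α // M.Next η.state s}, ¬s.1 <+: u ++ t.1 →
        remainder γ (η.cons s) (δ.cons t) = 0 := by
      refine fun s hsu => remainder_eq_zero fun h => hsu ?_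
      have := h.2.2
      simp only [Chain.word_cons] at this
      rw [← hu, List.append_assoc, ← List.append_assoc] at this
      exact (List.prefix_append_right_inj _).1 this
    rw [remainder_eq hs hη hu.symm, ← Chain.target_of_word hs hη hu.symm, ← path_append]
    -- Both sides are the path `u t`. If it is nonzero, exactly one minimal killed word `s` of `η`
    -- is a prefix of it and one summand survives; if it is zero, every summand vanishes.
    by_cases h0 : M.path η.target (u ++ t.1) = 0
    · rw [h0]
      refine Finset.sum_eq_zero fun s _ => ?_
      by_cases hsu : s.1 <+: u ++ t.1
      · rw [key s hsu, h0]
      · rw [key' s hsu, mul_zero]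
    · obtain ⟨s, hs', hsu⟩ := Kills.exists_next η.path_state_ne_zero
        (Chain.kills_of_concat hs hη hu.symm t.2) h0
      rw [Finset.sum_eq_single ⟨s, hs'⟩, key ⟨s, hs'⟩ hsu]
      · intro s' _ hne
        rw [key' s', mul_zero]
        exact fun h => hne (Subtype.ext (s'.2.eq_of_prefix hs' h hsu))
      · simp
  · rw [remainder_eq_zero h, zero_mul]
    refine Finset.sum_eq_zero fun s _ => ?_
    rw [remainder_eq_zero, mul_zero]
    rintro ⟨h1, h2, h3⟩
    -- If `γ η s` is a prefix of `δ t`, then `γ η` is already a prefix of `δ`, so all summands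
    -- vanish with the right side.
    refine h ⟨h1, h2, Chain.concat_prefix γ j δ η (δ.cons t).word h1 h2 (List.prefix_append _ _) ?_⟩
    exact List.IsPrefix.trans ⟨s.1, by simp⟩ h3

end Chains

end MonomialPresentation

/-! ### The minimal projective resolution of the top. -/

namespace MonomialPresentation

section Resolution

variable {K : Type*} [Field K] {A : Type*} [Ring A] [Algebra K A]
  {V : Type u} [Fintype V] {α : Type v} (M : MonomialPresentation K A V α)

/-- The projective modules of the minimal resolution: the direct sum, over the chains of degree
`n`, of the right ideals of paths that start where the chain ends. -/
def resolution (n : ℕ) : Submodule Aᵐᵒᵖ (M.Chain n → A) where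
  carrier := {f | ∀ γ, M.vert γ.target * f γ = f γ}
  add_mem' hf hg γ := by rw [Pi.add_apply, mul_add, hf γ, hg γ]
  zero_mem' γ := by simp
  smul_mem' a f hf γ := by
    rw [Pi.smul_apply, MulOpposite.smul_eq_mul_unop, ← mul_assoc, hf γ]

variable {M}

theorem vert_mul_sum_path {ι : Type*} (s : Finset ι) (x : V) (l : ι → List α) (a : ι → A) :
    M.vert x * ∑ i ∈ s, M.path x (l i) * a i = ∑ i ∈ s, M.path x (l i) * a i := by
  rw [Finset.mul_sum]
  exact Finset.sum_congr rfl fun i _ => by rw [← mul_assoc, M.vert_mul_path_self]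

variable (M) in
/-- The differential of the minimal resolution. -/
def diff (n : ℕ) : M.resolution (n + 1) →ₗ[Aᵐᵒᵖ] M.resolution n where
  toFun f := ⟨fun γ => ∑ s : {s : List α // M.Next γ.state s}, M.path γ.target s.1 * f.1 (γ.cons s),
    fun γ => vert_mul_sum_path _ _ _ _⟩
  map_add' f g := by
    ext γ
    simp [mul_add, Finset.sum_add_distrib]
  map_smul' a f := by
    ext γ
    simp [MulOpposite.smul_eq_mul_unop, Finset.sum_mul, mul_assoc]

theorem diff_apply {n : ℕ} (f : M.resolution (n + 1)) (γ : M.Chain n) :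
    (M.diff n f).1 γ =
      ∑ s : {s : List α // M.Next γ.state s}, M.path γ.target s.1 * f.1 (γ.cons s) := rfl

variable (M) in
/-- The linear combination of the components of an element of the resolution. -/
def scalarSum (n : ℕ) (c : M.Chain n → K) : M.resolution n →ₗ[Aᵐᵒᵖ] A where
  toFun f := ∑ γ, c γ • f.1 γ
  map_add' f g := by simp [Finset.sum_add_distrib]
  map_smul' a f := by simp [MulOpposite.smul_eq_mul_unop, Finset.sum_mul]

variable (M) in
/-- The map to the top that is given by a family of scalars. -/
def toTop (n : ℕ) (c : M.Chain n → K) : M.resolution n →ₗ[Aᵐᵒᵖ] A ⧸ rightRadical A :=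
  (rightRadical A).mkQ.comp (M.scalarSum n c)

theorem toTop_apply {n : ℕ} (c : M.Chain n → K) (f : M.resolution n) :
    M.toTop n c f = (rightRadical A).mkQ (∑ γ, c γ • f.1 γ) := rfl

theorem mkQ_eq_mkQ_iff {a b : A} : (rightRadical A).mkQ a = (rightRadical A).mkQ b ↔
    ∀ x, M.coeff x [] a = M.coeff x [] b := by
  rw [Submodule.mkQ_apply, Submodule.mkQ_apply, Submodule.Quotient.eq]
  change a - b ∈ Ring.jacobson A ↔ _
  simp [M.mem_jacobson_iff, sub_eq_zero]

theorem coeff_nil_resolution {n : ℕ} (f : M.resolution n) (γ : M.Chain n) {x : V}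
    (h : γ.target ≠ x) (l : List α) : M.coeff x l (f.1 γ) = 0 :=
  M.coeff_of_vert_mul_eq h (f.2 γ) l

theorem coeff_nil_path {x y : V} {l : List α} (hl : l ≠ []) : M.coeff x [] (M.path y l) = 0 :=
  M.coeff_path_of_ne (by simp [hl.symm])

variable (M) in
/-- The augmentation of the minimal resolution. -/
def augmentation : M.resolution 0 →ₗ[Aᵐᵒᵖ] A ⧸ rightRadical A := M.toTop 0 1

/-- Minimality: the differential multiplies by nonempty words, which lie in the radical. -/
theorem toTop_diff {n : ℕ} (c : M.Chain n → K) (f : M.resolution (n + 1)) :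
    M.toTop n c (M.diff n f) = 0 := by
  rw [toTop_apply, ← map_zero (rightRadical A).mkQ, mkQ_eq_mkQ_iff (M := M)]
  intro x
  simp only [diff_apply, map_sum, map_smul, map_zero]
  refine Finset.sum_eq_zero fun γ _ => ?_
  rw [Finset.sum_eq_zero, smul_zero]
  intro s _
  rw [M.coeff_nil_mul, coeff_nil_path s.2.2.1, zero_mul]

theorem augmentation_diff (f : M.resolution 1) : M.augmentation (M.diff 0 f) = 0 :=
  toTop_diff _ f

/-- Consecutive words of a chain multiply to zero. -/
theorem diff_diff {n : ℕ} (f : M.resolution (n + 2)) : M.diff n (M.diff (n + 1) f) = 0 := by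
  ext γ
  simp only [diff_apply, Finset.mul_sum]
  refine Finset.sum_eq_zero fun s _ => Finset.sum_eq_zero fun t _ => ?_
  rw [← mul_assoc, Chain.target_cons, ← path_append]
  have := (Chain.kills_of_pos (γ.cons s) t.1).1 t.2.2.2.1
  change M.path γ.target (s.1 ++ t.1) = 0 at this
  rw [this, zero_mul]

theorem augmentation_surjective : Function.Surjective M.augmentation := by
  intro y
  obtain ⟨a, rfl⟩ := (rightRadical A).mkQ_surjective y
  refine ⟨⟨fun γ => M.vert γ.target * a, fun γ => by rw [← mul_assoc, M.vert_mul_self]⟩, ?_⟩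
  rw [augmentation, toTop_apply]
  congr 1
  simp only [Pi.one_apply, one_smul]
  rw [← Finset.sum_mul]
  have : ∑ γ : M.Chain 0, M.vert γ.target = ∑ x, M.vert x :=
    Fintype.sum_equiv Equiv.ulift _ _ fun _ => rfl
  rw [this, M.sum_vert, one_mul]

/-- An element all whose paths are killed by a state lies in the right ideal that is generated by
the minimal killed words. -/
theorem exists_sum_next {σ : V × List α} (hσ : M.path σ.1 σ.2 ≠ 0) {a : A}
    (ha : M.vert (M.endpoint σ.1 σ.2) * a = a)
    (h : ∀ l, ¬M.Kills σ l → M.coeff (M.endpoint σ.1 σ.2) l a = 0) :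
    ∃ x : {s : List α // M.Next σ s} → A,
      (∀ s, M.vert (M.endpoint (M.endpoint σ.1 σ.2) s.1) * x s = x s) ∧
      ∑ s, M.path (M.endpoint σ.1 σ.2) s.1 * x s = a := by
  classical
  let Φ : ({s : List α // M.Next σ s} → A) →ₗ[K] A :=
    ∑ s, (LinearMap.mulLeft K (M.path (M.endpoint σ.1 σ.2) s.1)).comp (LinearMap.proj s)
  have hΦ : ∀ x, Φ x = ∑ s, M.path (M.endpoint σ.1 σ.2) s.1 * x s := fun x => by
    simp [Φ]
  have hmem : a ∈ LinearMap.range Φ := by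
    rw [← M.sum_coeff_smul_path a]
    refine Submodule.sum_mem _ fun p hp => ?_
    obtain ⟨y, l⟩ := p
    by_cases hy : M.endpoint σ.1 σ.2 = y
    · subst hy
      by_cases hk : M.Kills σ l
      · refine Submodule.smul_mem _ _ ?_
        obtain ⟨s, hs, r, rfl⟩ := hk.exists_next hσ (M.mem_support.1 hp)
        refine ⟨Pi.single ⟨s, hs⟩ (M.path (M.endpoint (M.endpoint σ.1 σ.2) s) r), ?_⟩
        rw [hΦ, Finset.sum_eq_single ⟨s, hs⟩]
        · rw [Pi.single_eq_same, ← path_append]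
        · intro t _ ht
          rw [Pi.single_eq_of_ne ht, mul_zero]
        · simp
      · rw [h l hk, zero_smul]
        exact Submodule.zero_mem _
    · rw [M.coeff_of_vert_mul_eq hy ha, zero_smul]
      exact Submodule.zero_mem _
  obtain ⟨x, hx⟩ := hmem
  refine ⟨fun s => M.vert (M.endpoint (M.endpoint σ.1 σ.2) s.1) * x s, fun s => ?_, ?_⟩
  · rw [← mul_assoc, M.vert_mul_self]
  · rw [← hx, hΦ]
    exact Finset.sum_congr rfl fun s _ => by rw [← mul_assoc, M.path_mul_vert]

/-- Exactness is checked chain by chain: the right ideal generated by the minimal killed words of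
`γ` consists of the combinations of killed words. -/
theorem exists_diff_eq {n : ℕ} {f : M.resolution n}
    (h : ∀ γ l, ¬M.Kills γ.state l → M.coeff γ.target l (f.1 γ) = 0) :
    ∃ g, M.diff n g = f := by
  choose x hx hxf using fun γ : M.Chain n =>
    exists_sum_next γ.path_state_ne_zero (f.2 γ) (h γ)
  refine ⟨⟨fun δ => x δ.init δ.last, fun δ => hx _ _⟩, ?_⟩
  ext γ
  rw [diff_apply]
  exact hxf γ

theorem exists_diff_of_augmentation_eq_zero {f : M.resolution 0} (h : M.augmentation f = 0) :
    ∃ g, M.diff 0 g = f := by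
  refine exists_diff_eq fun γ l hl => ?_
  obtain ⟨x, rfl⟩ := γ.cases_zero
  rw [Chain.kills_zero, not_not] at hl
  subst hl
  rw [augmentation, toTop_apply, ← map_zero (rightRadical A).mkQ, mkQ_eq_mkQ_iff (M := M)] at h
  have h1 := h x
  simp only [Pi.one_apply, one_smul, map_sum, map_zero] at h1
  rw [Finset.sum_eq_single (Chain.nil M x)] at h1
  · exact h1
  · intro γ _ hne
    obtain ⟨y, rfl⟩ := γ.cases_zero
    exact coeff_nil_resolution f _ (fun e => hne (by rw [← e]; rfl)) _
  · simp

/-- The words that continue `γ` form a prefix code, so the coefficient at `t l` in the differential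
comes from the component at `γ t` alone. In a cycle, that component only involves words `l` with `t
l` zero. -/
theorem exists_diff_of_diff_eq_zero {n : ℕ} {f : M.resolution (n + 1)} (h : M.diff n f = 0) :
    ∃ g, M.diff (n + 1) g = f := by
  refine exists_diff_eq fun γ l hl => ?_
  obtain ⟨γ, t, rfl⟩ := γ.cases_succ
  rw [Chain.kills_of_pos] at hl
  change ¬M.path γ.target (t.1 ++ l) = 0 at hl
  have h1 := congrArg (M.coeff γ.target (t.1 ++ l)) (congrFun (congrArg Subtype.val h) γ)
  rw [diff_apply, map_sum, Finset.sum_eq_single t] at h1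
  · rw [M.coeff_path_mul hl] at h1
    simpa using h1
  · intro s _ hne
    refine M.coeff_path_mul_of_not_prefix (fun hs => hne (Subtype.ext ?_)) _
    exact s.2.eq_of_prefix t.2 hs.2 (List.prefix_append _ _)
  · simp

/-- The generator of the resolution that belongs to a chain. -/
def generator {n : ℕ} (γ : M.Chain n) : M.resolution n := by
  classical
  exact ⟨Pi.single γ (M.vert γ.target), fun δ => by
    by_cases h : δ = γ
    · subst h
      rw [Pi.single_eq_same, M.vert_mul_self]
    · rw [Pi.single_eq_of_ne h, mul_zero]⟩

theorem generator_apply_self {n : ℕ} (γ : M.Chain n) :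
    (generator γ).1 γ = M.vert γ.target := by
  simp [generator]

theorem generator_apply_of_ne {n : ℕ} {γ δ : M.Chain n} (h : δ ≠ γ) :
    (generator γ).1 δ = 0 := by
  simp [generator, h]

theorem sum_generator {n : ℕ} (f : M.resolution n) :
    ∑ γ, MulOpposite.op (f.1 γ) • generator γ = f := by
  ext δ
  rw [Submodule.coe_sum, Finset.sum_apply, Finset.sum_eq_single δ]
  · simp [generator_apply_self, f.2 δ]
  · intro γ _ h
    simp [generator_apply_of_ne h.symm]
  · simp

/-- Every map from the resolution to the top is given by a family of scalars. -/
theorem exists_eq_toTop {n : ℕ} (k : M.resolution n →ₗ[Aᵐᵒᵖ] A ⧸ rightRadical A) :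
    ∃ c, k = M.toTop n c := by
  choose a ha using fun γ : M.Chain n => (rightRadical A).mkQ_surjective (k (generator γ))
  -- Modulo the radical only trivial paths count, and the component `f.1 γ` involves only paths from
  -- the target of `γ`; so the image of each generator matters only through one coefficient.
  refine ⟨fun γ => M.coeff γ.target [] (a γ), LinearMap.ext fun f => ?_⟩
  conv_lhs => rw [← sum_generator f, map_sum]
  have hsm : ∀ γ, k (MulOpposite.op (f.1 γ) • generator γ) =
      (rightRadical A).mkQ (a γ * f.1 γ) := fun γ => by
    rw [map_smul, ← ha]
    exact ((rightRadical A).mkQ.map_smul (MulOpposite.op (f.1 γ)) (a γ)).symm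
  simp only [hsm]
  rw [toTop_apply, ← map_sum, mkQ_eq_mkQ_iff (M := M)]
  intro x
  simp only [map_sum, M.coeff_nil_mul, map_smul, smul_eq_mul]
  refine Finset.sum_congr rfl fun γ _ => ?_
  by_cases hx : γ.target = x
  · rw [hx]
  · rw [coeff_nil_resolution f γ hx, mul_zero, mul_zero]

theorem toTop_generator_coeff {n : ℕ} (c : M.Chain n → K) (γ : M.Chain n) :
    M.toTop n c (generator γ) = (rightRadical A).mkQ (c γ • M.vert γ.target) := by
  rw [toTop_apply, Finset.sum_eq_single γ, generator_apply_self]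
  · intro δ _ h
    rw [generator_apply_of_ne h, smul_zero]
  · simp

theorem toTop_injective (n : ℕ) : Function.Injective (M.toTop n) := by
  classical
  intro c c' h
  ext γ
  have := LinearMap.congr_fun h (generator γ)
  rw [toTop_generator_coeff, toTop_generator_coeff, mkQ_eq_mkQ_iff (M := M)] at this
  simpa [M.coeff_nil_vert] using this γ.target

/-- The comparison of resolutions that is given by a family of scalars. -/
def comparison {m : ℕ} (c : M.Chain m → K) (j : ℕ) :
    M.resolution (m + j) →ₗ[Aᵐᵒᵖ] M.resolution j where
  toFun f := ⟨fun η => ∑ δ, (∑ γ, c γ • remainder γ η δ) * f.1 δ, fun η => by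
    rw [Finset.mul_sum]
    refine Finset.sum_congr rfl fun δ _ => ?_
    rw [← mul_assoc, Finset.mul_sum]
    congr 1
    exact Finset.sum_congr rfl fun γ _ => by rw [mul_smul_comm, vert_mul_remainder]⟩
  map_add' f g := by
    ext η
    simp [mul_add, Finset.sum_add_distrib]
  map_smul' a f := by
    ext η
    simp [MulOpposite.smul_eq_mul_unop, Finset.sum_mul, mul_assoc]

theorem comparison_apply {m : ℕ} (c : M.Chain m → K) (j : ℕ) (f : M.resolution (m + j))
    (η : M.Chain j) :
    (comparison c j f).1 η = ∑ δ, (∑ γ, c γ • remainder γ η δ) * f.1 δ := rfl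

/-- Comparing the contributions of `δ` followed by `t` reduces this to `sum_path_mul_remainder` for
each chain `γ` separately. -/
theorem diff_comparison {m : ℕ} (c : M.Chain m → K) (j : ℕ) (f : M.resolution (m + (j + 1))) :
    M.diff j (comparison c (j + 1) f) = comparison c j (M.diff (m + j) f) := by
  ext η
  rw [diff_apply, comparison_apply]
  simp only [comparison_apply, diff_apply, Finset.mul_sum]
  rw [Finset.sum_comm]
  refine (Chain.sum_succ (n := m + j) _).trans ?_
  refine Finset.sum_congr rfl fun δ _ => Finset.sum_congr rfl fun t _ => ?_
  simp only [← mul_assoc]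
  rw [← Finset.sum_mul]
  congr 1
  simp only [Finset.mul_sum, Finset.sum_mul]
  rw [Finset.sum_comm]
  refine Finset.sum_congr rfl fun γ _ => ?_
  simp only [mul_smul_comm, smul_mul_assoc]
  rw [← Finset.smul_sum]
  congr 1
  exact sum_path_mul_remainder γ η δ t

theorem sum_remainder_zero {m : ℕ} (c : M.Chain m → K) (δ : M.Chain m) :
    ∑ η : M.Chain 0, ∑ γ : M.Chain m, c γ • remainder γ η δ = c δ • M.vert δ.target := by
  rw [Finset.sum_comm, Finset.sum_eq_single δ, Finset.sum_eq_single (Chain.nil M δ.target)]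
  · rw [remainder_eq rfl rfl (u := []) (by simp)]
    simp
  · intro η _ hne
    obtain ⟨x, rfl⟩ := η.cases_zero
    rw [remainder_eq_zero, smul_zero]
    rintro ⟨-, h, -⟩
    exact hne (congrArg (Chain.nil M) h.symm)
  · simp
  · intro γ _ hne
    refine Finset.sum_eq_zero fun η _ => ?_
    rw [remainder_eq_zero, smul_zero]
    rintro ⟨h1, -, h3⟩
    exact hne (Chain.eq_of_prefix h1.symm ((List.prefix_append _ _).trans h3)
      (List.prefix_refl _))
  · simp

/-- The comparison lifts the map to the top given by `c`: in degree zero, only `γ = δ` leaves a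
remainder, and this is trivial. -/
theorem augmentation_comparison {m : ℕ} (c : M.Chain m → K) (f : M.resolution m) :
    M.augmentation (comparison c 0 f) = M.toTop m c f := by
  rw [augmentation, toTop_apply, toTop_apply]
  congr 1
  simp only [Pi.one_apply, one_smul, comparison_apply]
  rw [Finset.sum_comm]
  refine Finset.sum_congr rfl fun δ _ => ?_
  rw [← Finset.sum_mul]
  have := sum_remainder_zero c δ
  refine (congrArg (fun a => a * f.1 δ) this).trans ?_
  change (c δ • M.vert δ.target) * f.1 δ = _
  rw [smul_mul_assoc, f.2 δ]

open Classical in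
/-- The convolution of two families of scalars along the concatenation of chains. -/
def convolution {m n k : ℕ} (c : M.Chain m → K) (c' : M.Chain n → K) (δ : M.Chain k) : K :=
  ∑ γ, ∑ η, if δ.source = γ.source ∧ γ.target = η.source ∧ δ.word = γ.word ++ η.word then
    c γ * c' η else 0

/-- Modulo the radical only trivial remainders survive, that is, those with `δ` equal to `γ`
followed by `η`. -/
theorem toTop_comparison {m n : ℕ} (c : M.Chain m → K) (c' : M.Chain n → K)
    (f : M.resolution (m + n)) :
    M.toTop n c' (comparison c n f) = M.toTop (m + n) (convolution c c') f := by
  classical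
  rw [toTop_apply, toTop_apply, mkQ_eq_mkQ_iff (M := M)]
  intro x
  simp only [comparison_apply, Finset.smul_sum, map_sum]
  rw [Finset.sum_comm]
  refine Finset.sum_congr rfl fun δ _ => ?_
  by_cases hx : δ.target = x
  swap
  · simp [M.coeff_nil_mul, coeff_nil_resolution f δ hx]
  subst hx
  simp only [M.coeff_nil_mul, map_smul, map_sum, smul_eq_mul, convolution, Finset.sum_mul,
    Finset.mul_sum]
  rw [Finset.sum_comm]
  refine Finset.sum_congr rfl fun γ _ => Finset.sum_congr rfl fun η _ => ?_
  split_ifs with h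
  · obtain ⟨h1, h2, h3⟩ := h
    have h4 : δ.word = γ.word ++ η.word ++ [] := by simpa using h3
    rw [remainder_eq h1 h2 h4, path_nil, M.coeff_nil_vert,
      ← Chain.target_of_word h1 h2 h4, endpoint_nil, if_pos rfl]
    ring
  · suffices M.coeff δ.target [] (remainder γ η δ) = 0 by simp [this]
    by_cases h' : δ.source = γ.source ∧ γ.target = η.source ∧ γ.word ++ η.word <+: δ.word
    · obtain ⟨h1, h2, u, hu⟩ := h'
      rw [remainder_eq h1 h2 hu.symm]
      refine coeff_nil_path ?_
      rintro rfl
      exact h ⟨h1, h2, by simpa using hu.symm⟩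
    · rw [remainder_eq_zero h', map_zero]

/-- Multiplying each component by the idempotent of its target retracts the free module of all
functions onto this submodule. -/
theorem projective_resolution (n : ℕ) : Module.Projective Aᵐᵒᵖ (M.resolution n) := by
  have : Module.Projective Aᵐᵒᵖ A := by
    let e : A ≃ₗ[Aᵐᵒᵖ] Aᵐᵒᵖ :=
      { MulOpposite.opAddEquiv with
        map_smul' := fun a x => by
          simp [MulOpposite.smul_eq_mul_unop] }
    exact Module.Projective.of_equiv e.symm
  have : Module.Projective Aᵐᵒᵖ (M.Chain n → A) :=
    Module.Projective.of_equiv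
      (DFinsupp.linearEquivFunOnFintype (R := Aᵐᵒᵖ) (ι := M.Chain n) (M := fun _ => A))
  refine Module.Projective.of_split (M.resolution n).subtype
    { toFun := fun f => ⟨fun γ => M.vert γ.target * f γ, fun γ => by
        rw [← mul_assoc, M.vert_mul_self]⟩
      map_add' := fun f g => by ext γ; simp [mul_add]
      map_smul' := fun a f => by
        ext γ; simp [MulOpposite.smul_eq_mul_unop, mul_assoc] } ?_
  ext f γ
  exact f.2 γ

end Resolution

end MonomialPresentation

/-! ## Ext groups through projective resolutions -/

/-- A projective resolution of `K 0`, cut into short exact sequences. -/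
structure SyzygyResolution (C : Type u) [Category.{v} C] [Abelian C] where
  K : ℕ → C
  P : ℕ → C
  ι : ∀ n, K (n + 1) ⟶ P n
  π : ∀ n, P n ⟶ K n
  zero : ∀ n, ι n ≫ π n = 0
  shortExact : ∀ n, (ShortComplex.mk (ι n) (π n) (zero n)).ShortExact
  projective : ∀ n, Projective (P n)

namespace SyzygyResolution

variable {C : Type u} [Category.{v} C] [Abelian C] [HasExt.{w} C] (R : SyzygyResolution C)

instance (n : ℕ) : Projective (R.P n) := R.projective n

instance (n : ℕ) : Epi (R.π n) := (R.shortExact n).epi_g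

/-- The class of the first `n` steps of the resolution. -/
def extClass : ∀ n, Ext (R.K 0) (R.K n) n
  | 0 => Ext.mk₀ (𝟙 (R.K 0))
  | n + 1 => (extClass n).comp (R.shortExact n).extClass rfl

theorem extClass_succ (n : ℕ) :
    R.extClass (n + 1) = (R.extClass n).comp (R.shortExact n).extClass rfl := rfl

/-- Dimension shifting: `Ext` of positive degree vanishes on `R.P n`, so a class of positive degree
on `R.K n` factors through the connecting class. -/
theorem exists_extClass_comp {Y : C} (n : ℕ) : ∀ (k m : ℕ) (h : n + k = m) (x : Ext (R.K 0) Y m),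
    ∃ y : Ext (R.K n) Y k, (R.extClass n).comp y h = x := by
  induction n with
  | zero =>
    intro k m h x
    obtain rfl : k = m := by omega
    exact ⟨x, Ext.mk₀_id_comp x⟩
  | succ n ih =>
    intro k m h x
    obtain ⟨y, rfl⟩ := ih (1 + k) m (by omega) x
    have hy : (Ext.mk₀ (R.π n)).comp y (zero_add (1 + k)) = 0 := by
      have := Ext.subsingleton_of_projective (R.P n) Y k
      rw [add_comm] at this
      exact Subsingleton.elim _ _
    obtain ⟨z, rfl⟩ := Ext.contravariant_sequence_exact₃ (R.shortExact n) Y y hy rfl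
    refine ⟨z, ?_⟩
    rw [extClass_succ]
    exact Ext.comp_assoc _ _ _ _ _ (by omega)

/-- Every element of `Ext^n (K 0) Y` comes from a map `P n ⟶ Y`. -/
theorem exists_mk₀ {Y : C} (n : ℕ) (x : Ext (R.K 0) Y n) :
    ∃ g : R.K n ⟶ Y, (R.extClass n).comp (Ext.mk₀ g) (add_zero n) = x := by
  obtain ⟨y, hy⟩ := R.exists_extClass_comp n 0 n (add_zero n) x
  obtain ⟨g, rfl⟩ := (Ext.mk₀_bijective _ _).2 y
  exact ⟨g, hy⟩

/-- In positive degrees the shift is injective: a class killed by the connecting class comes from an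
`Ext` group of `R.P n` in positive degree, which is zero. -/
theorem extClass_comp_eq_zero {Y : C} (n : ℕ) :
    ∀ (k m : ℕ) (h : n + (k + 1) = m) (y : Ext (R.K n) Y (k + 1)),
      (R.extClass n).comp y h = 0 → y = 0 := by
  induction n with
  | zero =>
    intro k m h y hy
    obtain rfl : k + 1 = m := by omega
    rwa [← Ext.mk₀_id_comp y]
  | succ n ih =>
    intro k m h y hy
    rw [extClass_succ, Ext.comp_assoc (a₂₃ := k + 1 + 1) _ _ _ rfl (by omega) (by omega)] at hy
    have h0 := ih (k + 1) m (by omega) _ hy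
    obtain ⟨z, hz⟩ := Ext.contravariant_sequence_exact₁ (R.shortExact n) Y y _ h0
    rw [← hz, Ext.eq_zero_of_projective z, Ext.comp_zero]

/-- In degree zero the kernel of the shift consists of the maps that extend to the projective
containing the syzygy; minimality, in the form `hmin`, makes them zero. -/
theorem extClass_comp_mk₀_injective {Y : C} (n : ℕ)
    (hmin : ∀ (k : ℕ), n = k + 1 → ∀ f : R.P k ⟶ Y, R.ι k ≫ f = 0) {g : R.K n ⟶ Y}
    (h : (R.extClass n).comp (Ext.mk₀ g) (add_zero n) = 0) : g = 0 := by
  cases n with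
  | zero =>
    have h' : (Ext.mk₀ (𝟙 (R.K 0))).comp (Ext.mk₀ g) (add_zero 0) = 0 := h
    rwa [Ext.mk₀_comp_mk₀, Category.id_comp, Ext.mk₀_eq_zero_iff] at h'
  | succ n =>
    rw [extClass_succ, Ext.comp_assoc (a₂₃ := 1) _ _ _ rfl (by omega) (by omega)] at h
    have h0 := R.extClass_comp_eq_zero n 0 (n + 1) rfl _ h
    obtain ⟨z, hz⟩ := Ext.contravariant_sequence_exact₁ (R.shortExact n) Y _ _ h0
    obtain ⟨f, rfl⟩ := (Ext.mk₀_bijective _ _).2 z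
    rw [Ext.mk₀_comp_mk₀] at hz
    rw [← (Ext.mk₀_bijective _ _).1 hz]
    exact hmin n rfl f

/-- The Yoneda product through a comparison of resolutions. -/
theorem extClass_comp_extClass {m : ℕ} (g : ∀ j, R.K (m + j) ⟶ R.K j)
    (f : ∀ j, R.P (m + j) ⟶ R.P j) (hι : ∀ j, R.ι (m + j) ≫ f j = g (j + 1) ≫ R.ι j)
    (hπ : ∀ j, R.π (m + j) ≫ g j = f j ≫ R.π j) (n : ℕ) :
    ((R.extClass m).comp (Ext.mk₀ (g 0)) (add_zero m)).comp (R.extClass n) rfl =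
      (R.extClass (m + n)).comp (Ext.mk₀ (g n)) (add_zero (m + n)) := by
  induction n with
  | zero => exact Ext.comp_mk₀_id _
  | succ n ih =>
    have hnat := ShortComplex.ShortExact.extClass_naturality (R.shortExact (m + n))
      (R.shortExact n) { τ₁ := g (n + 1), τ₂ := f n, τ₃ := g n, comm₁₂ := (hι n).symm,
                         comm₂₃ := (hπ n).symm }
    dsimp only at hnat
    rw [extClass_succ, ← Ext.comp_assoc (a₁₂ := m + n) _ _ _ rfl rfl (by omega), ih,
      Ext.comp_assoc (a₂₃ := 1) _ _ _ (add_zero _) (zero_add 1) (by omega), ← hnat,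
      ← Ext.comp_assoc (a₁₂ := m + n + 1) _ _ _ rfl (add_zero 1) (by omega)]
    rfl

end SyzygyResolution

/-! ### The Ext algebra: the basis of chains and the Yoneda product. -/

namespace MonomialPresentation

section ExtAlgebra

variable {K : Type*} [Field K] {A : Type u} [Ring A] [Algebra K A]
  {V α : Type u} [Fintype V] (M : MonomialPresentation K A V α)

/-- The terms of the minimal resolution, in the category of right modules. -/
abbrev resolutionObj (n : ℕ) : ModuleCat.{u} Aᵐᵒᵖ :=
  ModuleCat.of Aᵐᵒᵖ (M.resolution n)

/-- The syzygies in the minimal resolution of the top. -/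
def syzygy : ℕ → ModuleCat.{u} Aᵐᵒᵖ
  | 0 => topModule A
  | 1 => ModuleCat.of Aᵐᵒᵖ (LinearMap.ker M.augmentation)
  | n + 2 => ModuleCat.of Aᵐᵒᵖ (LinearMap.ker (M.diff n))

/-- The inclusion of a syzygy. -/
def syzygyι : ∀ n, M.syzygy (n + 1) ⟶ M.resolutionObj n
  | 0 => ModuleCat.ofHom (LinearMap.ker M.augmentation).subtype
  | n + 1 => ModuleCat.ofHom (LinearMap.ker (M.diff n)).subtype

/-- The projection onto a syzygy. -/
def syzygyπ : ∀ n, M.resolutionObj n ⟶ M.syzygy n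
  | 0 => ModuleCat.ofHom M.augmentation
  | 1 => ModuleCat.ofHom ((M.diff 0).codRestrict (LinearMap.ker M.augmentation)
      fun f => augmentation_diff f)
  | n + 2 => ModuleCat.ofHom ((M.diff (n + 1)).codRestrict (LinearMap.ker (M.diff n))
      fun f => diff_diff f)

theorem syzygyπ_ι (n : ℕ) :
    M.syzygyπ (n + 1) ≫ M.syzygyι n = ModuleCat.ofHom (M.diff n) := by
  cases n <;> rfl

theorem syzygyι_π (n : ℕ) : M.syzygyι n ≫ M.syzygyπ n = 0 := by
  ext f
  match n with
  | 0 => exact f.2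
  | 1 => exact Subtype.ext f.2
  | n + 2 => exact Subtype.ext f.2

instance mono_syzygyι (n : ℕ) : Mono (M.syzygyι n) := by
  rw [ModuleCat.mono_iff_injective]
  cases n <;> exact Subtype.val_injective

/-- The minimal resolution of the top, cut into short exact sequences. -/
def syzygyResolution : SyzygyResolution (ModuleCat.{u} Aᵐᵒᵖ) where
  K := M.syzygy
  P := M.resolutionObj
  ι := M.syzygyι
  π := M.syzygyπ
  zero := M.syzygyι_π
  projective n := by
    have := projective_resolution (M := M) n
    exact (IsProjective.iff_projective (R := Aᵐᵒᵖ) (M.resolution n)).1 this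
  shortExact n :=
    { exact := by
        rw [ShortComplex.moduleCat_exact_iff]
        intro f hf
        match n with
        | 0 => exact ⟨⟨f, hf⟩, rfl⟩
        | 1 => exact ⟨⟨f, congrArg Subtype.val hf⟩, rfl⟩
        | n + 2 => exact ⟨⟨f, congrArg Subtype.val hf⟩, rfl⟩
      mono_f := M.mono_syzygyι n
      epi_g := by
        dsimp only
        rw [ModuleCat.epi_iff_surjective]
        match n with
        | 0 => exact augmentation_surjective
        | 1 =>
          rintro ⟨f, hf⟩
          obtain ⟨g, hg⟩ := exists_diff_of_augmentation_eq_zero hf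
          exact ⟨g, Subtype.ext hg⟩
        | n + 2 =>
          rintro ⟨f, hf⟩
          obtain ⟨g, hg⟩ := exists_diff_of_diff_eq_zero hf
          exact ⟨g, Subtype.ext hg⟩ }

/-- The syzygy is the image of the next term of the resolution, and by minimality every map to the
top kills the differential. -/
theorem syzygyι_toTop {n : ℕ} (f : M.resolutionObj n ⟶ topModule A) : M.syzygyι n ≫ f = 0 := by
  obtain ⟨c, hc⟩ := exists_eq_toTop f.hom
  have : ∀ g, M.syzygyπ (n + 1) ≫ M.syzygyι n ≫ f = g → M.syzygyι n ≫ f = 0 := by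
    intro g hg
    have : Epi (M.syzygyπ (n + 1)) := (M.syzygyResolution.shortExact (n + 1)).epi_g
    rw [← cancel_epi (M.syzygyπ (n + 1)), ← Category.assoc, syzygyπ_ι]
    ext x
    change f.hom (M.diff n x) = 0
    rw [hc, toTop_diff]
  exact this _ rfl

/-- The map from a syzygy to the top that is given by a family of scalars. -/
def syzygyDesc (n : ℕ) (c : M.Chain n → K) : M.syzygy n ⟶ topModule A :=
  (M.syzygyResolution.shortExact n).exact.desc (ModuleCat.ofHom (M.toTop n c))
    (M.syzygyι_toTop _)

theorem syzygyπ_desc (n : ℕ) (c : M.Chain n → K) :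
    M.syzygyπ n ≫ M.syzygyDesc n c = ModuleCat.ofHom (M.toTop n c) :=
  (M.syzygyResolution.shortExact n).exact.g_desc _ _

variable {M} in
theorem syzygy_hom_ext {n : ℕ} {Y : ModuleCat.{u} Aᵐᵒᵖ} {f g : M.syzygy n ⟶ Y}
    (h : M.syzygyπ n ≫ f = M.syzygyπ n ≫ g) : f = g := by
  have : Epi (M.syzygyπ n) := (M.syzygyResolution.shortExact n).epi_g
  exact (cancel_epi _).1 h

/-- The class of the first `n` steps of the minimal resolution of the top. -/
def syzygyClass (n : ℕ) : Ext (topModule A) (M.syzygy n) n := M.syzygyResolution.extClass n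

theorem syzygyClass_comp_injective {n : ℕ} {g : M.syzygy n ⟶ topModule A}
    (h : (M.syzygyClass n).comp (Ext.mk₀ g) (add_zero n) = 0) : g = 0 :=
  M.syzygyResolution.extClass_comp_mk₀_injective n (fun _ _ f => M.syzygyι_toTop f) h

theorem exists_syzygyClass_comp {n : ℕ} (x : SelfExt (topModule A) n) :
    ∃ g : M.syzygy n ⟶ topModule A, (M.syzygyClass n).comp (Ext.mk₀ g) (add_zero n) = x :=
  M.syzygyResolution.exists_mk₀ n x

theorem syzygyClass_comp_syzygyClass {m : ℕ} (g : ∀ j, M.syzygy (m + j) ⟶ M.syzygy j)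
    (f : ∀ j, M.resolutionObj (m + j) ⟶ M.resolutionObj j)
    (hι : ∀ j, M.syzygyι (m + j) ≫ f j = g (j + 1) ≫ M.syzygyι j)
    (hπ : ∀ j, M.syzygyπ (m + j) ≫ g j = f j ≫ M.syzygyπ j) (n : ℕ) :
    ((M.syzygyClass m).comp (Ext.mk₀ (Y := topModule A) (g 0)) (add_zero m)).comp
      (M.syzygyClass n) rfl =
      (M.syzygyClass (m + n)).comp (Ext.mk₀ (g n)) (add_zero (m + n)) :=
  M.syzygyResolution.extClass_comp_extClass g f hι hπ n

/-- The element of `Ext^n` that is given by a family of scalars. -/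
def toExt (n : ℕ) : (M.Chain n → K) →ₗ[K] SelfExt (topModule A) n where
  toFun c := (M.syzygyClass n).comp (Ext.mk₀ (M.syzygyDesc n c)) (add_zero n)
  map_add' c c' := by
    rw [← Ext.comp_add, ← Ext.mk₀_add]
    congr 2
    refine syzygy_hom_ext ?_
    rw [Preadditive.comp_add, syzygyπ_desc, syzygyπ_desc, syzygyπ_desc]
    ext f
    change M.toTop n (c + c') f = M.toTop n c f + M.toTop n c' f
    rw [toTop_apply, toTop_apply, toTop_apply, ← map_add]
    congr 1
    simp [add_smul, Finset.sum_add_distrib]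
  map_smul' r c := by
    rw [RingHom.id_apply, ← Ext.comp_smul, ← Ext.mk₀_smul]
    congr 2
    refine syzygy_hom_ext ?_
    rw [Linear.comp_smul, syzygyπ_desc, syzygyπ_desc]
    ext f
    change M.toTop n (r • c) f = algebraMap K Aᵐᵒᵖ r • M.toTop n c f
    rw [toTop_apply, toTop_apply, ← map_smul]
    congr 1
    simp only [Pi.smul_apply, smul_eq_mul, mul_smul, ← Finset.smul_sum]
    change _ = _ * algebraMap K A r
    rw [← Algebra.commutes, Algebra.smul_def]

theorem toExt_apply (n : ℕ) (c : M.Chain n → K) :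
    M.toExt n c = (M.syzygyClass n).comp (Ext.mk₀ (M.syzygyDesc n c)) (add_zero n) := rfl

/-- Every class comes from a map from the syzygy to the top, and such maps correspond to families of
scalars through `syzygyπ`; minimality keeps distinct maps distinct in `Ext`. -/
theorem toExt_bijective (n : ℕ) : Function.Bijective (M.toExt n) := by
  constructor
  · rw [injective_iff_map_eq_zero]
    intro c hc
    have h0 := M.syzygyClass_comp_injective hc
    apply toTop_injective n
    have h1 := M.syzygyπ_desc n c
    rw [h0, Limits.comp_zero] at h1
    rw [show M.toTop n c = (ModuleCat.ofHom (M.toTop n c)).hom from rfl, ← h1]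
    ext f
    rw [toTop_apply]
    simp
  · intro x
    obtain ⟨g, rfl⟩ := M.exists_syzygyClass_comp x
    obtain ⟨c, hc⟩ := exists_eq_toTop (M.syzygyπ n ≫ g).hom
    refine ⟨c, ?_⟩
    rw [toExt_apply]
    congr 2
    refine syzygy_hom_ext ?_
    rw [syzygyπ_desc, ← hc]
    rfl

theorem toExt_one : M.toExt 0 1 = Ext.mk₀ (𝟙 (topModule A)) := by
  refine (Ext.mk₀_id_comp _).trans ?_
  congr 1
  refine syzygy_hom_ext ?_
  rw [syzygyπ_desc]
  exact (Category.comp_id _).symm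

variable {M} in
/-- The comparison of resolutions that is given by a family of scalars. -/
def resolutionComparison {m : ℕ} (c : M.Chain m → K) (j : ℕ) :
    M.resolutionObj (m + j) ⟶ M.resolutionObj j :=
  ModuleCat.ofHom (comparison c j)

variable {M} in
theorem resolutionComparison_zero {m : ℕ} (c : M.Chain m → K) :
    resolutionComparison c 0 ≫ M.syzygyπ 0 = M.syzygyπ m ≫ M.syzygyDesc m c := by
  rw [syzygyπ_desc]
  ext f
  exact augmentation_comparison c f

variable {M} in
theorem resolutionComparison_diff {m : ℕ} (c : M.Chain m → K) (j : ℕ) :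
    resolutionComparison c (j + 1) ≫ ModuleCat.ofHom (M.diff j) =
      ModuleCat.ofHom (M.diff (m + j)) ≫ resolutionComparison c j :=
  ModuleCat.hom_ext (LinearMap.ext fun f => diff_comparison c j f)

/-- A morphism into a term of the resolution that is killed by the projection factors through
the next syzygy. -/
def syzygyLift {n : ℕ} {Y : ModuleCat.{u} Aᵐᵒᵖ} (f : Y ⟶ M.resolutionObj n)
    (h : f ≫ M.syzygyπ n = 0) : Y ⟶ M.syzygy (n + 1) :=
  have := (M.syzygyResolution.shortExact n).mono_f
  (M.syzygyResolution.shortExact n).exact.lift f h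

theorem syzygyLift_ι {n : ℕ} {Y : ModuleCat.{u} Aᵐᵒᵖ} (f : Y ⟶ M.resolutionObj n)
    (h : f ≫ M.syzygyπ n = 0) : M.syzygyLift f h ≫ M.syzygyι n = f := by
  have := (M.syzygyResolution.shortExact n).mono_f
  exact (M.syzygyResolution.shortExact n).exact.lift_f f h

variable {M} in
/-- The comparison of resolutions that is given by a family of scalars, on the syzygies. -/
def syzygyComparison {m : ℕ} (c : M.Chain m → K) : ∀ j,
    {g : M.syzygy (m + j) ⟶ M.syzygy j //
      M.syzygyπ (m + j) ≫ g = resolutionComparison c j ≫ M.syzygyπ j}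
  | 0 => ⟨M.syzygyDesc m c, (resolutionComparison_zero c).symm⟩
  | j + 1 =>
    have h : (M.syzygyι (m + j) ≫ resolutionComparison c j) ≫ M.syzygyπ j = 0 := by
      rw [Category.assoc, ← (syzygyComparison c j).2, ← Category.assoc, syzygyι_π,
        Limits.zero_comp]
    ⟨M.syzygyLift (M.syzygyι (m + j) ≫ resolutionComparison c j) h, by
      rw [← cancel_mono (M.syzygyι j), Category.assoc, Category.assoc, syzygyLift_ι, syzygyπ_ι,
        resolutionComparison_diff, ← Category.assoc]
      congr 1
      exact M.syzygyπ_ι (m + j)⟩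

variable {M} in
theorem syzygyComparison_ι {m : ℕ} (c : M.Chain m → K) (j : ℕ) :
    (syzygyComparison c (j + 1)).1 ≫ M.syzygyι j =
      M.syzygyι (m + j) ≫ resolutionComparison c j := by
  rw [syzygyComparison, syzygyLift_ι]

variable {M} in
theorem resolutionComparison_toTop {m n : ℕ} (c : M.Chain m → K) (c' : M.Chain n → K) :
    resolutionComparison c n ≫ ModuleCat.ofHom (M.toTop n c') =
      ModuleCat.ofHom (M.toTop (m + n) (convolution c c')) := by
  refine ModuleCat.hom_ext (LinearMap.ext fun f => ?_)
  exact toTop_comparison c c' f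

variable {M} in
theorem syzygyComparison_desc {m n : ℕ} (c : M.Chain m → K) (c' : M.Chain n → K) :
    (syzygyComparison c n).1 ≫ M.syzygyDesc n c' = M.syzygyDesc (m + n) (convolution c c') := by
  refine syzygy_hom_ext ?_
  rw [← Category.assoc, (syzygyComparison c n).2, Category.assoc, syzygyπ_desc, syzygyπ_desc]
  exact resolutionComparison_toTop c c'

theorem comp_mk₀_assoc {X Y Z : ModuleCat.{u} Aᵐᵒᵖ} {m n : ℕ} (x : Ext X Y m)
    (y : Ext Y Z n) {T : ModuleCat.{u} Aᵐᵒᵖ} (f : Z ⟶ T) :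
    x.comp (y.comp (Ext.mk₀ f) (add_zero n)) (rfl : m + n = m + n) =
      (x.comp y (rfl : m + n = m + n)).comp (Ext.mk₀ f) (add_zero (m + n)) :=
  (Ext.comp_assoc x y (Ext.mk₀ f) rfl (add_zero n) (by omega)).symm

/-- The Yoneda product is given by the convolution of families of scalars. -/
theorem toExt_comp_toExt {m n : ℕ} (c : M.Chain m → K) (c' : M.Chain n → K) :
    (M.toExt m c).comp (M.toExt n c') rfl = M.toExt (m + n) (convolution c c') := by
  have h1 := M.syzygyClass_comp_syzygyClass (fun j => (syzygyComparison c j).1)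
    (resolutionComparison c) (fun j => (syzygyComparison_ι c j).symm)
    (fun j => (syzygyComparison c j).2) n
  have h2 : (M.toExt m c).comp (M.syzygyClass n) rfl =
      (M.syzygyClass (m + n)).comp (Ext.mk₀ (syzygyComparison c n).1) (add_zero (m + n)) := h1
  calc (M.toExt m c).comp (M.toExt n c') rfl
      = ((M.toExt m c).comp (M.syzygyClass n) rfl).comp (Ext.mk₀ (M.syzygyDesc n c'))
          (add_zero (m + n)) := comp_mk₀_assoc _ _ _
    _ = (M.syzygyClass (m + n)).comp (Ext.mk₀ ((syzygyComparison c n).1 ≫ M.syzygyDesc n c'))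
          (add_zero (m + n)) := by
        rw [h2, ← Ext.mk₀_comp_mk₀]
        exact Ext.comp_assoc _ _ _ (add_zero _) (add_zero 0) (by omega)
    _ = M.toExt (m + n) (convolution c c') := by
        rw [syzygyComparison_desc]
        rfl

/-- The groups `Ext^n` have a basis that is indexed by the chains of degree `n`. -/
def extEquiv (n : ℕ) : (M.Chain n → K) ≃ₗ[K] SelfExt (topModule A) n :=
  LinearEquiv.ofBijective (M.toExt n) (M.toExt_bijective n)

end ExtAlgebra

end MonomialPresentation

/-! ## Graded subalgebras of a product of polynomial rings -/

namespace Polynomial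

/-- The variable is a root of the monic polynomial q(T) − q over K[q], and integral elements are
closed under sums and products. -/
theorem isIntegralElem_aeval {K : Type*} [Field K] {q : K[X]} (hq : q.Monic)
    (hd : 0 < q.natDegree) (f : K[X]) :
    (aeval (R := K) q).toRingHom.IsIntegralElem f := by
  have hX : (aeval (R := K) q).toRingHom.IsIntegralElem X := by
    refine ⟨q.map C - C X, ?_, ?_⟩
    · refine (hq.map C).sub_of_left ?_
      rw [degree_map_eq_of_injective C_injective]
      exact lt_of_le_of_lt degree_C_le (natDegree_pos_iff_degree_pos.1 hd)
    · rw [eval₂_sub, eval₂_map, eval₂_C]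
      have : (aeval (R := K) q).toRingHom.comp C = C := by
        ext x
        simp
      rw [this, eval₂_C_X]
      simp
  have hC : ∀ a : K, (aeval (R := K) q).toRingHom.IsIntegralElem (C a) := by
    intro a
    have := (aeval (R := K) q).toRingHom.isIntegralElem_map (x := C a)
    simpa using this
  induction f using Polynomial.induction_on with
  | C a => exact hC a
  | add f g hf hg => exact hf.add _ hg
  | monomial n a h =>
    rw [pow_succ, ← mul_assoc]
    exact h.mul _ hX

end Polynomial

section GradedSubalgebra

open Polynomial

variable {K : Type*} [Field K] {ι : Type*} (H : Subalgebra K (ι → K[X]))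

/-- The kernel of a coordinate of a subalgebra of a product. -/
def coordKer (i : ι) : Ideal H := RingHom.ker ((Pi.evalAlgHom K (fun _ : ι => K[X]) i).comp H.val)

variable {H}

theorem mem_coordKer {i : ι} {h : H} : h ∈ coordKer H i ↔ (h : ι → K[X]) i = 0 := Iff.rfl

/-- There are finitely many coordinate kernels, and they intersect in zero. -/
theorem exists_coordKer_le [Finite ι] {P : Ideal H} (hP : P.IsPrime) : ∃ i, coordKer H i ≤ P := by
  have := Fintype.ofFinite ι
  have h : Finset.univ.inf (coordKer H) ≤ P := by
    intro h hh
    have : h = 0 := by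
      refine Subtype.ext (funext fun i => ?_)
      exact mem_coordKer.1 ((Submodule.mem_finsetInf).1 hh i (Finset.mem_univ i))
    rw [this]
    exact P.zero_mem
  obtain ⟨i, -, hi⟩ := (hP.inf_le' (s := Finset.univ)).1 h
  exact ⟨i, hi⟩

/-- Modulo the coordinate kernel, `H` lies in K[X] and `P` contains a nonconstant q. As K[X] is
integral over K[q], the domain `H ⧸ P` is integral over K, hence a field. -/
theorem isMaximal_of_coordKer_le {i : ι} {P : Ideal H} (hP : P.IsPrime) (hi : coordKer H i ≤ P)
    {h : H} (hh : h ∈ P) (h0 : (h : ι → K[X]) i ≠ 0) : P.IsMaximal := by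
  set q : K[X] := (h : ι → K[X]) i with hq
  set a : K := q.leadingCoeff⁻¹
  have hmon : (a • q).Monic := by
    rw [smul_eq_C_mul, mul_comm]
    exact monic_mul_leadingCoeff_inv h0
  have haP : a • h ∈ P := by
    rw [Algebra.smul_def]
    exact P.mul_mem_left _ hh
  have hah : ((a • h : H) : ι → K[X]) i = a • q := rfl
  -- A nonzero constant coordinate would put `1` into `P`.
  have hd : 0 < (a • q).natDegree := by
    by_contra hd
    have h1 : a • q = 1 := hmon.natDegree_eq_zero.1 (by omega)
    have : a • h - 1 ∈ P := hi (mem_coordKer.2 (by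
      change ((a • h : H) : ι → K[X]) i - 1 = 0
      rw [hah, h1, sub_self]))
    exact hP.one_notMem (by simpa using P.sub_mem haP this)
  have hint : Algebra.IsIntegral K (H ⧸ P) := by
    refine ⟨fun x => ?_⟩
    obtain ⟨f, rfl⟩ := Ideal.Quotient.mk_surjective x
    obtain ⟨F, hF, hFf⟩ := isIntegralElem_aeval hmon hd ((f : ι → K[X]) i)
    -- The coefficients of `F` are polynomials in a variable that stands for `a • h`, which vanishes
    -- modulo `P`.
    refine ⟨F.map (evalRingHom 0), hF.map _, ?_⟩
    have h1 : eval₂ (aeval (R := K) (a • h)).toRingHom f F ∈ P := by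
      refine hi ?_
      rw [coordKer, RingHom.mem_ker, ← hFf]
      change ((Pi.evalAlgHom K (fun _ : ι => K[X]) i).comp H.val).toRingHom _ = _
      rw [hom_eval₂]
      congr 1
      ext x
      · simp
      · simp [← hah]
    rw [← Ideal.Quotient.eq_zero_iff_mem, hom_eval₂] at h1
    rw [← h1, eval₂_map]
    congr 1
    ext x
    · simp
    · simp [Ideal.Quotient.eq_zero_iff_mem.2 haP]
  have := Ideal.Quotient.isDomain P
  have hf : IsField (H ⧸ P) :=
    isField_of_isIntegral_of_isField' (R := K) (S := H ⧸ P) (Field.toIsField K)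
  exact Ideal.Quotient.maximal_of_isField _ hf

/-- A prime that is not minimal properly contains a minimal prime `Q`, and `Q` contains a coordinate
kernel. An element outside `Q` has a nonzero coordinate there, so the larger prime is maximal. -/
theorem ringKrullDim_subalgebra_le_one [Finite ι] : ringKrullDim H ≤ 1 := by
  have : Ring.KrullDimLE 1 H := by
    rw [Ring.krullDimLE_one_iff]
    intro P hP
    refine or_iff_not_imp_left.2 fun hmin => ?_
    obtain ⟨Q, hQ, hQP⟩ := Ideal.exists_minimalPrimes_le (bot_le : ⊥ ≤ P)
    have hne : Q ≠ P := fun h => hmin (h ▸ hQ)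
    obtain ⟨h, hhP, hhQ⟩ := SetLike.exists_of_lt (lt_of_le_of_ne hQP hne)
    obtain ⟨i, hi⟩ := exists_coordKer_le hQ.1.1
    exact isMaximal_of_coordKer_le hP (hi.trans hQP) hhP fun h0 => hhQ (hi (mem_coordKer.2 h0))
  exact_mod_cast Ring.krullDimLE_iff.1 this

/-- For each coordinate in which a positive degree occurs, choose a homogeneous element of `H` that
is nonzero there. Over the Noetherian algebra `A` generated by these finitely many elements, `H` is
contained in a finitely generated module, hence is itself finite. -/
theorem finiteType_of_graded [Finite ι]
    (hH : ∀ h ∈ H, ∀ n, (fun i => monomial n ((h i).coeff n)) ∈ H) : Algebra.FiniteType K H := by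
  classical
  have := Fintype.ofFinite ι
  let S : Set ι := {i | ∃ h ∈ H, ∃ n, 1 ≤ n ∧ (h i).coeff n ≠ 0}
  have hS : ∀ i : S, ∃ g ∈ H, ∃ n, 1 ≤ n ∧ ∃ a : K, a ≠ 0 ∧ g i = monomial n a := by
    rintro ⟨i, h, hh, n, hn, h0⟩
    exact ⟨_, hH h hh n, n, hn, _, h0, rfl⟩
  choose g hg n hn a ha hga using hS
  let A : Subalgebra K (ι → K[X]) := Algebra.adjoin K (Set.range g)
  have hAH : A ≤ H := Algebra.adjoin_le (by rintro _ ⟨i, rfl⟩; exact hg i)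
  have hAfg : Algebra.FiniteType K A :=
    (Subalgebra.fg_iff_finiteType _).1 ⟨(Set.finite_range g).toFinset, by simp [A]⟩
  have hAnoeth : IsNoetherianRing A := Algebra.FiniteType.isNoetherianRing K A
  -- The coordinate monomials of degree at most `N` generate `M`; in the coordinates of `S`, those
  -- of higher degree are reached by multiplying lower ones with `g i`.
  let N : ℕ := Finset.univ.sup n
  let M : Submodule A (ι → K[X]) := Submodule.span A
    (Set.range fun p : ι × Fin (N + 1) =>
      (Pi.single p.1 (monomial (p.2 : ℕ) (1 : K)) : ι → K[X]))
  have hMfg : M.FG := Submodule.fg_span (Set.finite_range _)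
  have hsmul : ∀ (c : K) x, x ∈ M → c • x ∈ M := fun c x hx => by
    have := M.smul_mem (algebraMap K A c) hx
    rwa [algebraMap_smul] at this
  have hlow : ∀ i k, k ≤ N → (Pi.single i (monomial k (1 : K)) : ι → K[X]) ∈ M := fun i k hk =>
    Submodule.subset_span ⟨(i, ⟨k, by omega⟩), rfl⟩
  have hmono : ∀ (i : S) k, (Pi.single (i : ι) (monomial k (1 : K)) : ι → K[X]) ∈ M := by
    intro i k
    induction k using Nat.strong_induction_on with
    | _ k ih =>
      by_cases hk : k ≤ N
      · exact hlow i k hk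
      · have hni : n i ≤ N := Finset.le_sup (Finset.mem_univ i)
        have h1 := M.smul_mem (⟨g i, Algebra.subset_adjoin ⟨i, rfl⟩⟩ : A)
          (ih (k - n i) (by have := hn i; omega))
        have h2 := hsmul (a i)⁻¹ _ h1
        convert h2 using 1
        change _ = (a i)⁻¹ • (g i * _)
        rw [← Pi.single_mul_right, ← Pi.single_smul, hga, monomial_mul_monomial, smul_monomial,
          mul_one, smul_eq_mul, inv_mul_cancel₀ (ha i), Nat.add_sub_cancel' (by omega)]
  have hHM : ∀ h ∈ H, h ∈ M := by
    intro h hh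
    have h1 : h = ∑ i, Pi.single i (h i) := (Finset.univ_sum_single h).symm
    rw [h1]
    refine M.sum_mem fun i _ => ?_
    have h2 : (Pi.single i (h i) : ι → K[X]) =
        ∑ k ∈ (h i).support, (h i).coeff k • Pi.single i (monomial k (1 : K)) := by
      conv_lhs => rw [(h i).as_sum_support]
      refine (map_sum (LinearMap.single K (fun _ : ι => K[X]) i) _ _).trans ?_
      refine Finset.sum_congr rfl fun k _ => ?_
      rw [← Pi.single_smul, smul_monomial, smul_eq_mul, mul_one, LinearMap.single_apply]
    rw [h2]
    refine M.sum_mem fun k hk => hsmul _ _ ?_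
    rcases Nat.eq_zero_or_pos k with rfl | hk0
    · exact hlow i 0 (Nat.zero_le _)
    · exact hmono ⟨i, h, hh, k, hk0, mem_support_iff.1 hk⟩ k
  let HA : Submodule A (ι → K[X]) :=
    { carrier := H
      add_mem' := fun ha hb => H.add_mem ha hb
      zero_mem' := H.zero_mem
      smul_mem' := fun c x hx => H.mul_mem (hAH c.2) hx }
  have hMnoeth : IsNoetherian A M := isNoetherian_of_fg_of_noetherian M hMfg
  have hHfg : HA.FG := by
    have := (isNoetherian_submodule.1 hMnoeth) HA hHM
    exact this
  let _ : Algebra A H := (Subalgebra.inclusion hAH).toAlgebra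
  have : IsScalarTower K A H := IsScalarTower.of_algebraMap_eq fun _ => rfl
  have hfin : Module.Finite A H := by
    have h1 : Module.Finite A HA := Module.Finite.iff_fg.2 hHfg
    let e : HA →ₗ[A] H :=
      { toFun := fun x => ⟨x.1, x.2⟩
        map_add' := fun _ _ => rfl
        map_smul' := fun _ _ => rfl }
    exact Module.Finite.of_surjective e fun x => ⟨⟨x.1, x.2⟩, rfl⟩
  have : Algebra.FiniteType A H := inferInstance
  exact Algebra.FiniteType.trans hAfg this

end GradedSubalgebra

/-! ## Rings with a multiplicative basis of words -/

/-- A graded algebra whose elements of positive degree have a basis of words that is closed under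
multiplication up to zero, such that the words of a given degree form a prefix code. -/
structure WordGrading (K : Type*) [Field K] (R : Type*) [Ring R] [Algebra K R]
    (V : Type*) (α : Type*) [DecidableEq α] where
  homogeneous : ℕ → Submodule K R
  one_mem : (1 : R) ∈ homogeneous 0
  mul_mem : ∀ {m n x y}, x ∈ homogeneous m → y ∈ homogeneous n → x * y ∈ homogeneous (m + n)
  words : ℕ → Finset (List α)
  basis : ℕ → List α → R
  coord : ℕ → List α → R →ₗ[K] K
  basis_mem : ∀ n w, basis n w ∈ homogeneous n
  basis_eq_zero : ∀ {n w}, w ∉ words n → basis n w = 0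
  coord_basis : ∀ {n v w}, w ∈ words n → coord n v (basis n w) = if v = w then 1 else 0
  sum_coord : ∀ {n x}, 1 ≤ n → x ∈ homogeneous n → ∑ w ∈ words n, coord n w x • basis n w = x
  basis_mul : ∀ {m n c d}, 1 ≤ m → 1 ≤ n → c ∈ words m → d ∈ words n →
    basis m c * basis n d = basis (m + n) (c ++ d)
  prefix_free : ∀ {n u v w}, 1 ≤ n → u ∈ words n → v ∈ words n → u <+: w → v <+: w → u = v
  truncation : ∀ {m n w}, 1 ≤ m → m ≤ n → w ∈ words n → ∃ u ∈ words m, u <+: w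
  ne_nil : ∀ {n w}, 1 ≤ n → w ∈ words n → w ≠ []
  append_two : ∀ {m c d}, 2 ≤ m → c ∈ words m → c ++ c ∈ words (m + m) → d ∈ words 2 → d <+: c →
    c ++ d ∈ words (m + 2)
  -- Continuation by words of degree two depends only on the last piece of a chain. If the chain
  -- word is a suffix of `y ++ d`, this piece is a suffix of `d`; so two such pieces are comparable,
  -- and the longer one allows more continuations.
  compare_two : ∀ {m n c c' d}, 2 ≤ m → 2 ≤ n → c ∈ words m → c' ∈ words n → d ∈ words 2 →
    (∃ y, c <:+ y ++ d) → (∃ y, c' <:+ y ++ d) →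
    (∀ b ∈ words 2, c ++ b ∈ words (m + 2) → c' ++ b ∈ words (n + 2)) ∨
    (∀ b ∈ words 2, c' ++ b ∈ words (n + 2) → c ++ b ∈ words (m + 2))
  vertexCoord : V → R →ₗ[K] K
  vertexCoord_one : ∀ v, vertexCoord v 1 = 1
  vertexCoord_mul : ∀ {v x y}, x ∈ homogeneous 0 → y ∈ homogeneous 0 →
    vertexCoord v (x * y) = vertexCoord v x * vertexCoord v y
  eq_zero_of_vertexCoord : ∀ {x}, x ∈ homogeneous 0 → (∀ v, vertexCoord v x = 0) → x = 0
  start : List α → V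
  start_prefix : ∀ {u w}, u ≠ [] → u <+: w → start u = start w
  mul_basis : ∀ {n x w}, x ∈ homogeneous 0 → 1 ≤ n → w ∈ words n →
    x * basis n w = vertexCoord (start w) x • basis n w
  -- The directness of the grading: functionals chosen degree by degree assemble into one linear
  -- map.
  exists_lift : ∀ f : ℕ → R →ₗ[K] K, ∃ g : R →ₗ[K] Polynomial K,
    ∀ n x, x ∈ homogeneous n → g x = Polynomial.monomial n (f n x)

/-! ### Homogeneous central elements and essential words. -/

namespace WordGrading

section Repetition

variable {α : Type*}

/-- Repetition of a word. -/
def rep (c : List α) (k : ℕ) : List α := (List.replicate k c).flatten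

theorem rep_succ (c : List α) (k : ℕ) : rep c (k + 1) = c ++ rep c k := by
  simp [rep, List.replicate_succ]

theorem rep_add (c : List α) (j k : ℕ) : rep c (j + k) = rep c j ++ rep c k := by
  rw [rep, List.replicate_add, List.flatten_append]
  rfl

theorem rep_prefix (c : List α) {j k : ℕ} (h : j ≤ k) : rep c j <+: rep c k := by
  obtain ⟨i, rfl⟩ := Nat.exists_eq_add_of_le h
  rw [rep_add]
  exact List.prefix_append _ _

theorem rep_one (c : List α) : rep c 1 = c := by simp [rep]

theorem rep_two (c : List α) : rep c 2 = c ++ c := by simp [rep, List.replicate_succ]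

theorem rep_append_self (c : List α) (k : ℕ) : rep (c ++ c) k = rep c (k + k) := by
  induction k with
  | zero => rfl
  | succ k ih =>
    rw [rep_succ, ih, show k + 1 + (k + 1) = (k + k) + 1 + 1 by omega, rep_succ, rep_succ,
      List.append_assoc]

theorem rep_append_eq {c w x : List α} (h : c ++ w = w ++ x) (k : ℕ) :
    rep c k ++ w = w ++ rep x k := by
  induction k with
  | zero => simp [rep]
  | succ k ih =>
    rw [rep_succ, rep_succ, List.append_assoc, ih, ← List.append_assoc, h, List.append_assoc]

end Repetition

variable {K : Type*} [Field K] {R : Type*} [Ring R] [Algebra K R] {V : Type*} {α : Type*}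
  [DecidableEq α] (W : WordGrading K R V α)

/-- The elements of the graded centre that are homogeneous of degree `m`. -/
def Central (m : ℕ) (z : R) : Prop :=
  z ∈ W.homogeneous m ∧ ∀ n, ∀ y ∈ W.homogeneous n, z * y = (-1) ^ (m * n) * (y * z)

variable {W}

theorem neg_one_pow_mul_comm (k : ℕ) (x : R) : (-1) ^ k * x = x * (-1) ^ k :=
  ((Commute.neg_one_left x).pow_left k).eq

theorem Central.mul {m n : ℕ} {x y : R} (hx : W.Central m x) (hy : W.Central n y) :
    W.Central (m + n) (x * y) := by
  refine ⟨W.mul_mem hx.1 hy.1, fun k u hu => ?_⟩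
  rw [mul_assoc, hy.2 k u hu, ← mul_assoc, ← neg_one_pow_mul_comm, mul_assoc, ← mul_assoc x,
    hx.2 k u hu, add_mul, pow_add]
  rw [neg_one_pow_mul_comm (m * k) ((-1) ^ (n * k))]
  simp only [mul_assoc]

theorem Central.add {m : ℕ} {x y : R} (hx : W.Central m x) (hy : W.Central m y) :
    W.Central m (x + y) := by
  refine ⟨Submodule.add_mem _ hx.1 hy.1, fun k u hu => ?_⟩
  rw [add_mul, hx.2 k u hu, hy.2 k u hu, mul_add, mul_add]

theorem Central.neg {m : ℕ} {x : R} (hx : W.Central m x) : W.Central m (-x) := by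
  refine ⟨Submodule.neg_mem _ hx.1, fun k u hu => ?_⟩
  rw [neg_mul, hx.2 k u hu, mul_neg, mul_neg]

variable (W) in
theorem central_zero (m : ℕ) : W.Central m 0 := ⟨Submodule.zero_mem _, by simp⟩

theorem basis_ne_zero_iff {n : ℕ} {w : List α} : W.basis n w ≠ 0 ↔ w ∈ W.words n := by
  refine ⟨fun h => by_contra fun hw => h (W.basis_eq_zero hw), fun h h0 => ?_⟩
  have := W.coord_basis (v := w) h
  rw [h0, map_zero, if_pos rfl] at this
  exact zero_ne_one this

theorem coord_basis_of_ne {n : ℕ} {v w : List α} (h : v ≠ w) : W.coord n v (W.basis n w) = 0 := by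
  by_cases hw : w ∈ W.words n
  · rw [W.coord_basis hw, if_neg h]
  · rw [W.basis_eq_zero hw, map_zero]

theorem coord_basis_self {n : ℕ} {w : List α} (h : w ∈ W.words n) :
    W.coord n w (W.basis n w) = 1 := by
  rw [W.coord_basis h, if_pos rfl]

theorem mul_eq_sum {m n : ℕ} (hm : 1 ≤ m) (hn : 1 ≤ n) {x y : R} (hx : x ∈ W.homogeneous m)
    (hy : y ∈ W.homogeneous n) :
    x * y = ∑ u ∈ W.words m, ∑ v ∈ W.words n,
      (W.coord m u x * W.coord n v y) • W.basis (m + n) (u ++ v) := by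
  conv_lhs => rw [← W.sum_coord hm hx, ← W.sum_coord hn hy]
  rw [Finset.sum_mul]
  refine Finset.sum_congr rfl fun u hu => ?_
  rw [Finset.mul_sum]
  refine Finset.sum_congr rfl fun v hv => ?_
  rw [smul_mul_smul_comm, W.basis_mul hm hn hu hv]

/-- The coordinate of a product at a concatenation of words. -/
theorem coord_mul {m n : ℕ} (hm : 1 ≤ m) (hn : 1 ≤ n) {x y : R} (hx : x ∈ W.homogeneous m)
    (hy : y ∈ W.homogeneous n) {u v : List α} (hu : u ∈ W.words m) (hv : v ∈ W.words n)
    (huv : u ++ v ∈ W.words (m + n)) :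
    W.coord (m + n) (u ++ v) (x * y) = W.coord m u x * W.coord n v y := by
  rw [mul_eq_sum hm hn hx hy]
  simp only [map_sum, map_smul, smul_eq_mul]
  rw [Finset.sum_eq_single u, Finset.sum_eq_single v, coord_basis_self huv, mul_one]
  · intro v' _ hne
    rw [coord_basis_of_ne, mul_zero]
    simpa using hne.symm
  · exact fun h => absurd hv h
  · intro u' hu' hne
    refine Finset.sum_eq_zero fun v' _ => ?_
    rw [coord_basis_of_ne, mul_zero]
    intro e
    exact hne (W.prefix_free hm hu' hu (w := u ++ v) (e ▸ List.prefix_append _ _)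
      (List.prefix_append _ _))
  · exact fun h => absurd hu h

theorem exists_of_coord_mul_ne_zero {m n : ℕ} (hm : 1 ≤ m) (hn : 1 ≤ n) {x y : R}
    (hx : x ∈ W.homogeneous m) (hy : y ∈ W.homogeneous n) {w : List α}
    (h : W.coord (m + n) w (x * y) ≠ 0) :
    ∃ u ∈ W.words m, ∃ v ∈ W.words n, u ++ v = w ∧ W.coord m u x ≠ 0 ∧ W.coord n v y ≠ 0 := by
  rw [mul_eq_sum hm hn hx hy] at h
  simp only [map_sum, map_smul, smul_eq_mul] at h
  obtain ⟨u, hu, h⟩ := Finset.exists_ne_zero_of_sum_ne_zero h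
  obtain ⟨v, hv, h⟩ := Finset.exists_ne_zero_of_sum_ne_zero h
  refine ⟨u, hu, v, hv, ?_, left_ne_zero_of_mul (left_ne_zero_of_mul h),
    right_ne_zero_of_mul (left_ne_zero_of_mul h)⟩
  by_contra hne
  exact h (by rw [coord_basis_of_ne (Ne.symm hne), mul_zero])

/-- A word in the support of a central element can be moved past the words that it composes
with. -/
theorem Central.exists_append_eq {m n : ℕ} (hm : 1 ≤ m) (hn : 1 ≤ n) {z : R} (hz : W.Central m z)
    {c b : List α} (hc : c ∈ W.words m) (hb : b ∈ W.words n) (hcz : W.coord m c z ≠ 0)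
    (hcb : c ++ b ∈ W.words (m + n)) :
    ∃ c' ∈ W.words m, W.coord m c' z ≠ 0 ∧ c ++ b = b ++ c' := by
  have h1 := coord_mul hm hn hz.1 (W.basis_mem n b) hc hb hcb
  rw [coord_basis_self hb, mul_one, hz.2 n _ (W.basis_mem n b)] at h1
  have h2 : W.coord (n + m) (c ++ b) (W.basis n b * z) ≠ 0 := by
    rw [add_comm n m]
    intro h0
    rcases neg_one_pow_eq_or R (m * n) with h | h
    · rw [h, one_mul, h0] at h1
      exact hcz h1.symm
    · rw [h, neg_one_mul, map_neg, h0, neg_zero] at h1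
      exact hcz h1.symm
  obtain ⟨u, hu, v, hv, huv, hu0, hv0⟩ :=
    exists_of_coord_mul_ne_zero hn hm (W.basis_mem n b) hz.1 h2
  refine ⟨v, hv, hv0, ?_⟩
  by_cases hub : u = b
  · rw [← huv, hub]
  · rw [coord_basis_of_ne hub] at hu0
    exact absurd rfl hu0

/-- Centrality of `x` gives `c d = d c'`, and that of `y` gives `d c' = c' d'`. So `c` and `c'` are
prefixes of one word in the same degree, hence equal. -/
theorem Central.append_comm {m n : ℕ} (hm : 1 ≤ m) (hn : 1 ≤ n) {x y : R} (hx : W.Central m x)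
    (hy : W.Central n y) {c d : List α} (hc : c ∈ W.words m) (hd : d ∈ W.words n)
    (hcx : W.coord m c x ≠ 0) (hdy : W.coord n d y ≠ 0) (hcd : c ++ d ∈ W.words (m + n)) :
    c ++ d = d ++ c := by
  obtain ⟨c', hc', -, h1⟩ := hx.exists_append_eq hm hn hc hd hcx hcd
  obtain ⟨d', -, -, h2⟩ := hy.exists_append_eq hn hm hd hc' hdy
    (by rw [← h1, add_comm]; exact hcd)
  rw [h1]
  congr 1
  refine (W.prefix_free hm hc hc' (w := c ++ d) (List.prefix_append _ _) ?_).symm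
  rw [h1, h2]
  exact List.prefix_append _ _

/-- If `w` occurs in `z` and `w b` is nonzero, then `w b` also begins with `b` by centrality; as `w`
and `b` have the same degree, `w = b`. -/
theorem Central.mul_basis_self {m : ℕ} (hm : 1 ≤ m) {z : R} (hz : W.Central m z) {b : List α}
    (hb : b ∈ W.words m) :
    z * W.basis m b = W.coord m b z • (W.basis m b * W.basis m b) := by
  conv_lhs => rw [← W.sum_coord hm hz.1]
  rw [Finset.sum_mul, Finset.sum_eq_single b, smul_mul_assoc]
  · intro w hw hne
    rw [smul_mul_assoc, W.basis_mul hm hm hw hb]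
    by_cases h0 : W.coord m w z = 0
    · rw [h0, zero_smul]
    by_cases hwb : w ++ b ∈ W.words (m + m)
    · obtain ⟨c', -, -, h⟩ := hz.exists_append_eq hm hm hw hb h0 hwb
      exact absurd (W.prefix_free hm hw hb (w := w ++ b) (List.prefix_append _ _)
        (h ▸ List.prefix_append _ _)) hne
    · rw [W.basis_eq_zero hwb, smul_zero]
  · exact fun h => absurd hb h

/-- By `Central.mul_basis_self` there are no cross terms. -/
theorem Central.pow_succ_eq {m : ℕ} (hm : 1 ≤ m) {z : R} (hz : W.Central m z) (k : ℕ) :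
    z ^ (k + 1) = ∑ c ∈ W.words m, W.coord m c z ^ (k + 1) • W.basis m c ^ (k + 1) := by
  have h : ∀ k, ∀ c ∈ W.words m, z ^ k * W.basis m c = W.coord m c z ^ k • W.basis m c ^ (k + 1) := by
    intro k c hc
    induction k with
    | zero => simp
    | succ k ih =>
      rw [pow_succ, mul_assoc, hz.mul_basis_self hm hc, mul_smul_comm, ← mul_assoc, ih,
        smul_mul_assoc, smul_smul, ← pow_succ, pow_succ' (W.coord m c z)]
  conv_lhs => rw [pow_succ]; rw (occs := .pos [2]) [← W.sum_coord hm hz.1]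
  rw [Finset.mul_sum]
  refine Finset.sum_congr rfl fun c hc => ?_
  rw [mul_smul_comm, h k c hc, smul_smul, ← pow_succ']

/-- A central element all whose terms are nilpotent is nilpotent. -/
theorem Central.isNilpotent {m : ℕ} (hm : 1 ≤ m) {z : R} (hz : W.Central m z)
    (h : ∀ c ∈ W.words m, W.coord m c z ≠ 0 → IsNilpotent (W.basis m c)) : IsNilpotent z := by
  have h' : ∀ c ∈ W.words m, ∃ N, ∀ k, N ≤ k →
      W.coord m c z ^ (k + 1) • W.basis m c ^ (k + 1) = 0 := by
    intro c hc
    by_cases h0 : W.coord m c z = 0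
    · exact ⟨0, fun k _ => by rw [h0, zero_pow (Nat.succ_ne_zero k), zero_smul]⟩
    · obtain ⟨N, hN⟩ := h c hc h0
      exact ⟨N, fun k hk => by rw [pow_eq_zero_of_le (by omega) hN, smul_zero]⟩
  choose! N hN using h'
  refine ⟨(W.words m).sup N + 1, ?_⟩
  rw [hz.pow_succ_eq hm]
  exact Finset.sum_eq_zero fun c hc => hN c hc _ (Finset.le_sup hc)

theorem basis_pow {m : ℕ} (hm : 1 ≤ m) {c : List α} {k : ℕ} (h : W.basis m c ^ (k + 1) ≠ 0) :
    rep c (k + 1) ∈ W.words ((k + 1) * m) ∧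
      W.basis m c ^ (k + 1) = W.basis ((k + 1) * m) (rep c (k + 1)) := by
  induction k with
  | zero =>
    simp only [zero_add, pow_one, one_mul, rep_one] at h ⊢
    exact ⟨basis_ne_zero_iff.1 h, trivial⟩
  | succ k ih =>
    rw [pow_succ'] at h
    obtain ⟨h1, h2⟩ := ih (right_ne_zero_of_mul h)
    have hc : c ∈ W.words m := basis_ne_zero_iff.1 (left_ne_zero_of_mul h)
    have hd : m + (k + 1) * m = (k + 1 + 1) * m := by ring
    have he : W.basis m c * W.basis m c ^ (k + 1) =
        W.basis ((k + 1 + 1) * m) (rep c (k + 1 + 1)) := by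
      rw [h2, W.basis_mul hm (Nat.mul_pos (Nat.succ_pos k) hm) hc h1, hd, ← rep_succ]
    exact ⟨basis_ne_zero_iff.1 (he ▸ h), by rw [pow_succ', he]⟩

theorem pow_ne_zero_of_not_isNilpotent {x : R} (h : ¬IsNilpotent x) (k : ℕ) : x ^ k ≠ 0 :=
  fun h0 => h ⟨k, h0⟩

theorem rep_mem {m : ℕ} (hm : 1 ≤ m) {c : List α} (h : ¬IsNilpotent (W.basis m c)) {k : ℕ}
    (hk : 1 ≤ k) : rep c k ∈ W.words (k * m) := by
  obtain ⟨k, rfl⟩ := Nat.exists_eq_add_of_le' hk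
  exact (basis_pow hm (pow_ne_zero_of_not_isNilpotent h _)).1

theorem basis_pow_eq {m : ℕ} (hm : 1 ≤ m) {c : List α} (h : ¬IsNilpotent (W.basis m c)) {k : ℕ}
    (hk : 1 ≤ k) : W.basis m c ^ k = W.basis (k * m) (rep c k) := by
  obtain ⟨k, rfl⟩ := Nat.exists_eq_add_of_le' hk
  exact (basis_pow hm (pow_ne_zero_of_not_isNilpotent h _)).2

variable (W) in
/-- The words of degree `m` that occur in a central element and are not nilpotent. -/
def Essential (m : ℕ) (c : List α) : Prop :=
  ¬IsNilpotent (W.basis m c) ∧ ∃ z, W.Central m z ∧ W.coord m c z ≠ 0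

theorem Essential.mem {m : ℕ} {c : List α} (h : W.Essential m c) : c ∈ W.words m :=
  basis_ne_zero_iff.1 fun h0 => h.1 (h0 ▸ IsNilpotent.zero)

theorem Essential.append_self_mem {m : ℕ} (hm : 1 ≤ m) {c : List α} (h : W.Essential m c) :
    c ++ c ∈ W.words (m + m) := by
  have := rep_mem hm h.1 (k := 2) (by norm_num)
  rwa [rep_two, two_mul] at this

/-- A nonnilpotent word can be continued by the beginning of degree two of itself. -/
theorem rep_append_mem {m : ℕ} (hm : 2 ≤ m) {c d : List α} (h : ¬IsNilpotent (W.basis m c))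
    (hd : d ∈ W.words 2) (hdc : d <+: c) {k : ℕ} (hk : 1 ≤ k) :
    rep c k ++ d ∈ W.words (k * m + 2) := by
  refine W.append_two ?_ (rep_mem (by omega) h hk) ?_ hd (hdc.trans ?_)
  · nlinarith
  · rw [← rep_add, ← add_mul]
    exact rep_mem (by omega) h (by omega)
  · conv_lhs => rw [← rep_one c]
    exact rep_prefix c hk

/-- Essential words can be rotated. -/
theorem Essential.rotate {m : ℕ} (hm : 2 ≤ m) {c d : List α} (h : W.Essential m c)
    (hd : d ∈ W.words 2) (hdc : d <+: c) : ∃ c', W.Essential m c' ∧ c ++ d = d ++ c' := by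
  have h1 : 1 ≤ m := by omega
  obtain ⟨hn, z, hz, hcz⟩ := h
  have hc : c ∈ W.words m := basis_ne_zero_iff.1 fun h0 => hn (h0 ▸ IsNilpotent.zero)
  have hcd : c ++ d ∈ W.words (m + 2) := by
    have := rep_append_mem hm hn hd hdc (k := 1) le_rfl
    rwa [rep_one, one_mul] at this
  obtain ⟨c', hc', hcz', he⟩ := hz.exists_append_eq h1 (by norm_num) hc hd hcz hcd
  refine ⟨c', ⟨?_, z, hz, hcz'⟩, he⟩
  -- If a power of `c'` vanished, `d c'^(k+1) = c^(k+1) d` would vanish too, but every power of `c`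
  -- can be continued by `d`.
  have hsc : SemiconjBy (W.basis 2 d) (W.basis m c') (W.basis m c) := by
    rw [SemiconjBy, W.basis_mul (by norm_num) h1 hd hc', W.basis_mul h1 (by norm_num) hc hd, he,
      add_comm]
  rintro ⟨k, hk⟩
  have h2 := (hsc.pow_right (k + 1)).eq
  rw [pow_succ, hk, zero_mul, mul_zero, basis_pow_eq h1 hn (by omega),
    W.basis_mul (Nat.mul_pos (Nat.succ_pos k) h1) (by norm_num)
      (rep_mem h1 hn (by omega)) hd] at h2
  exact basis_ne_zero_iff.2 (rep_append_mem hm hn hd hdc (by omega)) h2.symm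

/-- The beginning of an essential word is determined by the end of the previous rotation. -/
theorem Essential.two_eq {m n : ℕ} (hm : 2 ≤ m) (hn : 2 ≤ n) {c c' d b b' : List α}
    (hc : W.Essential m c) (hc' : W.Essential n c') (hd : d ∈ W.words 2) (hcd : ∃ y, c <:+ y ++ d)
    (hcd' : ∃ y, c' <:+ y ++ d) (hb : b ∈ W.words 2) (hb' : b' ∈ W.words 2) (hbc : b <+: c)
    (hbc' : b' <+: c') : b = b' := by
  -- `compare_two` gives one of two symmetric cases. The word `c' b` is nonzero and by centrality
  -- also begins with `b`; so `b` and `b'` are prefixes of degree two of the same word.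
  have key : ∀ {m n : ℕ}, 2 ≤ m → 2 ≤ n → ∀ {c c' b b' : List α}, W.Essential m c →
      W.Essential n c' → b ∈ W.words 2 → b' ∈ W.words 2 → b <+: c → b' <+: c' →
      (∀ b ∈ W.words 2, c ++ b ∈ W.words (m + 2) → c' ++ b ∈ W.words (n + 2)) → b = b' := by
    intro m n hm hn c c' b b' hc hc' hb hb' hbc hbc' h
    have h1 := h b hb (by
      have := rep_append_mem hm hc.1 hb hbc (k := 1) le_rfl
      rwa [rep_one, one_mul] at this)
    obtain ⟨z, hz, hcz⟩ := hc'.2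
    obtain ⟨x, -, -, hx⟩ := hz.exists_append_eq (by omega) (by norm_num) hc'.mem hb hcz h1
    refine W.prefix_free (by norm_num) hb hb' (w := c' ++ b) ?_ (hbc'.trans (List.prefix_append _ _))
    rw [hx]
    exact List.prefix_append _ _
  rcases W.compare_two hm hn hc.mem hc'.mem hd hcd hcd' with h | h
  · exact key hm hn hc hc' hb hb' hbc hbc' h
  · exact (key hn hm hc' hc hb' hb hbc' hbc h).symm

/-- Rotate both words by their common beginning. The rotated words end alike, so by
`Essential.two_eq` they begin alike, and the process can be repeated. The pieces moved make up `w`,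
a common beginning of the infinite powers of both words. -/
theorem Essential.exists_common_word (j : ℕ) {m n : ℕ} (hm : 2 ≤ m) (hn : 2 ≤ n)
    {c c' d : List α} (hc : W.Essential m c) (hc' : W.Essential n c') (hd : d ∈ W.words 2)
    (hdc : d <+: c) (hdc' : d <+: c') :
    ∃ w, j ≤ w.length ∧ (∃ x, c ++ w = w ++ x) ∧ ∃ x, c' ++ w = w ++ x := by
  induction j generalizing c c' d with
  | zero => exact ⟨[], by simp⟩
  | succ j ih =>
    obtain ⟨e, he, hce⟩ := hc.rotate hm hd hdc
    obtain ⟨e', he', hce'⟩ := hc'.rotate hn hd hdc'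
    obtain ⟨b, hb, hbe⟩ := W.truncation (by norm_num) hm he.mem
    obtain ⟨b', hb', hbe'⟩ := W.truncation (by norm_num) hn he'.mem
    obtain rfl : b = b' := he.two_eq hm hn he' hd ⟨c, d, hce.symm⟩ ⟨c', d, hce'.symm⟩ hb hb' hbe hbe'
    obtain ⟨w, hw, ⟨x, hx⟩, x', hx'⟩ := ih he he' hb hbe hbe'
    refine ⟨d ++ w, ?_, ⟨x, ?_⟩, x', ?_⟩
    · have := List.length_pos_iff.2 (W.ne_nil (by norm_num) hd)
      rw [List.length_append]
      omega
    · rw [← List.append_assoc, hce, List.append_assoc, hx, List.append_assoc]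
    · rw [← List.append_assoc, hce', List.append_assoc, hx', List.append_assoc]

theorem Essential.append_self {m : ℕ} (hm : 1 ≤ m) {c : List α} (h : W.Essential m c) :
    W.Essential (m + m) (c ++ c) := by
  obtain ⟨z, hz, hcz⟩ := h.2
  refine ⟨?_, z * z, hz.mul hz, ?_⟩
  · rw [← W.basis_mul hm hm h.mem h.mem, ← pow_two]
    rintro ⟨k, hk⟩
    exact h.1 ⟨2 * k, by rw [pow_mul, hk]⟩
  · rw [coord_mul hm hm hz.1 hz.1 h.mem h.mem (h.append_self_mem hm)]
    exact mul_ne_zero hcz hcz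

/-- Essential words with the same beginning have a common power. -/
theorem Essential.rep_eq {m n : ℕ} (hm : 1 ≤ m) (hn : 1 ≤ n) {c c' d : List α}
    (hc : W.Essential m c) (hc' : W.Essential n c') (hd : d ∈ W.words 2)
    (hdc : d <+: c ++ c) (hdc' : d <+: c' ++ c') : rep c n = rep c' m := by
  -- Squaring raises the degree to at least two even if `m` or `n` is 1; the length of `w` is chosen
  -- so that it covers the powers to be compared.
  obtain ⟨w, hw, ⟨x, hx⟩, x', hx'⟩ := Essential.exists_common_word
    ((rep c (n + n)).length + (rep c' (m + m)).length) (by omega) (by omega)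
    (hc.append_self hm) (hc'.append_self hn) hd hdc hdc'
  have h1 := rep_append_eq hx n
  have h2 := rep_append_eq hx' m
  rw [rep_append_self] at h1 h2
  have h3 : rep c (n + n) <+: w := List.prefix_of_prefix_length_le
    (List.prefix_append _ w) (h1 ▸ List.prefix_append _ _) (by omega)
  have h4 : rep c' (m + m) <+: w := List.prefix_of_prefix_length_le
    (List.prefix_append _ w) (h2 ▸ List.prefix_append _ _) (by omega)
  refine W.prefix_free (n := n * m) (Nat.mul_pos hn hm) (rep_mem hm hc.1 hn) ?_
    ((rep_prefix c (by omega)).trans h3) ((rep_prefix c' (by omega)).trans h4)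
  rw [mul_comm]
  exact rep_mem hn hc'.1 hm

end WordGrading

/-! ### Leading coefficients and the map to a product of polynomial rings. -/

namespace WordGrading

variable {K : Type*} [Field K] {R : Type*} [Ring R] [Algebra K R] {V : Type*} {α : Type*}
  [DecidableEq α] {W : WordGrading K R V α}

variable (W) in
/-- The essential words of degree `n` whose powers begin with `d`. -/
def Leads (d : List α) (n : ℕ) (c : List α) : Prop := W.Essential n c ∧ d <+: c ++ c

/-- Both words are prefixes, in the same degree, of a common power. -/
theorem Leads.eq {n : ℕ} (hn : 1 ≤ n) {c c' d : List α} (hd : d ∈ W.words 2)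
    (hc : W.Leads d n c) (hc' : W.Leads d n c') : c = c' := by
  have h := hc.1.rep_eq hn hn hc'.1 hd hc.2 hc'.2
  refine W.prefix_free hn hc.1.mem hc'.1.mem (w := rep c n) ?_ ?_
  · conv_lhs => rw [← rep_one c]
    exact rep_prefix c hn
  · rw [h]
    conv_lhs => rw [← rep_one c']
    exact rep_prefix c' hn

/-- A power of `c` equals a power of `c'`, so the product divides a power of `c`, which is not
nilpotent. -/
theorem Leads.mul_pow_ne_zero {m n : ℕ} (hm : 1 ≤ m) (hn : 1 ≤ n) {c c' d : List α}
    (hd : d ∈ W.words 2) (hc : W.Leads d m c) (hc' : W.Leads d n c') (k : ℕ) :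
    W.basis m c ^ k * W.basis n c' ^ k ≠ 0 := by
  intro h0
  have h1 : W.basis m c ^ n = W.basis n c' ^ m := by
    rw [basis_pow_eq hm hc.1.1 hn, basis_pow_eq hn hc'.1.1 hm,
      hc.1.rep_eq hm hn hc'.1 hd hc.2 hc'.2, mul_comm]
  have h2 : W.basis m c ^ (n * k + n * k) = 0 := by
    obtain ⟨i, rfl⟩ := Nat.exists_eq_add_of_le' hn
    obtain ⟨j, rfl⟩ := Nat.exists_eq_add_of_le' hm
    have h3 : W.basis (j + 1) c ^ ((i + 1) * k) = W.basis (i + 1) c' ^ ((j + 1) * k) := by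
      rw [pow_mul, h1, ← pow_mul]
    rw [pow_add]
    conv_lhs => rw (occs := .pos [2]) [h3]
    rw [add_mul, one_mul, pow_add, add_mul, one_mul, add_comm (j * k),
      pow_add, mul_assoc, ← mul_assoc (_ ^ k) (_ ^ k), h0, zero_mul, mul_zero]
  exact pow_ne_zero_of_not_isNilpotent hc.1.1 _ h2

theorem basis_commute {m n : ℕ} (hm : 1 ≤ m) (hn : 1 ≤ n) {c c' : List α}
    (hc : c ∈ W.words m) (hc' : c' ∈ W.words n) (h : c ++ c' = c' ++ c) :
    Commute (W.basis m c) (W.basis n c') := by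
  rw [Commute, SemiconjBy, W.basis_mul hm hn hc hc', W.basis_mul hn hm hc' hc, h, add_comm]

/-- Words of central elements commute when their product is nonzero, so the powers of the product
are the products of powers that `Leads.mul_pow_ne_zero` shows to be nonzero. -/
theorem Leads.append {m n : ℕ} (hm : 1 ≤ m) (hn : 1 ≤ n) {c c' d : List α}
    (hd : d ∈ W.words 2) (hc : W.Leads d m c) (hc' : W.Leads d n c') :
    W.Leads d (m + n) (c ++ c') := by
  have hmul := W.basis_mul hm hn hc.1.mem hc'.1.mem
  have hmem : c ++ c' ∈ W.words (m + n) := by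
    rw [← basis_ne_zero_iff, ← hmul]
    simpa using hc.mul_pow_ne_zero hm hn hd hc' 1
  obtain ⟨x, hx, hcx⟩ := hc.1.2
  obtain ⟨y, hy, hcy⟩ := hc'.1.2
  have hcomm := hx.append_comm hm hn hy hc.1.mem hc'.1.mem hcx hcy hmem
  refine ⟨⟨?_, x * y, hx.mul hy, ?_⟩, ?_⟩
  · rintro ⟨k, hk⟩
    rw [← hmul, (basis_commute hm hn hc.1.mem hc'.1.mem hcomm).mul_pow] at hk
    exact hc.mul_pow_ne_zero hm hn hd hc' k hk
  · rw [coord_mul hm hn hx.1 hy.1 hc.1.mem hc'.1.mem hmem]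
    exact mul_ne_zero hcx hcy
  · have : c ++ c' ++ (c ++ c') = c ++ c ++ (c' ++ c') := by
      rw [List.append_assoc, ← List.append_assoc c', ← hcomm]
      simp only [List.append_assoc]
    rw [this]
    exact hc.2.trans (List.prefix_append _ _)

theorem Leads.of_prefix {m n : ℕ} (hm : 1 ≤ m) {u b d : List α} (hd : d ∈ W.words 2)
    (hb : W.Leads d n b) (hu : W.Essential m u) (h : u ++ u <+: b ++ b) : W.Leads d m u := by
  obtain ⟨d', hd', hp⟩ := W.truncation (m := 2) (by norm_num) (by omega) (hu.append_self_mem hm)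
  obtain rfl := W.prefix_free (by norm_num) hd hd' hb.2 (hp.trans h)
  exact ⟨hu, hp⟩

/-- Converse to `Leads.append`: the word `b` splits into two commuting words from the factors.
Neither is nilpotent, and the square of each is a prefix of the square of `b`. -/
theorem Leads.exists_of_coord_mul_ne_zero {m n : ℕ} (hm : 1 ≤ m) (hn : 1 ≤ n) {b d : List α}
    (hd : d ∈ W.words 2) (hb : W.Leads d (m + n) b) {x y : R} (hx : W.Central m x)
    (hy : W.Central n y) (h : W.coord (m + n) b (x * y) ≠ 0) :
    (∃ u, W.Leads d m u) ∧ ∃ v, W.Leads d n v := by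
  obtain ⟨u, hu, v, hv, rfl, hux, hvy⟩ :=
    WordGrading.exists_of_coord_mul_ne_zero hm hn hx.1 hy.1 h
  have hcomm := hx.append_comm hm hn hy hu hv hux hvy hb.1.mem
  have hC := basis_commute hm hn hu hv hcomm
  have hnil := hb.1.1
  rw [← W.basis_mul hm hn hu hv] at hnil
  refine ⟨⟨u, hb.of_prefix hm hd ⟨fun h0 => hnil (hC.isNilpotent_mul_right h0), x, hx, hux⟩ ?_⟩,
    ⟨v, hb.of_prefix hn hd ⟨fun h0 => hnil (hC.isNilpotent_mul_left h0), y, hy, hvy⟩ ?_⟩⟩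
  · refine ⟨v ++ v, ?_⟩
    rw [List.append_assoc u v, ← List.append_assoc v, ← hcomm]
    simp only [List.append_assoc]
  · refine ⟨u ++ u, ?_⟩
    conv_rhs => rw [hcomm]
    rw [List.append_assoc v u, ← List.append_assoc u, hcomm]
    simp only [List.append_assoc]

open Classical in
variable (W) in
/-- The coefficient at the power with the given beginning. -/
def leadCoeff (d : List α) (n : ℕ) : R →ₗ[K] K :=
  if n = 0 then W.vertexCoord (W.start d)
  else if h : ∃ c, W.Leads d n c then W.coord n h.choose else 0

theorem leadCoeff_zero (d : List α) : W.leadCoeff d 0 = W.vertexCoord (W.start d) := if_pos rfl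

theorem Leads.leadCoeff_eq {n : ℕ} (hn : 1 ≤ n) {c d : List α} (hd : d ∈ W.words 2)
    (hc : W.Leads d n c) : W.leadCoeff d n = W.coord n c := by
  have h : ∃ c, W.Leads d n c := ⟨c, hc⟩
  rw [leadCoeff, if_neg (by omega), dif_pos h, h.choose_spec.eq hn hd hc]

theorem leadCoeff_eq_zero {n : ℕ} (hn : 1 ≤ n) {d : List α} (h : ¬∃ c, W.Leads d n c) :
    W.leadCoeff d n = 0 := by
  rw [leadCoeff, if_neg (by omega), dif_neg h]

/-- An element of degree zero acts on a word by its value at the starting vertex, which for the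
leading word is that of `d`. -/
theorem leadCoeff_zero_mul {n : ℕ} (hn : 1 ≤ n) {d : List α} (hd : d ∈ W.words 2) {x y : R}
    (hx : x ∈ W.homogeneous 0) (hy : y ∈ W.homogeneous n) :
    W.leadCoeff d n (x * y) = W.leadCoeff d 0 x * W.leadCoeff d n y := by
  by_cases h : ∃ c, W.Leads d n c
  · obtain ⟨c, hc⟩ := h
    have hs : W.start d = W.start c :=
      (W.start_prefix (W.ne_nil (by norm_num) hd) hc.2).trans
        (W.start_prefix (W.ne_nil hn hc.1.mem) (List.prefix_append _ _)).symm
    rw [hc.leadCoeff_eq hn hd, leadCoeff_zero, hs]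
    conv_lhs => rw [← W.sum_coord hn hy]
    rw [Finset.mul_sum, map_sum, Finset.sum_eq_single c]
    · rw [mul_smul_comm, W.mul_basis hx hn hc.1.mem, map_smul, map_smul,
        coord_basis_self hc.1.mem, smul_eq_mul, smul_eq_mul, mul_one, mul_comm]
    · intro w hw hne
      rw [mul_smul_comm, W.mul_basis hx hn hw, map_smul, map_smul, coord_basis_of_ne hne.symm,
        smul_zero, smul_zero]
    · exact fun h => absurd hc.1.mem h
  · rw [leadCoeff_eq_zero hn h, LinearMap.zero_apply, LinearMap.zero_apply, mul_zero]

/-- The leading coefficients are multiplicative on central elements. -/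
theorem leadCoeff_mul {m n : ℕ} {d : List α} (hd : d ∈ W.words 2) {x y : R}
    (hx : W.Central m x) (hy : W.Central n y) :
    W.leadCoeff d (m + n) (x * y) = W.leadCoeff d m x * W.leadCoeff d n y := by
  rcases Nat.eq_zero_or_pos m with rfl | hm
  · rcases Nat.eq_zero_or_pos n with rfl | hn
    · rw [add_zero, leadCoeff_zero, W.vertexCoord_mul hx.1 hy.1]
    · rw [zero_add, leadCoeff_zero_mul hn hd hx.1 hy.1]
  · rcases Nat.eq_zero_or_pos n with rfl | hn
    · rw [add_zero, hx.2 0 y hy.1, mul_zero, pow_zero, one_mul,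
        leadCoeff_zero_mul hm hd hy.1 hx.1, mul_comm]
    · by_cases h : (∃ u, W.Leads d m u) ∧ ∃ v, W.Leads d n v
      · obtain ⟨⟨u, hu⟩, v, hv⟩ := h
        have huv := hu.append hm hn hd hv
        rw [hu.leadCoeff_eq hm hd, hv.leadCoeff_eq hn hd, huv.leadCoeff_eq (by omega) hd,
          coord_mul hm hn hx.1 hy.1 hu.1.mem hv.1.mem huv.1.mem]
      · have h1 : W.leadCoeff d m x * W.leadCoeff d n y = 0 := by
          rcases not_and_or.1 h with h | h
          · rw [leadCoeff_eq_zero hm h, LinearMap.zero_apply, zero_mul]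
          · rw [leadCoeff_eq_zero hn h, LinearMap.zero_apply, mul_zero]
        rw [h1]
        by_cases hb : ∃ b, W.Leads d (m + n) b
        · obtain ⟨b, hb⟩ := hb
          rw [hb.leadCoeff_eq (by omega) hd]
          by_contra h0
          exact h (hb.exists_of_coord_mul_ne_zero hm hn hd hx hy h0)
        · rw [leadCoeff_eq_zero (by omega) hb, LinearMap.zero_apply]

theorem leadCoeff_one (d : List α) : W.leadCoeff d 0 1 = 1 := by
  rw [leadCoeff_zero, W.vertexCoord_one]

variable (W) in
/-- The degree zero part of the coordinate at a vertex. -/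
def vertexCoeff (v : V) (n : ℕ) : R →ₗ[K] K := if n = 0 then W.vertexCoord v else 0

theorem vertexCoeff_mul {m n : ℕ} (v : V) {x y : R} (hx : W.Central m x) (hy : W.Central n y) :
    W.vertexCoeff v (m + n) (x * y) = W.vertexCoeff v m x * W.vertexCoeff v n y := by
  by_cases hm : m = 0
  · by_cases hn : n = 0
    · subst hm hn
      simp only [vertexCoeff, add_zero, if_true]
      exact W.vertexCoord_mul hx.1 hy.1
    · simp [vertexCoeff, hn]
  · simp [vertexCoeff, hm]

variable (W) in
/-- The functions on the homogeneous elements that give the map to a product of polynomial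
rings. -/
def coeffAt (i : W.words 2 ⊕ V) : ℕ → R →ₗ[K] K :=
  i.elim (fun d => W.leadCoeff d.1) W.vertexCoeff

theorem coeffAt_mul {m n : ℕ} (i : W.words 2 ⊕ V) {x y : R} (hx : W.Central m x)
    (hy : W.Central n y) :
    W.coeffAt i (m + n) (x * y) = W.coeffAt i m x * W.coeffAt i n y := by
  rcases i with d | v
  · exact leadCoeff_mul d.2 hx hy
  · exact vertexCoeff_mul v hx hy

theorem coeffAt_one (i : W.words 2 ⊕ V) : W.coeffAt i 0 1 = 1 := by
  rcases i with d | v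
  · exact leadCoeff_one _
  · exact W.vertexCoord_one v

/-- In positive degree, a non-nilpotent word of `x` is essential and its square begins with some `d`
of degree two, so its coefficient is the leading coefficient at `d`. In degree zero the vertices
detect everything. -/
theorem Central.isNilpotent_of_coeffAt {m : ℕ} {x : R} (hx : W.Central m x)
    (h : ∀ i, W.coeffAt i m x = 0) : IsNilpotent x := by
  rcases Nat.eq_zero_or_pos m with rfl | hm
  · have : x = 0 := W.eq_zero_of_vertexCoord hx.1 fun v => h (Sum.inr v)
    rw [this]
    exact IsNilpotent.zero
  · refine hx.isNilpotent hm fun c hc hcx => by_contra fun hn => ?_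
    have hE : W.Essential m c := ⟨hn, x, hx, hcx⟩
    obtain ⟨d, hd, hp⟩ := W.truncation (m := 2) (by norm_num) (by omega) (hE.append_self_mem hm)
    have := h (Sum.inl ⟨d, hd⟩)
    change W.leadCoeff d m x = 0 at this
    rw [Leads.leadCoeff_eq hm hd ⟨hE, hp⟩] at this
    exact hcx this

variable (W) in
/-- The map to a product of polynomial rings, which is multiplicative on the graded centre. -/
def toPoly : R →ₗ[K] (W.words 2 ⊕ V → Polynomial K) :=
  LinearMap.pi fun i => (W.exists_lift (W.coeffAt i)).choose

theorem toPoly_apply {n : ℕ} {x : R} (hx : x ∈ W.homogeneous n) (i : W.words 2 ⊕ V) :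
    W.toPoly x i = Polynomial.monomial n (W.coeffAt i n x) :=
  (W.exists_lift (W.coeffAt i)).choose_spec n x hx

theorem toPoly_one : W.toPoly 1 = 1 := by
  ext1 i
  rw [toPoly_apply W.one_mem, coeffAt_one, Pi.one_apply, Polynomial.monomial_zero_one]

variable (W) in
/-- The finite sums of homogeneous central elements. -/
def centre : AddSubgroup R := AddSubgroup.closure {z | ∃ m, W.Central m z}

theorem toPoly_mul {x y : R} (hx : x ∈ W.centre) (hy : y ∈ W.centre) :
    W.toPoly (x * y) = W.toPoly x * W.toPoly y := by
  induction hx using AddSubgroup.closure_induction with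
  | mem x hx =>
    obtain ⟨m, hx⟩ := hx
    induction hy using AddSubgroup.closure_induction with
    | mem y hy =>
      obtain ⟨n, hy⟩ := hy
      ext1 i
      rw [Pi.mul_apply, toPoly_apply (hx.mul hy).1, toPoly_apply hx.1, toPoly_apply hy.1,
        coeffAt_mul i hx hy, Polynomial.monomial_mul_monomial]
    | zero => rw [mul_zero, map_zero, mul_zero]
    | add y z _ _ h1 h2 => rw [mul_add, map_add, map_add, h1, h2, mul_add]
    | neg y _ h => rw [mul_neg, map_neg, map_neg, h, mul_neg]
  | zero => rw [zero_mul, map_zero, zero_mul]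
  | add x z _ _ h1 h2 => rw [add_mul, map_add, map_add, h1, h2, add_mul]
  | neg x _ h => rw [neg_mul, map_neg, map_neg, h, neg_mul]

/-- Elements of the centre have central homogeneous components, so the kernel of `toPoly` on the
centre can be studied degree by degree. -/
theorem mem_centre_iff {x : R} : x ∈ W.centre ↔
    ∃ f : ℕ →₀ R, (∀ n, W.Central n (f n)) ∧ (f.sum fun _ r => r) = x := by
  constructor
  · intro hx
    induction hx using AddSubgroup.closure_induction with
    | mem x hx =>
      obtain ⟨m, hx⟩ := hx
      refine ⟨Finsupp.single m x, fun n => ?_, by simp⟩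
      rw [Finsupp.single_apply]
      split_ifs with h
      · exact h ▸ hx
      · exact W.central_zero n
    | zero => exact ⟨0, fun n => W.central_zero n, by simp⟩
    | add x z _ _ h1 h2 =>
      obtain ⟨f, hf, rfl⟩ := h1
      obtain ⟨g, hg, rfl⟩ := h2
      exact ⟨f + g, fun n => (hf n).add (hg n),
        Finsupp.sum_add_index' (fun _ => rfl) fun _ _ _ => rfl⟩
    | neg x _ h =>
      obtain ⟨f, hf, rfl⟩ := h
      exact ⟨-f, fun n => (hf n).neg, by
        rw [Finsupp.sum_neg_index fun _ => rfl, Finsupp.sum, Finsupp.sum,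
          Finset.sum_neg_distrib]⟩
  · rintro ⟨f, hf, rfl⟩
    exact AddSubgroup.sum_mem _ fun n _ => AddSubgroup.subset_closure ⟨n, hf n⟩

theorem coeff_toPoly_sum {f : ℕ →₀ R} (hf : ∀ n, W.Central n (f n)) (i : W.words 2 ⊕ V) (n : ℕ) :
    (W.toPoly (f.sum fun _ r => r) i).coeff n = W.coeffAt i n (f n) := by
  rw [Finsupp.sum, map_sum, Finset.sum_apply, Polynomial.finsetSum_coeff]
  simp only [toPoly_apply (hf _).1, Polynomial.coeff_monomial]
  rw [Finset.sum_ite_eq' f.support n]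
  split_ifs with h
  · rfl
  · rw [Finsupp.notMem_support_iff.1 h, map_zero]

theorem mul_mem_centre {x y : R} (hx : x ∈ W.centre) (hy : y ∈ W.centre) : x * y ∈ W.centre := by
  induction hx using AddSubgroup.closure_induction with
  | mem x hx =>
    obtain ⟨m, hx⟩ := hx
    induction hy using AddSubgroup.closure_induction with
    | mem y hy =>
      obtain ⟨n, hy⟩ := hy
      exact AddSubgroup.subset_closure ⟨_, hx.mul hy⟩
    | zero => rw [mul_zero]; exact W.centre.zero_mem
    | add y z _ _ h1 h2 => rw [mul_add]; exact W.centre.add_mem h1 h2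
    | neg y _ h => rw [mul_neg]; exact W.centre.neg_mem h
  | zero => rw [zero_mul]; exact W.centre.zero_mem
  | add x z _ _ h1 h2 => rw [add_mul]; exact W.centre.add_mem h1 h2
  | neg x _ h => rw [neg_mul]; exact W.centre.neg_mem h

theorem central_one : W.Central 0 1 :=
  ⟨W.one_mem, fun n y _ => by rw [zero_mul, pow_zero, one_mul, one_mul, mul_one]⟩

theorem mem_closure_iff {x : R} :
    x ∈ Subring.closure {z | ∃ m, W.Central m z} ↔ x ∈ W.centre := by
  constructor
  · intro h
    induction h using Subring.closure_induction with
    | mem x hx => exact AddSubgroup.subset_closure hx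
    | zero => exact W.centre.zero_mem
    | one => exact AddSubgroup.subset_closure ⟨0, central_one⟩
    | add x y _ _ h1 h2 => exact W.centre.add_mem h1 h2
    | neg x _ h => exact W.centre.neg_mem h
    | mul x y _ _ h1 h2 => exact mul_mem_centre h1 h2
  · intro h
    exact (AddSubgroup.closure_le (Subring.closure _).toAddSubgroup).2 Subring.subset_closure h

/-- A graded centre maps to a product of polynomial rings, and the kernel is generated by the
homogeneous nilpotent elements. -/
theorem exists_algHom (Z : Subalgebra K R)
    (hZ : ∀ x, x ∈ Z ↔ x ∈ Subring.closure {z | ∃ m, W.Central m z}) :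
    ∃ φ : Z →ₐ[K] (W.words 2 ⊕ V → Polynomial K),
      (∀ x, φ x = 0 ↔ x ∈ TwoSidedIdeal.span {z : Z | IsNilpotent z ∧
        ∃ m, (z : R) ∈ W.homogeneous m}) ∧
      ∀ h ∈ φ.range, ∀ n, (fun i => Polynomial.monomial n ((h i).coeff n)) ∈ φ.range := by
  have hZ' : ∀ x, x ∈ Z ↔ x ∈ W.centre := fun x => (hZ x).trans mem_closure_iff
  let φ : Z →ₐ[K] (W.words 2 ⊕ V → Polynomial K) :=
    AlgHom.ofLinearMap (W.toPoly.comp Z.val.toLinearMap) toPoly_one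
      fun x y => toPoly_mul ((hZ' _).1 x.2) ((hZ' _).1 y.2)
  have hφ : ∀ x : Z, φ x = W.toPoly x := fun _ => rfl
  have hmem : ∀ {n x}, W.Central n x → x ∈ Z := fun hx =>
    (hZ' _).2 (AddSubgroup.subset_closure ⟨_, hx⟩)
  refine ⟨φ, fun x => ⟨fun h => ?_, fun h => ?_⟩, ?_⟩
  · obtain ⟨f, hf, hfx⟩ := mem_centre_iff.1 ((hZ' _).1 x.2)
    have h0 : ∀ n i, W.coeffAt i n (f n) = 0 := by
      intro n i
      rw [← coeff_toPoly_sum hf, hfx, ← hφ, h, Pi.zero_apply, Polynomial.coeff_zero]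
    have hx : x = ∑ n ∈ f.support, (⟨f n, hmem (hf n)⟩ : Z) := by
      refine Subtype.ext ?_
      rw [← hfx, Finsupp.sum, AddSubmonoidClass.coe_finsetSum]
    rw [hx]
    refine TwoSidedIdeal.finsetSum_mem _ _ _ fun n _ => TwoSidedIdeal.subset_span ⟨?_, n, (hf n).1⟩
    obtain ⟨k, hk⟩ := (hf n).isNilpotent_of_coeffAt (h0 n)
    exact ⟨k, Subtype.ext hk⟩
  · rw [← TwoSidedIdeal.mem_ker φ]
    refine TwoSidedIdeal.span_le.2 ?_ h
    rintro z ⟨hz, -⟩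
    -- A product of polynomial rings over a field is reduced.
    exact (TwoSidedIdeal.mem_ker φ).2 (hz.map φ).eq_zero
  · rintro _ ⟨x, rfl⟩ n
    obtain ⟨f, hf, hfx⟩ := mem_centre_iff.1 ((hZ' _).1 x.2)
    refine ⟨⟨f n, hmem (hf n)⟩, ?_⟩
    funext i
    change W.toPoly (f n) i = Polynomial.monomial n ((W.toPoly x i).coeff n)
    rw [toPoly_apply (hf n).1, ← hfx, coeff_toPoly_sum hf]

end WordGrading

/-! ### Chains of positive degree as words. -/

namespace MonomialPresentation

section Words

variable {K : Type*} [Field K] {A : Type*} [Ring A] [Algebra K A]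
  {V : Type u} [Fintype V] {α : Type v} {M : MonomialPresentation K A V α}

theorem src_eq_of_path_ne_zero {x : V} {a : α} {l : List α} (h : M.path x (a :: l) ≠ 0) :
    M.src a = x := by
  by_contra hne
  exact h (M.path_cons_of_ne (Ne.symm hne) l)

theorem src_eq_endpoint {x : V} {l r : List α} {a : α} (h : M.path x (l ++ a :: r) ≠ 0) :
    M.src a = M.endpoint x l :=
  src_eq_of_path_ne_zero (path_append_ne_zero_right h)

/-- The letters of a chain are composable. -/
theorem Chain.src_eq : ∀ {n : ℕ} (γ : M.Chain n) {l r : List α} {a : α},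
    γ.word = l ++ a :: r → M.src a = M.endpoint γ.source l
  | 0, γ, l, r, a, h => by
    have h0 : γ.word = [] := rfl
    rw [h0] at h
    simp at h
  | n + 1, γ, l, r, a, h => by
    obtain ⟨γ, s, rfl⟩ := γ.cases_succ
    rw [Chain.word_cons, List.append_eq_append_iff] at h
    rw [Chain.source_cons]
    have hs : M.path γ.target s.1 ≠ 0 := s.2.1
    rcases h with ⟨l', rfl, h⟩ | ⟨x, h, h'⟩
    · rw [endpoint_append, ← γ.target_eq]
      exact src_eq_endpoint (h ▸ hs)
    · rcases x with - | ⟨b, x⟩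
      · rw [List.append_nil] at h
        rw [← h, ← γ.target_eq]
        exact src_eq_of_path_ne_zero (by rwa [← List.nil_append s.1, ← h'] at hs)
      · obtain ⟨rfl, -⟩ := List.cons_eq_cons.1 h'
        exact γ.src_eq h

theorem Chain.word_ne_nil {n : ℕ} (hn : 1 ≤ n) (γ : M.Chain n) : γ.word ≠ [] := by
  have := γ.length_word_ge
  rw [← List.length_pos_iff]
  omega

theorem Chain.exists_word_eq_cons {n : ℕ} (hn : 1 ≤ n) (γ : M.Chain n) :
    ∃ a l, γ.word = a :: l ∧ M.src a = γ.source := by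
  obtain ⟨a, l, h⟩ := List.exists_cons_of_ne_nil (γ.word_ne_nil hn)
  exact ⟨a, l, h, γ.src_eq (l := []) h⟩

/-- The first letter determines the starting vertex, so chains of positive degree can be treated as
bare words. -/
theorem Chain.source_eq_of_prefix {m n : ℕ} (hm : 1 ≤ m) {γ : M.Chain m} {δ : M.Chain n}
    (h : γ.word <+: δ.word) : δ.source = γ.source := by
  obtain ⟨a, l, ha, hs⟩ := γ.exists_word_eq_cons hm
  obtain ⟨r, hr⟩ := h
  rw [ha, List.cons_append] at hr
  rw [← hs]
  exact (δ.src_eq (l := []) hr.symm).symm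

theorem Chain.target_eq_of_word {m n k : ℕ} (hm : 1 ≤ m) (hn : 1 ≤ n) {γ : M.Chain m}
    {η : M.Chain n} {δ : M.Chain k} {l : List α} (hl : η.word <+: l)
    (h : δ.word = γ.word ++ l) : γ.target = η.source := by
  obtain ⟨a, l', ha, hs⟩ := η.exists_word_eq_cons hn
  obtain ⟨r, rfl⟩ := hl
  rw [ha, List.cons_append] at h
  rw [← hs, δ.src_eq h, γ.target_eq,
    Chain.source_eq_of_prefix hm (γ := γ) (δ := δ) (h ▸ List.prefix_append _ _)]

theorem Chain.eq_of_word_prefix {n : ℕ} (hn : 1 ≤ n) {γ δ : M.Chain n} {l : List α}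
    (hγ : γ.word <+: l) (hδ : δ.word <+: l) : γ = δ := by
  refine Chain.eq_of_prefix ?_ hγ hδ
  obtain ⟨a, r, ha, hs⟩ := γ.exists_word_eq_cons hn
  obtain ⟨b, t, hb, ht⟩ := δ.exists_word_eq_cons hn
  obtain ⟨r', rfl⟩ := hγ
  obtain ⟨t', ht'⟩ := hδ
  rw [ha, hb, List.cons_append, List.cons_append, List.cons_eq_cons] at ht'
  rw [← hs, ← ht, ht'.1]

theorem Chain.word_injective {n : ℕ} (hn : 1 ≤ n) {γ δ : M.Chain n} (h : γ.word = δ.word) :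
    γ = δ := Chain.eq_of_word_prefix hn (List.prefix_refl _) (h ▸ List.prefix_refl _)

/-- A chain whose square is a chain can be continued by its beginning of degree two. -/
theorem Chain.exists_append_two {m k : ℕ} (hm : 1 ≤ m) (γ : M.Chain m) {δ : M.Chain k}
    (hk : m + 1 ≤ k) {l : List α} (hδ : δ.word = γ.word ++ l) {d : M.Chain 2}
    (hd : d.word <+: l) : ∃ τ : M.Chain (m + 2), τ.word = γ.word ++ d.word := by
  obtain ⟨n, rfl⟩ := Nat.exists_eq_add_of_le' hm
  have ht : γ.target = d.source := Chain.target_eq_of_word hm (by norm_num) hd hδ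
  have hs : δ.source = γ.source := Chain.source_eq_of_prefix hm (hδ ▸ List.prefix_append _ _)
  obtain ⟨τ, -, hτ⟩ := γ.exists_concat_two d ht
    (γ.path_eq_zero_of_concat δ (by omega) hs hδ d ht hd)
  exact ⟨τ, hτ⟩

/-- If the last word of a chain is a suffix of the last word of another one, then the latter has
more continuations. -/
theorem Chain.exists_append_two_of_suffix {m n : ℕ} {γ : M.Chain (m + 1)} {γ' : M.Chain (n + 1)}
    (h : γ.state.2 <:+ γ'.state.2) {δ : M.Chain (m + 1 + 2)} {d : M.Chain 2}
    (hδ : δ.word = γ.word ++ d.word) : ∃ τ : M.Chain (n + 1 + 2), τ.word = γ'.word ++ d.word := by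
  have ht : γ.target = d.source :=
    Chain.target_eq_of_word (by omega) (by norm_num) (List.prefix_refl _) hδ
  have hs : δ.source = γ.source :=
    Chain.source_eq_of_prefix (by omega) (hδ ▸ List.prefix_append _ _)
  have h0 := γ.path_eq_zero_of_concat δ (by omega) hs hδ d ht (List.prefix_refl _)
  obtain ⟨z, hz⟩ := h
  have hx : γ.state.1 = M.endpoint γ'.state.1 z := by
    obtain ⟨a, l, hal⟩ := List.exists_cons_of_ne_nil γ.state_ne_nil
    have h1 := γ.path_state_ne_zero
    have h2 := γ'.path_state_ne_zero
    rw [hal] at h1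
    rw [← hz, hal] at h2
    rw [← src_eq_of_path_ne_zero h1, src_eq_endpoint h2]
  have ht' : γ'.target = γ.target := by
    rw [γ'.target_eq_state, ← hz, endpoint_append, ← hx, ← γ.target_eq_state]
  obtain ⟨τ, -, hτ⟩ := γ'.exists_concat_two d (ht'.trans ht) (by
    rw [← hz, List.append_assoc]
    exact M.path_eq_zero_of_right (hx ▸ h0))
  exact ⟨τ, hτ⟩

/-- The last word of `γ` is a nonzero path, so it cannot contain the zero path `d`. -/
theorem Chain.state_suffix_two {n : ℕ} {γ : M.Chain (n + 1)} {d : M.Chain 2} {y : List α}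
    (h : γ.word <:+ y ++ d.word) : γ.state.2 <:+ d.word := by
  rcases List.suffix_or_suffix_of_suffix (γ.state_suffix.trans h) (List.suffix_append y d.word)
    with h | ⟨z, hz⟩
  · exact h
  · obtain ⟨a, s, hd, -, ha, -, h0, -⟩ := d.two_word
    refine absurd ?_ γ.path_state_ne_zero
    rw [← hz, hd]
    by_contra hne
    refine hne (M.path_eq_zero_of_right ?_)
    rw [← src_eq_endpoint hne, ha]
    exact h0

/-- Only the trivial chain at the source of `δ` can stand in front of `δ`. -/
theorem convolution_zero_left {n : ℕ} (f : M.Chain 0 → K) (g : M.Chain n → K) (δ : M.Chain n) :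
    convolution f g δ = f (Chain.nil M δ.source) * g δ := by
  rw [convolution, Finset.sum_eq_single (Chain.nil M δ.source), Finset.sum_eq_single δ, if_pos]
  · exact ⟨rfl, rfl, rfl⟩
  · intro η _ hne
    rw [if_neg]
    rintro ⟨-, h1, h2⟩
    exact hne (Chain.ext h1.symm h2.symm)
  · exact fun h => absurd (Finset.mem_univ _) h
  · intro γ _ hne
    refine Finset.sum_eq_zero fun η _ => if_neg ?_
    rintro ⟨h1, -, -⟩
    obtain ⟨x, rfl⟩ := γ.cases_zero
    exact hne (by rw [h1, Chain.source_nil])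
  · exact fun h => absurd (Finset.mem_univ _) h

variable [DecidableEq α]

variable (M) in
/-- The words of the chains of degree `n`, for positive `n`. -/
def chainWords (n : ℕ) : Finset (List α) :=
  -- In degree zero all chains have the empty word, so words would not tell the vertices apart.
  if 1 ≤ n then Finset.univ.image (Chain.word (M := M) (n := n)) else ∅

theorem mem_chainWords {n : ℕ} {w : List α} :
    w ∈ M.chainWords n ↔ 1 ≤ n ∧ ∃ γ : M.Chain n, γ.word = w := by
  rw [chainWords]
  split_ifs with h <;> simp [h]

variable (M) in
/-- The indicator function of a word. -/
def wordIndicator (n : ℕ) (w : List α) (γ : M.Chain n) : K := if 1 ≤ n ∧ γ.word = w then 1 else 0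

theorem wordIndicator_self {n : ℕ} (hn : 1 ≤ n) (γ : M.Chain n) :
    M.wordIndicator n γ.word γ = 1 := if_pos ⟨hn, rfl⟩

theorem wordIndicator_of_ne {n : ℕ} {w : List α} {γ : M.Chain n} (h : γ.word ≠ w) :
    M.wordIndicator n w γ = 0 := if_neg fun h' => h h'.2

/-- Each indicator picks out a single chain, and the conditions on sources and targets follow from
the letters; so only equality of words remains. -/
theorem convolution_wordIndicator {m n : ℕ} (hm : 1 ≤ m) (hn : 1 ≤ n) {c d : List α}
    (hc : c ∈ M.chainWords m) (hd : d ∈ M.chainWords n) :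
    convolution (M.wordIndicator m c) (M.wordIndicator n d) = M.wordIndicator (m + n) (c ++ d) := by
  obtain ⟨-, γ, rfl⟩ := mem_chainWords.1 hc
  obtain ⟨-, η, rfl⟩ := mem_chainWords.1 hd
  funext δ
  rw [convolution, Finset.sum_eq_single γ, Finset.sum_eq_single η, wordIndicator_self hm,
    wordIndicator_self hn, mul_one, wordIndicator]
  · by_cases h : δ.word = γ.word ++ η.word
    · rw [if_pos, if_pos ⟨by omega, h⟩]
      exact ⟨Chain.source_eq_of_prefix hm (h ▸ List.prefix_append _ _),
        Chain.target_eq_of_word hm hn (List.prefix_refl _) h, h⟩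
    · rw [if_neg fun h' => h h'.2.2, if_neg fun h' => h h'.2]
  · intro η' _ hne
    rw [wordIndicator_of_ne (γ := η') fun h => hne (Chain.word_injective hn h), mul_zero, ite_self]
  · exact fun h => absurd (Finset.mem_univ _) h
  · intro γ' _ hne
    refine Finset.sum_eq_zero fun η' _ => ?_
    rw [wordIndicator_of_ne (γ := γ') fun h => hne (Chain.word_injective hm h), zero_mul, ite_self]
  · exact fun h => absurd (Finset.mem_univ _) h

variable (M) in
/-- The coordinate of a family of scalars at a word. -/
def wordCoord (n : ℕ) (w : List α) : (M.Chain n → K) →ₗ[K] K :=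
  ∑ γ ∈ Finset.univ.filter fun γ : M.Chain n => γ.word = w, LinearMap.proj γ

theorem wordCoord_word {n : ℕ} (hn : 1 ≤ n) (γ : M.Chain n) (f : M.Chain n → K) :
    M.wordCoord n γ.word f = f γ := by
  have : (Finset.univ.filter fun δ : M.Chain n => δ.word = γ.word) = {γ} := by
    ext δ
    simp only [Finset.mem_filter, Finset.mem_univ, true_and, Finset.mem_singleton]
    exact ⟨Chain.word_injective hn, fun h => h ▸ rfl⟩
  rw [wordCoord, this, Finset.sum_singleton, LinearMap.proj_apply]

theorem wordCoord_wordIndicator {n : ℕ} {v w : List α} (hw : w ∈ M.chainWords n) :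
    M.wordCoord n v (M.wordIndicator n w) = if v = w then 1 else 0 := by
  obtain ⟨hn, γ, rfl⟩ := mem_chainWords.1 hw
  split_ifs with h
  · rw [h, wordCoord_word hn, wordIndicator_self hn]
  · rw [wordCoord, LinearMap.sum_apply]
    refine Finset.sum_eq_zero fun δ hδ => ?_
    rw [LinearMap.proj_apply, wordIndicator_of_ne]
    rw [(Finset.mem_filter.1 hδ).2]
    exact h

theorem sum_wordCoord {n : ℕ} (hn : 1 ≤ n) (f : M.Chain n → K) :
    ∑ w ∈ M.chainWords n, M.wordCoord n w f • M.wordIndicator n w = f := by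
  funext γ
  rw [Finset.sum_apply, Finset.sum_eq_single γ.word]
  · rw [Pi.smul_apply, wordCoord_word hn, wordIndicator_self hn, smul_eq_mul, mul_one]
  · intro w _ hne
    rw [Pi.smul_apply, wordIndicator_of_ne hne.symm, smul_zero]
  · exact fun h => absurd (mem_chainWords.2 ⟨hn, γ, rfl⟩) h

end Words

/-! ### The word grading of the Ext algebra and the embedding of the quotient. -/

section Grading

variable {K : Type*} [Field K] {A : Type u} [Ring A] [Algebra K A]
  {V α : Type u} [Fintype V] (M : MonomialPresentation K A V α)

/-- The homogeneous element of the Ext algebra that is given by a family of scalars. -/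
def toExtAlgebra (n : ℕ) : (M.Chain n → K) →ₗ[K] ExtAlgebra A :=
  (DirectSum.lof K ℕ (SelfExt (topModule A)) n).comp (M.toExt n)

theorem toExtAlgebra_apply (n : ℕ) (c : M.Chain n → K) :
    M.toExtAlgebra n c = ExtAlgebra.of A n (M.toExt n c) := rfl

theorem of_eq_toExtAlgebra (n : ℕ) (x : SelfExt (topModule A) n) :
    ExtAlgebra.of A n x = M.toExtAlgebra n ((M.extEquiv n).symm x) := by
  rw [toExtAlgebra_apply]
  congr 1
  exact ((M.extEquiv n).apply_symm_apply x).symm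

/-- The family of scalars that gives the component of degree `n`. -/
def extCoord (n : ℕ) : ExtAlgebra A →ₗ[K] (M.Chain n → K) :=
  (M.extEquiv n).symm.toLinearMap.comp (DirectSum.component K ℕ (SelfExt (topModule A)) n)

theorem extCoord_toExtAlgebra (n : ℕ) (c : M.Chain n → K) :
    M.extCoord n (M.toExtAlgebra n c) = c := by
  have : DirectSum.component K ℕ (SelfExt (topModule A)) n (M.toExtAlgebra n c) = M.toExt n c :=
    DirectSum.component.lof_self K _ _
  rw [extCoord, LinearMap.comp_apply, this]
  exact (M.extEquiv n).symm_apply_apply c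

theorem toExtAlgebra_one : M.toExtAlgebra 0 1 = 1 := by
  rw [toExtAlgebra_apply, toExt_one]
  rfl

theorem toExtAlgebra_mul {m n k : ℕ} (h : m + n = k) (c : M.Chain m → K) (c' : M.Chain n → K) :
    M.toExtAlgebra m c * M.toExtAlgebra n c' = M.toExtAlgebra k (convolution c c') := by
  subst h
  rw [toExtAlgebra_apply, toExtAlgebra_apply, toExtAlgebra_apply, ← toExt_comp_toExt]
  exact DirectSum.of_mul_of _ _

/-- The word grading of the Ext algebra of a monomial algebra. -/
def wordGrading [Nonempty V] [DecidableEq α] : WordGrading K (ExtAlgebra A) V α where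
  homogeneous n := LinearMap.range (M.toExtAlgebra n)
  one_mem := ⟨1, M.toExtAlgebra_one⟩
  mul_mem := by
    rintro m n _ _ ⟨c, rfl⟩ ⟨c', rfl⟩
    exact ⟨_, (M.toExtAlgebra_mul rfl c c').symm⟩
  words := M.chainWords
  basis n w := M.toExtAlgebra n (M.wordIndicator n w)
  coord n w := (M.wordCoord n w).comp (M.extCoord n)
  basis_mem n w := ⟨_, rfl⟩
  basis_eq_zero := by
    intro n w hw
    have : M.wordIndicator n w = 0 := by
      funext γ
      exact if_neg fun h => hw (mem_chainWords.2 ⟨h.1, γ, h.2⟩)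
    rw [this, map_zero]
  coord_basis := by
    intro n v w hw
    rw [LinearMap.comp_apply, extCoord_toExtAlgebra, wordCoord_wordIndicator hw]
  sum_coord := by
    rintro n _ hn ⟨f, rfl⟩
    conv_rhs => rw [← sum_wordCoord hn f]
    simp only [LinearMap.comp_apply, extCoord_toExtAlgebra, map_sum, map_smul]
  basis_mul := by
    intro m n c d hm hn hc hd
    rw [M.toExtAlgebra_mul rfl, convolution_wordIndicator hm hn hc hd]
  prefix_free := by
    intro n u v w hn hu hv huw hvw
    obtain ⟨-, γ, rfl⟩ := mem_chainWords.1 hu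
    obtain ⟨-, δ, rfl⟩ := mem_chainWords.1 hv
    rw [Chain.eq_of_word_prefix hn huw hvw]
  truncation := by
    intro m n w hm hmn hw
    obtain ⟨-, γ, rfl⟩ := mem_chainWords.1 hw
    obtain ⟨δ, -, hδ⟩ := Chain.exists_truncation hmn γ
    exact ⟨δ.word, mem_chainWords.2 ⟨hm, δ, rfl⟩, hδ⟩
  ne_nil := by
    intro n w hn hw
    obtain ⟨-, γ, rfl⟩ := mem_chainWords.1 hw
    exact γ.word_ne_nil hn
  append_two := by
    intro m c d hm hc hcc hd hdc
    obtain ⟨-, γ, rfl⟩ := mem_chainWords.1 hc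
    obtain ⟨-, δ, hδ⟩ := mem_chainWords.1 hcc
    obtain ⟨-, e, rfl⟩ := mem_chainWords.1 hd
    obtain ⟨τ, hτ⟩ := γ.exists_append_two (by omega) (by omega) hδ hdc
    exact mem_chainWords.2 ⟨by omega, τ, hτ⟩
  compare_two := by
    rintro m n c c' d hm hn hc hc' hd ⟨y, hy⟩ ⟨y', hy'⟩
    obtain ⟨m, rfl⟩ := Nat.exists_eq_add_of_le' (show 1 ≤ m by omega)
    obtain ⟨n, rfl⟩ := Nat.exists_eq_add_of_le' (show 1 ≤ n by omega)
    obtain ⟨-, γ, rfl⟩ := mem_chainWords.1 hc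
    obtain ⟨-, γ', rfl⟩ := mem_chainWords.1 hc'
    obtain ⟨-, e, rfl⟩ := mem_chainWords.1 hd
    -- Both last words are suffixes of the word of `e`, hence comparable, and the chain with the
    -- longer one has more continuations.
    refine (List.suffix_or_suffix_of_suffix (Chain.state_suffix_two hy)
      (Chain.state_suffix_two hy')).imp (fun h b hb hcb => ?_) fun h b hb hcb => ?_
    all_goals
      obtain ⟨-, b, rfl⟩ := mem_chainWords.1 hb
      obtain ⟨-, δ, hδ⟩ := mem_chainWords.1 hcb
      obtain ⟨τ, hτ⟩ := Chain.exists_append_two_of_suffix h hδ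
      exact mem_chainWords.2 ⟨by omega, τ, hτ⟩
  vertexCoord x := (LinearMap.proj (Chain.nil M x)).comp (M.extCoord 0)
  vertexCoord_one := by
    intro x
    rw [LinearMap.comp_apply, ← M.toExtAlgebra_one, extCoord_toExtAlgebra]
    rfl
  vertexCoord_mul := by
    rintro x _ _ ⟨f, rfl⟩ ⟨g, rfl⟩
    simp only [M.toExtAlgebra_mul (add_zero 0), LinearMap.comp_apply, extCoord_toExtAlgebra,
      LinearMap.proj_apply, convolution_zero_left, Chain.source_nil]
  eq_zero_of_vertexCoord := by
    rintro _ ⟨f, rfl⟩ h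
    have : f = 0 := by
      funext γ
      obtain ⟨x, rfl⟩ := γ.cases_zero
      have := h x
      rwa [LinearMap.comp_apply, extCoord_toExtAlgebra] at this
    rw [this, map_zero]
  -- The value at the empty word is immaterial, since words of positive degree are nonempty.
  start
    | [] => Classical.arbitrary V
    | a :: _ => M.src a
  start_prefix := by
    rintro u w hu ⟨r, rfl⟩
    obtain ⟨a, l, rfl⟩ := List.exists_cons_of_ne_nil hu
    rfl
  mul_basis := by
    rintro n _ w ⟨f, rfl⟩ hn hw
    obtain ⟨-, γ, rfl⟩ := mem_chainWords.1 hw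
    obtain ⟨a, l, hal, hs⟩ := γ.exists_word_eq_cons hn
    rw [LinearMap.comp_apply, extCoord_toExtAlgebra, M.toExtAlgebra_mul (zero_add n), hal,
      LinearMap.proj_apply, ← map_smul]
    congr 1
    funext δ
    rw [convolution_zero_left, Pi.smul_apply, smul_eq_mul]
    by_cases hδ : δ.word = a :: l
    · rw [show δ.source = M.src a from (δ.src_eq (l := []) hδ).symm]
    · rw [wordIndicator_of_ne hδ, mul_zero, mul_zero]
  exists_lift := by
    intro f
    refine ⟨DirectSum.toModule K ℕ (Polynomial K) fun n => (Polynomial.monomial n).comp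
      ((f n).comp (DirectSum.lof K ℕ (SelfExt (topModule A)) n)), ?_⟩
    rintro n _ ⟨c, rfl⟩
    exact DirectSum.toModule_lof K n _

theorem mem_gradedCentral_iff [Nonempty V] [DecidableEq α] {z : ExtAlgebra A} :
    z ∈ gradedCentral A ↔ ∃ m, M.wordGrading.Central m z := by
  constructor
  · rintro ⟨m, x, rfl, h⟩
    refine ⟨m, ⟨_, (M.of_eq_toExtAlgebra m x).symm⟩, ?_⟩
    rintro n _ ⟨c, rfl⟩
    exact h n _
  · rintro ⟨m, ⟨c, rfl⟩, h⟩
    exact ⟨m, _, rfl, fun n y => h n _ ⟨_, (M.of_eq_toExtAlgebra n y).symm⟩⟩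

/-- The graded centre of the Ext algebra of a monomial algebra, modulo nilpotents, is a graded
subalgebra of a finite product of polynomial rings. -/
theorem exists_algEquiv [Nonempty V] (M : MonomialPresentation K A V α) :
    ∃ (ι : Type u) (_ : Finite ι) (H : Subalgebra K (ι → Polynomial K)),
      (∀ h ∈ H, ∀ n, (fun i => Polynomial.monomial n ((h i).coeff n)) ∈ H) ∧
      Nonempty (GradedCentreModNil K A ≃ₐ[K] H) := by
  classical
  obtain ⟨φ, hker, hgr⟩ := WordGrading.exists_algHom (W := M.wordGrading) (gradedCentre K A) (fun x => by
    have : gradedCentral A = {z | ∃ m, M.wordGrading.Central m z} :=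
      Set.ext fun z => M.mem_gradedCentral_iff
    rw [← this]
    rfl)
  have hN : ∀ x, φ x = 0 ↔ x ∈ nilpotentIdeal K A := by
    intro x
    rw [hker, nilpotentIdeal]
    have : {z : gradedCentre K A | IsNilpotent z ∧
        ∃ m, (z : ExtAlgebra A) ∈ M.wordGrading.homogeneous m} =
        {z : gradedCentre K A | IsNilpotent z ∧ ∃ (m : ℕ) (x : SelfExt (topModule A) m),
          (z : ExtAlgebra A) = ExtAlgebra.of A m x} := by
      ext z
      refine and_congr_right fun _ => exists_congr fun m => ⟨?_, ?_⟩
      · rintro ⟨c, hc⟩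
        exact ⟨_, hc.symm⟩
      · rintro ⟨x, hx⟩
        exact ⟨_, (hx.trans (M.of_eq_toExtAlgebra m x)).symm⟩
    rw [this]
  have hrel : ∀ x y, (nilpotentIdeal K A).ringCon x y ↔ φ x = φ y := by
    intro x y
    rw [TwoSidedIdeal.rel_iff, ← hN, map_sub, sub_eq_zero]
  let ψ : GradedCentreModNil K A →ₐ[K] φ.range :=
    { toFun := fun q => Quotient.liftOn' q φ.rangeRestrict fun x y h =>
        Subtype.ext ((hrel x y).1 h)
      map_one' := map_one φ.rangeRestrict
      map_zero' := map_zero φ.rangeRestrict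
      map_mul' := by
        rintro ⟨x⟩ ⟨y⟩
        exact map_mul φ.rangeRestrict x y
      map_add' := by
        rintro ⟨x⟩ ⟨y⟩
        exact map_add φ.rangeRestrict x y
      commutes' := fun r => φ.rangeRestrict.commutes r }
  refine ⟨_, inferInstance, φ.range, hgr, ⟨AlgEquiv.ofBijective ψ ⟨?_, ?_⟩⟩⟩
  · rintro ⟨x⟩ ⟨y⟩ h
    exact Quotient.sound' ((hrel x y).2 (congrArg Subtype.val h))
  · rintro ⟨_, x, rfl⟩
    exact ⟨((x : gradedCentre K A) : (nilpotentIdeal K A).ringCon.Quotient), rfl⟩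

end Grading

end MonomialPresentation

/-! ## The presentation of a monomial algebra by its quiver -/

/-- The arrows of a quiver, in a universe that contains the path algebra. -/
abbrev Letter (_ : Type w) (V : Type u) [Quiver.{v} V] : Type (max u v w) :=
  ULift.{max u v w} (Σ i j : V, i ⟶ j)

namespace QuiverPath

variable (K : Type w) {V : Type u} [Quiver.{v} V]

/-- An arrow as a path. -/
def ofLetter {K : Type w} (a : Letter K V) : QuiverPath V := ⟨a.down.1, a.down.2.1, a.down.2.2.toPath⟩

/-- The word of a path. -/
def letters {x : V} : ∀ {y : V}, Quiver.Path x y → List (Letter K V)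
  | _, .nil => []
  | _, .cons p a => letters p ++ [(⟨⟨_, _, a⟩⟩ : Letter K V)]

/-- The source and the word of a path. -/
def code (p : QuiverPath V) : ULift.{max u v w} V × List (Letter K V) :=
  (⟨p.source⟩, letters K p.path)

theorem code_concat_ofLetter (p : QuiverPath V) (a : Letter K V)
    (h : p.target = (ofLetter a).source) :
    code K (p.concat (ofLetter a) h) = (⟨p.source⟩, letters K p.path ++ [a]) := by
  obtain ⟨x, y, p⟩ := p
  obtain ⟨⟨i, j, a⟩⟩ := a
  dsimp [ofLetter] at h
  subst h
  rfl

theorem length_concat (p q : QuiverPath V) (h) :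
    (p.concat q h).length = p.length + q.length := by
  obtain ⟨a, b, p⟩ := p
  obtain ⟨c, d, q⟩ := q
  dsimp at h
  subst h
  exact Quiver.Path.length_comp p q

end QuiverPath

namespace PathAlgebra

variable {K : Type w} [Field K] {V : Type u} [Quiver.{v} V]

variable (K) in
/-- The coefficient of a path. -/
def pathCoeff (p : QuiverPath V) : PathAlgebra K V →ₗ[K] K := Finsupp.lapply p

theorem pathCoeff_self (p : QuiverPath V) : pathCoeff K p (ofPath K p) = 1 :=
  Finsupp.single_eq_same

theorem pathCoeff_of_ne {p q : QuiverPath V} (h : p ≠ q) : pathCoeff K p (ofPath K q) = 0 :=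
  Finsupp.single_eq_of_ne h

theorem ofPath_injective : Function.Injective (ofPath K (V := V)) := fun _ _ h =>
  Finsupp.single_left_injective one_ne_zero h

theorem ofPath_mul_ofPath_of_eq {p q : QuiverPath V} (h : p.target = q.source) :
    ofPath K p * ofPath K q = ofPath K (p.concat q h) := by
  rw [ofPath_mul_ofPath, pathMul, dif_pos h]

theorem ofPath_nil_mul {x : V} {p : QuiverPath V} (h : x = p.source) :
    ofPath K (QuiverPath.nil x) * ofPath K p = ofPath K p := by
  rw [ofPath_mul_ofPath_of_eq (show (QuiverPath.nil x).target = p.source from h),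
    QuiverPath.nil_concat]

theorem ofPath_mul_nil {x : V} {p : QuiverPath V} (h : p.target = x) :
    ofPath K p * ofPath K (QuiverPath.nil x) = ofPath K p := by
  rw [ofPath_mul_ofPath_of_eq (show p.target = (QuiverPath.nil x).source from h),
    QuiverPath.concat_nil]

theorem ofPath_mul_ofPath_of_ne {p q : QuiverPath V} (h : p.target ≠ q.source) :
    ofPath K p * ofPath K q = 0 := by
  rw [ofPath_mul_ofPath, pathMul, dif_neg h]

/-- To prove a statement that is preserved by linear combinations, it is enough to check it on
the paths in the support. -/
theorem mem_of_support {f : PathAlgebra K V} (S : Submodule K (PathAlgebra K V))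
    (h : ∀ p, pathCoeff K p f ≠ 0 → ofPath K p ∈ S) : f ∈ S := by
  have : f = Finsupp.sum (show QuiverPath V →₀ K from f) fun p r => r • ofPath K p := by
    refine (Finsupp.sum_single (show QuiverPath V →₀ K from f)).symm.trans ?_
    refine Finset.sum_congr rfl fun p _ => ?_
    exact ((Finsupp.smul_single _ p 1).trans (by rw [smul_eq_mul, mul_one])).symm
  rw [this]
  exact S.sum_mem fun p hp => S.smul_mem _ (h p (Finsupp.mem_support_iff.1 hp))

variable [Fintype V]

/-- The two-sided ideal that is spanned by a set of paths that is closed under extension. -/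
def pathIdeal (P : QuiverPath V → Prop) (h₁ : ∀ p q h, P p → P (p.concat q h))
    (h₂ : ∀ p q h, P q → P (QuiverPath.concat p q h)) : TwoSidedIdeal (PathAlgebra K V) :=
  have hl : ∀ f g : PathAlgebra K V, (∀ p, pathCoeff K p g ≠ 0 → P p) →
      ∀ p, pathCoeff K p (f * g) ≠ 0 → P p := by
    intro f g hg p
    contrapose
    intro hp
    have hf : f ∈ LinearMap.ker ((pathCoeff K p).comp ((mulLin K).flip g)) := by
      refine mem_of_support _ fun q _ => ?_
      change pathCoeff K p (ofPath K q * g) = 0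
      change g ∈ LinearMap.ker ((pathCoeff K p).comp (mulLin K (ofPath K q)))
      refine mem_of_support _ fun r hr => ?_
      change pathCoeff K p (ofPath K q * ofPath K r) = 0
      rw [ofPath_mul_ofPath, pathMul]
      split_ifs with h
      · refine pathCoeff_of_ne fun e => hp ?_
        rw [e]
        exact h₂ _ _ _ (hg r hr)
      · exact map_zero _
    exact hf
  have hr : ∀ f g : PathAlgebra K V, (∀ p, pathCoeff K p f ≠ 0 → P p) →
      ∀ p, pathCoeff K p (f * g) ≠ 0 → P p := by
    intro f g hf p
    contrapose
    intro hp
    have hf : f ∈ LinearMap.ker ((pathCoeff K p).comp ((mulLin K).flip g)) := by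
      refine mem_of_support _ fun q hq => ?_
      change pathCoeff K p (ofPath K q * g) = 0
      change g ∈ LinearMap.ker ((pathCoeff K p).comp (mulLin K (ofPath K q)))
      refine mem_of_support _ fun r _ => ?_
      change pathCoeff K p (ofPath K q * ofPath K r) = 0
      rw [ofPath_mul_ofPath, pathMul]
      split_ifs with h
      · refine pathCoeff_of_ne fun e => hp ?_
        rw [e]
        exact h₁ _ _ _ (hf q hq)
      · exact map_zero _
    exact hf
  TwoSidedIdeal.mk' {f | ∀ p, pathCoeff K p f ≠ 0 → P p}
    (fun p hp => absurd (map_zero _) hp)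
    (fun {f g} hf hg p hp => by
      by_contra h
      refine hp ?_
      rw [map_add, by_contra fun h0 => h (hf p h0), by_contra fun h0 => h (hg p h0), add_zero])
    (fun {f} hf p hp => hf p fun h0 => hp (by rw [map_neg, h0, neg_zero]))
    (fun {f g} hg => hl f g hg) (fun {f g} hf => hr f g hf)

theorem mem_pathIdeal {P : QuiverPath V → Prop} {h₁ h₂} {f : PathAlgebra K V} :
    f ∈ pathIdeal (K := K) P h₁ h₂ ↔ ∀ p, pathCoeff K p f ≠ 0 → P p := by
  simp only [pathIdeal, TwoSidedIdeal.mem_mk']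
  rfl

theorem ofPath_mem_pathIdeal {P : QuiverPath V → Prop} {h₁ h₂} {p : QuiverPath V} (hp : P p) :
    ofPath K p ∈ pathIdeal (K := K) P h₁ h₂ := by
  rw [mem_pathIdeal]
  intro q hq
  by_cases h : q = p
  · exact h ▸ hp
  · exact absurd (pathCoeff_of_ne h) hq

end PathAlgebra

section Presentation

open PathAlgebra QuiverPath

variable {K : Type w} [Field K] {V : Type u} [Fintype V] [Quiver.{v} V]
  {I : TwoSidedIdeal (PathAlgebra K V)}

/-- The paths of length at least two span an ideal that contains the generators. It follows that
vertices and arrows survive in the quotient. -/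
theorem IsMonomialIdeal.two_le_length (hI : IsMonomialIdeal I) {f : PathAlgebra K V} (hf : f ∈ I)
    {p : QuiverPath V} (hp : pathCoeff K p f ≠ 0) : 2 ≤ p.length := by
  obtain ⟨S, hS, rfl⟩ := hI
  have : TwoSidedIdeal.span (ofPath K '' S) ≤ pathIdeal (K := K) (fun p => 2 ≤ p.length)
      (fun p q h hp => by rw [length_concat]; omega)
      (fun p q h hq => by rw [length_concat]; omega) := by
    rw [TwoSidedIdeal.span_le]
    rintro _ ⟨p, hp, rfl⟩
    exact ofPath_mem_pathIdeal (hS p hp)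
  exact mem_pathIdeal.1 (this hf) p hp

/-- A monomial ideal contains the paths in the support of its elements. -/
theorem IsMonomialIdeal.ofPath_mem (hI : IsMonomialIdeal I) {f : PathAlgebra K V} (hf : f ∈ I)
    {p : QuiverPath V} (hp : pathCoeff K p f ≠ 0) : ofPath K p ∈ I := by
  have h : I ≤ pathIdeal (K := K) (fun p => ofPath K p ∈ I)
      (fun p q h hp => by
        have := I.mul_mem_right _ (ofPath K q) hp
        rwa [ofPath_mul_ofPath_of_eq h] at this)
      (fun p q h hq => by
        have := I.mul_mem_left (ofPath K p) _ hq
        rwa [ofPath_mul_ofPath_of_eq h] at this) := by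
    obtain ⟨S, hS, rfl⟩ := hI
    rw [TwoSidedIdeal.span_le]
    rintro _ ⟨p, hp, rfl⟩
    exact ofPath_mem_pathIdeal (TwoSidedIdeal.subset_span ⟨p, hp, rfl⟩)
  exact mem_pathIdeal.1 (h hf) p hp

theorem IsMonomialIdeal.ofPath_notMem (hI : IsMonomialIdeal I) {p : QuiverPath V}
    (hp : p.length < 2) : ofPath K p ∉ I := fun h => by
  have := hI.two_le_length h (p := p) (by rw [pathCoeff_self]; exact one_ne_zero)
  omega

variable (I) in
/-- The class of an element of the path algebra. -/
abbrev toMonomial : PathAlgebra K V →ₐ[K] I.ringCon.Quotient := I.ringCon.mkₐ K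

theorem toMonomial_eq_zero_iff {f : PathAlgebra K V} : toMonomial I f = 0 ↔ f ∈ I := by
  rw [← sub_zero f, ← TwoSidedIdeal.rel_iff I f 0, sub_zero, ← map_zero (toMonomial I)]
  exact Quotient.eq''

/-- The element of the path algebra that is given by a word. -/
def wordPath (x : ULift.{max u v w} V) (l : List (Letter K V)) : PathAlgebra K V :=
  ofPath K (QuiverPath.nil x.down) * (l.map fun a => ofPath K (ofLetter a)).prod

theorem wordPath_append (x : ULift.{max u v w} V) (l m : List (Letter K V)) :
    wordPath x (l ++ m) = wordPath x l * (m.map fun a => ofPath K (ofLetter a)).prod := by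
  rw [wordPath, wordPath, List.map_append, List.prod_append, mul_assoc]

theorem wordPath_code (p : QuiverPath V) :
    wordPath (code K p).1 (code K p).2 = ofPath K p := by
  obtain ⟨x, y, p⟩ := p
  induction p with
  | nil => exact mul_one _
  | cons p a ih =>
    change wordPath _ (letters K p ++ [_]) = _
    rw [wordPath_append]
    refine (congrArg (· * _) ih).trans ?_
    rw [List.map_singleton, List.prod_singleton, ofPath_mul_ofPath_of_eq rfl]
    rfl

theorem code_injective : Function.Injective (code K (V := V)) := fun p q h =>
  ofPath_injective (K := K) (by rw [← wordPath_code, ← wordPath_code, h])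

theorem wordPath_eq (x : ULift.{max u v w} V) (l : List (Letter K V)) :
    wordPath x l = 0 ∨ ∃ p, code K p = (x, l) ∧ wordPath x l = ofPath K p := by
  induction l using List.reverseRecOn with
  | nil => exact Or.inr ⟨QuiverPath.nil x.down, rfl, mul_one _⟩
  | append_singleton l a ih =>
    rw [wordPath_append, List.map_singleton, List.prod_singleton]
    rcases ih with h | ⟨p, hp, h⟩
    · left
      rw [h, zero_mul]
    · rw [h, ofPath_mul_ofPath, pathMul]
      split_ifs with hpa
      · refine Or.inr ⟨_, ?_, rfl⟩
        rw [code_concat_ofLetter]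
        rw [code] at hp
        cases hp
        rfl
      · exact Or.inl rfl

open Classical in
/-- The coefficient of a path in a monomial algebra. -/
def IsMonomialIdeal.quotientCoeff (hI : IsMonomialIdeal I) (p : QuiverPath V) :
    I.ringCon.Quotient →ₗ[K] K where
  toFun q := Quotient.liftOn' q (fun f => if ofPath K p ∈ I then 0 else pathCoeff K p f) (by
    intro f g h
    have h' : f - g ∈ I := (TwoSidedIdeal.rel_iff I f g).1 h
    split_ifs with hp
    · rfl
    · rw [← sub_eq_zero, ← map_sub]
      exact by_contra fun h0 => hp (hI.ofPath_mem h' h0))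
  map_add' := by
    rintro ⟨f⟩ ⟨g⟩
    change (if ofPath K p ∈ I then 0 else pathCoeff K p (f + g)) =
      (if ofPath K p ∈ I then 0 else pathCoeff K p f) +
      (if ofPath K p ∈ I then 0 else pathCoeff K p g)
    split_ifs <;> simp
  map_smul' := by
    rintro r ⟨f⟩
    change (if ofPath K p ∈ I then 0 else pathCoeff K p (r • f)) =
      r • (if ofPath K p ∈ I then 0 else pathCoeff K p f)
    split_ifs <;> simp

theorem IsMonomialIdeal.quotientCoeff_apply (hI : IsMonomialIdeal I) {p : QuiverPath V}
    (hp : ofPath K p ∉ I) (f : PathAlgebra K V) :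
    hI.quotientCoeff p (toMonomial I f) = pathCoeff K p f := if_neg hp

open Classical in
theorem IsMonomialIdeal.quotientCoeff_of_ne (hI : IsMonomialIdeal I) {p q : QuiverPath V}
    (h : p ≠ q) : hI.quotientCoeff p (toMonomial I (ofPath K q)) = 0 := by
  change (if ofPath K p ∈ I then 0 else pathCoeff K p (ofPath K q)) = 0
  rw [pathCoeff_of_ne h, ite_self]

theorem map_wordPath (x : ULift.{max u v w} V) (l : List (Letter K V)) :
    toMonomial I (ofPath K (QuiverPath.nil x.down)) *
      (l.map fun a => toMonomial I (ofPath K (ofLetter a))).prod =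
    toMonomial I (wordPath x l) := by
  rw [wordPath, map_mul, map_list_prod, List.map_map]
  rfl

/-- The functionals `quotientCoeff` separate the classes of these paths, which are thus linearly
independent in a finite-dimensional space. -/
theorem finite_setOf_ofPath_notMem (hI : IsMonomialIdeal I)
    [FiniteDimensional K I.ringCon.Quotient] : {p : QuiverPath V | ofPath K p ∉ I}.Finite := by
  have hli : LinearIndependent K
      fun p : {p : QuiverPath V | ofPath K p ∉ I} => toMonomial I (ofPath K p.1) := by
    rw [linearIndependent_iff']
    intro s c hc p hp
    have := congrArg (hI.quotientCoeff p.1) hc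
    rw [map_sum, map_zero, Finset.sum_eq_single p] at this
    · rwa [map_smul, hI.quotientCoeff_apply p.2, pathCoeff_self, smul_eq_mul, mul_one] at this
    · intro q _ hq
      rw [map_smul, hI.quotientCoeff_of_ne (fun h => hq (Subtype.ext h.symm)), smul_zero]
    · exact fun h => absurd hp h
  have := hli.finite_of_isNoetherian
  exact Set.toFinite _

open Classical in
/-- The presentation of a monomial algebra by its quiver. -/
def IsMonomialIdeal.presentation (hI : IsMonomialIdeal I)
    [FiniteDimensional K I.ringCon.Quotient] :
    MonomialPresentation K I.ringCon.Quotient (ULift.{max u v w} V) (Letter K V) where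
  src a := ⟨a.down.1⟩
  tgt a := ⟨a.down.2.1⟩
  vert x := toMonomial I (ofPath K (QuiverPath.nil x.down))
  arrow a := toMonomial I (ofPath K (ofLetter a))
  vert_mul_self x := by
    exact (map_mul _ _ _).symm.trans (congrArg _ (ofPath_nil_mul rfl))
  vert_mul_of_ne {x y} h := by
    rw [← map_mul, ofPath_mul_ofPath_of_ne fun e => h (ULift.ext _ _ e), map_zero]
  sum_vert := by
    rw [← map_sum, ← map_one (toMonomial I), one_def]
    congr 1
    exact Fintype.sum_equiv Equiv.ulift _ _ fun _ => rfl
  vert_mul_arrow a := by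
    exact (map_mul _ _ _).symm.trans (congrArg _ (ofPath_nil_mul rfl))
  arrow_mul_vert a := by
    exact (map_mul _ _ _).symm.trans (congrArg _ (ofPath_mul_nil rfl))
  vert_ne_zero x := by
    rw [Ne, toMonomial_eq_zero_iff]
    exact hI.ofPath_notMem (show 0 < 2 by norm_num)
  -- A word that is not composable from `x` is the code of no path and gets the coefficient zero.
  coeff x l := if h : ∃ p, code K p = (x, l) then hI.quotientCoeff h.choose else 0
  coeff_self x l h := by
    rw [map_wordPath] at h ⊢
    rcases wordPath_eq (K := K) x l with h0 | ⟨p, hp, he⟩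
    · rw [h0, map_zero] at h
      exact absurd rfl h
    · have hex : ∃ p, code K p = (x, l) := ⟨p, hp⟩
      rw [dif_pos hex, code_injective (hex.choose_spec.trans hp.symm), he,
        hI.quotientCoeff_apply, pathCoeff_self]
      rwa [he, Ne, toMonomial_eq_zero_iff] at h
  coeff_of_ne {x y l m} h := by
    rw [map_wordPath]
    rcases wordPath_eq (K := K) y m with h0 | ⟨p, hp, he⟩
    · rw [h0, map_zero, map_zero]
    · split_ifs with hex
      · rw [he, hI.quotientCoeff_of_ne]
        intro hpe
        exact h (by rw [← hex.choose_spec, hpe, hp])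
      · rfl
  span_eq_top := by
    refine Submodule.eq_top_iff'.2 fun a => ?_
    obtain ⟨f, rfl⟩ := I.ringCon.mkₐ_surjective (α := K) a
    refine mem_of_support (Submodule.comap (toMonomial I).toLinearMap (Submodule.span K _))
      fun p _ => ?_
    refine Submodule.subset_span ⟨code K p, ?_⟩
    exact (map_wordPath _ _).trans (congrArg _ (wordPath_code p))
  finite_paths := by
    refine ((finite_setOf_ofPath_notMem hI).image (code K)).subset ?_
    rintro ⟨x, l⟩ h
    change _ ≠ _ at h
    rw [map_wordPath] at h
    rcases wordPath_eq (K := K) x l with h0 | ⟨p, hp, he⟩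
    · rw [h0, map_zero] at h
      exact absurd rfl h
    · refine ⟨p, fun hpI => h ?_, hp⟩
      rwa [he, toMonomial_eq_zero_iff]

end Presentation

end

theorem mainTheorem2 {K : Type w} [Field K] {V : Type u} [Fintype V] [Quiver.{v} V]
    (I : TwoSidedIdeal (PathAlgebra K V)) (hI : IsMonomialIdeal I)
    [FiniteDimensional K I.ringCon.Quotient]
    (hind : IsIndecomposableRing I.ringCon.Quotient) :
    ∃ hcomm : ∀ x y : GradedCentreModNil K I.ringCon.Quotient, x * y = y * x,
      Algebra.FiniteType K (GradedCentreModNil K I.ringCon.Quotient) ∧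
      letI : CommRing (GradedCentreModNil K I.ringCon.Quotient) :=
        { (inferInstance : Ring (GradedCentreModNil K I.ringCon.Quotient)) with
          mul_comm := hcomm }
      ringKrullDim (GradedCentreModNil K I.ringCon.Quotient) ≤ 1 := by
  -- Without vertices the unit would be an empty sum, contrary to the algebra being nonzero.
  have hne : Nonempty (ULift.{max u v w} V) := by
    by_contra h
    rw [not_nonempty_iff] at h
    have := hind.1
    refine one_ne_zero (α := I.ringCon.Quotient) ?_
    rw [← hI.presentation.sum_vert, Finset.univ_eq_empty, Finset.sum_empty]
  obtain ⟨ι, _, H, hH, ⟨e⟩⟩ := hI.presentation.exists_algEquiv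
  have hcomm : ∀ x y : GradedCentreModNil K I.ringCon.Quotient, x * y = y * x := fun x y =>
    e.injective (by rw [map_mul, map_mul, mul_comm])
  refine ⟨hcomm, (finiteType_of_graded hH).equiv e.symm, ?_⟩
  let : CommRing (GradedCentreModNil K I.ringCon.Quotient) :=
    { (inferInstance : Ring (GradedCentreModNil K I.ringCon.Quotient)) with mul_comm := hcomm }
  exact (ringKrullDim_eq_of_ringEquiv e.toRingEquiv).trans_le ringKrullDim_subalgebra_le_one
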